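/- **Setting.** Let $G$ be a DAG on $V=\{1,\dots,p\}$, $p\ge 1$, with parents $\mathrm{Pa}(j)$, non-descendants $\mathrm{Nd}(j)$ (excluding $j$) and skeleton neighbourhoods $\mathcal N(j)$. Let $X=(X_1,\dots,X_p)$ take values in $\mathbb N^p$ (with $0\in\mathbb N$). Its law is a *GHD DAG model* for $G$ with known parameters $a(j)=(a_{j1},\dots)$, $b(j)=(b_{j1},\dots)$ (finite real lists, no $b_{jk}$ a non-positive integer) if $P(X=x)=\prod_j P(X_j=x_j\mid X_{\mathrm{Pa}(j)}=x_{\mathrm{Pa}(j)})$ and, given $X_{\mathrm{Pa}(j)}=x$ (for every $x$ of positive probability), $X_j$ has probability generating function $s\mapsto F[a(j);b(j);\theta_j(x)(s-1)]$ near $s=1$, for some real $\theta_j(x)$. Here $F[a;b;z]=\sum_{m\ge0}\frac{\prod_i\langle a_i\rangle^m}{\prod_k\langle b_k\rangle^m}\frac{z^m}{m!}$ and $\langle u\rangle^m=u(u+1)\cdots(u+m-1)$. For an integer $r\ge2$ put $f_j(x)=x^r\prod_i\frac{\langle a_{ji}\rangle^r}{a_{ji}^r}\prod_k\frac{b_{jk}^r}{\langle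 b_{jk}\rangle^r}$. Let $s(r,k)$ be the signed Stirling numbers of the first kind. For a sequence of moments $m=(m_0,m_1,\dots)$ let $$R_j(m)=\frac{m_r}{f_j(m_1)-\sum_{k=0}^{r-1}s(r,k)\,m_k},$$ with $R_j(m)=0$ if the denominator is $0$. **Algorithm (MRS, with the true skeleton).** Given samples $X^{(1)},\dots,X^{(n)}$ and an integer $N_{\min}\ge1$, write $\widehat{\mathbb E}(X_j^k\mid X_S=x)$ for the average of $(X_j^{(i)})^k$ over the samples with $X_S^{(i)}=x$. Let $n_S(x)$ be the number of these samples if it is at least $N_{\min}$, and $0$ otherwise, and let $n_S=\sum_x n_S(x)$. For $m=1,\dots,p$ in turn, the algorithm chooses $\widehat\pi_m\in V\setminus\{\widehat\pi_1,\dots,\widehat\pi_{m-1}\}$ minimizing $\widehat{\mathcal S}(m,j)$ over $j$ in this set, with ties broken arbitrarily. Here $\widehat{\mathcal S}(1,j)=R_j\big((\widehat{\mathbb E}(X_j^k))_k\big)$ uses all samples and, for $m\ge2$, $$\widehat{\mathcal S}(m,j)=\sum_x\frac{n_C(x)}{n_C}\,R_j\big((\widehat{\mathbb E}(X_j^k\mid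 X_C=x))_k\big),\qquad C=\mathcal N(j)\cap\{\widehat\pi_1,\dots,\widehat\pi_{m-1}\},$$ which is $0$ if $n_C=0$. Let $\mathcal E$ be the set of orderings in which every node comes after all its parents. Let $\{\widehat\pi\in\mathcal E\}$ be the event that the algorithm returns an element of $\mathcal E$, however ties are broken. **Assumptions.** For every $j\in V$, every non-empty $\mathrm{Pa}_0\subseteq\mathrm{Pa}(j)$ and every $S\subseteq\mathrm{Nd}(j)\setminus\mathrm{Pa}_0$: * (A1) $R_j\big((\mathbb E(X_j^k\mid X_S=x))_k\big)>1+M_{\min}$ for all $x$ with $P(X_S=x)>0$, where $M_{\min}>0$ is a constant; * (A3) (an event about the sample) some value $x$ has $\#\{i: X_S^{(i)}=x\}\ge N_{\min}$. For every $j\in V$: * (A2) $\mathbb E(e^{X_j}\mid X_{\mathrm{Pa}(j)}=x)<V_1$ for all $x$ with $P(X_{\mathrm{Pa}(j)}=x)>0$, where $V_1$ is a constant. **Theorem.** Let $r\ge2$, $d\ge0$ be integers, $M_{\min}>0$, $V_1\in\mathbb R$, $K>0$, $\varepsilon>0$. Consider a GHD DAG model with indegree at most $d$ that satisfies (A1)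 and (A2) with these constants. Then there is a constant $C_\varepsilon>0$ such that for all integers $N_{\min}\ge1$ and $n$ with $$n> C_\varepsilon\,\log^{2r+d}(\max(n,p))\,(\log p+\log r),$$ the MRS algorithm run on $n$ i.i.d. samples from the model satisfies: 1. with probability at least $1-\varepsilon$, either (A3) fails or $\widehat\pi\in\mathcal E$ (in particular, $P(\widehat\pi\in\mathcal E)\ge1-\varepsilon$ if (A3) holds almost surely); 2. if $N_{\min}\le K\log^{2r}(\max(n,p))\,(\log p+\log r)$, then $P(\widehat\pi\in\mathcal E)\ge1-\varepsilon$, with no assumption (A3). Moreover, for every $\gamma>0$ there is a constant $C_\varepsilon>0$, depending only on $\varepsilon,r,d,M_{\min},V_1,K,\gamma$ (not on $p$, the graph or the model), for which the same two conclusions hold simultaneously for all $p\ge1$ and all such models that also satisfy $\mathbb E(X_j\mid X_{\mathrm{Pa}(j)}=x)\ge\gamma$ for all $j$ and all $x$ with $P(X_{\mathrm{Pa}(j)}=x)>0$. -/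

import Mathlib

open MeasureTheory ProbabilityTheory

/-! ## Directed acyclic graphs -/

/-- A directed acyclic graph on the nodes `Fin p`; `edge j k` means `j → k`. -/
structure DAG (p : ℕ) where
  edge : Fin p → Fin p → Prop
  acyclic : ∀ j, ¬ Relation.TransGen edge j j

namespace DAG

variable {p : ℕ} (G : DAG p)

open Classical in
/-- The parents of `k`. -/
noncomputable def parents (k : Fin p) : Finset (Fin p) :=
  Finset.univ.filter fun j => G.edge j k

open Classical in
/-- The descendants of `k`: nodes reached from `k` by a directed path. -/
noncomputable def descendants (k : Fin p) : Finset (Fin p) :=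
  Finset.univ.filter fun l => Relation.TransGen G.edge k l

open Classical in
/-- The non-descendants of `k`: `V \ ({k} ∪ De(k))`. -/
noncomputable def nonDescendants (k : Fin p) : Finset (Fin p) :=
  Finset.univ \ ({k} ∪ G.descendants k)

open Classical in
/-- The neighbourhood of `j` in the skeleton. -/
noncomputable def neighbors (j : Fin p) : Finset (Fin p) :=
  Finset.univ.filter fun k => G.edge j k ∨ G.edge k j

/-- The ordering `π 0, π 1, …, π (p-1)` is consistent with the DAG: for every edge `j → k`, the
node `j` comes before `k`. -/
def IsOrdering (π : Equiv.Perm (Fin p)) : Prop :=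
  ∀ j k, G.edge j k → π.symm j < π.symm k

end DAG

/-! ## Generalized hypergeometric distributions and DAG models -/

/-- The known parameters `a = (a_1, …)` and `b = (b_1, …)` of a generalized hypergeometric
distribution. -/
structure GHDParam where
  a : List ℝ
  b : List ℝ

namespace GHDParam

/-- The `m`-th term of the generalized hypergeometric series; `(ascPochhammer ℝ m).eval u` is the
rising factorial `u (u+1) ⋯ (u+m-1)`. -/
noncomputable def term (q : GHDParam) (z : ℝ) (m : ℕ) : ℝ :=
  (q.a.map fun u => (ascPochhammer ℝ m).eval u).prod * z ^ m /
    ((q.b.map fun u => (ascPochhammer ℝ m).eval u).prod * (m.factorial : ℝ))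

/-- The generalized hypergeometric function `F[a; b; z]`. -/
noncomputable def hyp (q : GHDParam) (z : ℝ) : ℝ := ∑' m, q.term z m

/-- The probability mass function `w` on `ℕ` is generalized hypergeometric with parameters
`a, b, θ`: no `b_k` is a non-positive integer, and the probability generating function
`∑ w(k) s^k` is `F[a; b; θ (s - 1)]` around `s = 1` (which determines `w`). -/
def IsGHD (q : GHDParam) (θ : ℝ) (w : ℕ → ℝ) : Prop :=
  (∀ u ∈ q.b, ∀ m : ℕ, u ≠ -(m : ℝ)) ∧
  ∃ δ > 0, ∀ s : ℝ, |s - 1| < δ →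
    Summable (q.term (θ * (s - 1))) ∧
    HasSum (fun k => w k * s ^ k) (q.hyp (θ * (s - 1)))

/-- The `r`-th factorial constant moments ratio (CMR) function
`f^{(r)}(x; a, b) = x^r ∏ (a_i+r-1)_r / a_i^r ∏ b_k^r / (b_k+r-1)_r`; the falling factorial
`(u+r-1)_r` is the rising factorial `u (u+1) ⋯ (u+r-1)`. -/
noncomputable def cmr (q : GHDParam) (r : ℕ) (x : ℝ) : ℝ :=
  x ^ r * (q.a.map fun u => (ascPochhammer ℝ r).eval u / u ^ r).prod *
    (q.b.map fun u => u ^ r / (ascPochhammer ℝ r).eval u).prod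

end GHDParam

/-- The event `X_S = x`. -/
def cyl {p : ℕ} (S : Finset (Fin p)) (x : S → ℕ) : Set (Fin p → ℕ) := {y | S.restrict y = x}

/-- The law `μ` of `X = (X_1, …, X_p)` is a GHD DAG model for `G` with the parameters `par`:
it factorizes as `P(x) = ∏ P(x_j | x_{Pa(j)})`, and, for every parent configuration `x` of positive
probability, the conditional law of `X_j` given `X_{Pa(j)} = x` is generalized hypergeometric with
parameters `a(j)`, `b(j)` and `θ_j(x)`. -/
structure IsGHDModel {p : ℕ} (G : DAG p) (μ : Measure (Fin p → ℕ)) (par : Fin p → GHDParam) :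
    Prop where
  factor : ∀ x : Fin p → ℕ,
    μ {x} = ∏ j, (μ[|cyl (G.parents j) ((G.parents j).restrict x)]) {y | y j = x j}
  ghd : ∀ j, ∃ θ : (G.parents j → ℕ) → ℝ, ∀ x, μ (cyl (G.parents j) x) ≠ 0 →
    (par j).IsGHD (θ x) fun k => (μ[|cyl (G.parents j) x]).real {y | y j = k}

/-! ## The moments ratio -/

/-- Signed Stirling numbers of the first kind: `(x)_r = ∑ s(r,k) x^k`. -/
def stirlingS (r k : ℕ) : ℤ := (-1) ^ (r - k) * (Nat.stirlingFirst r k : ℤ)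

/-- The `r`-th moments ratio `m_r / (f^{(r)}(m_1) - ∑_{k<r} s(r,k) m_k)` of a sequence of moments
`m_0, m_1, …`, for the CMR function given by `q`. It is `0` if the denominator vanishes. -/
noncomputable def momentsRatio (q : GHDParam) (r : ℕ) (m : ℕ → ℝ) : ℝ :=
  m r / (q.cmr r (m 1) - ∑ k ∈ Finset.range r, (stirlingS r k : ℝ) * m k)

/-- The conditional moment `E(X_j^k | X_S = x)`. -/
noncomputable def condMoment {p : ℕ} (μ : Measure (Fin p → ℕ)) (S : Finset (Fin p)) (x : S → ℕ)
    (j : Fin p) (k : ℕ) : ℝ :=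
  ∫ y, (y j : ℝ) ^ k ∂(μ[|cyl S x])

/-! ## The MRS algorithm -/

/-- A data set of `n` samples of a `p`-variate count vector. -/
abbrev Data (n p : ℕ) := Fin n → Fin p → ℕ

section Algorithm

variable {n p : ℕ}

/-- The samples `i` with `X_S^{(i)} = x`. -/
def cell (D : Data n p) (S : Finset (Fin p)) (x : S → ℕ) : Finset (Fin n) :=
  Finset.univ.filter fun i => S.restrict (D i) = x

/-- The method of moments estimate of the `k`-th moment of `X_j` from the samples in `I`. -/
noncomputable def empMoment (D : Data n p) (I : Finset (Fin n)) (j : Fin p) (k : ℕ) : ℝ :=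
  (∑ i ∈ I, (D i j : ℝ) ^ k) / (I.card : ℝ)

/-- The truncated conditional sample size `n(x_S)`: the number of samples with `X_S = x` if this is
at least `Nmin`, and `0` otherwise. -/
def truncCount (Nmin : ℕ) (D : Data n p) (S : Finset (Fin p)) (x : S → ℕ) : ℕ :=
  if Nmin ≤ (cell D S x).card then (cell D S x).card else 0

/-- The configurations `x ∈ 𝒳_S` that occur in the data (all others have no samples). -/
def observed (D : Data n p) (S : Finset (Fin p)) : Finset (S → ℕ) :=
  Finset.univ.image fun i => S.restrict (D i)

/-- The total truncated conditional sample size `n_S`. -/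
def totalCount (Nmin : ℕ) (D : Data n p) (S : Finset (Fin p)) : ℕ :=
  ∑ x ∈ observed D S, truncCount Nmin D S x

/-- The `r`-th moments ratio score of the node `j` when the nodes in `A` have already been ordered:
for the first element of the ordering it is the moments ratio of the whole sample; afterwards it is
the average, over the values `x` of the candidate parents `C = N(j) ∩ A`, of the conditional moments
ratios, with weights `n(x) / n_C`. -/
noncomputable def score (nbr : Fin p → Finset (Fin p)) (par : Fin p → GHDParam) (r Nmin : ℕ)
    (D : Data n p) (A : Finset (Fin p)) (j : Fin p) : ℝ :=
  if A = ∅ then momentsRatio (par j) r (empMoment D Finset.univ j)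
  else ∑ x ∈ observed D (nbr j ∩ A),
    (truncCount Nmin D (nbr j ∩ A) x : ℝ) / (totalCount Nmin D (nbr j ∩ A) : ℝ) *
      momentsRatio (par j) r (empMoment D (cell D (nbr j ∩ A) x) j)

/-- The nodes `π 0, …, π (m-1)` that precede position `m`. -/
def before (π : Equiv.Perm (Fin p)) (m : Fin p) : Finset (Fin p) :=
  Finset.univ.filter fun k => π.symm k < m

/-- `π` is an ordering that the MRS algorithm can return on the data `D`, for the skeleton `nbr` and
the known parameters `par`: each element minimizes the score among the nodes not yet ordered (for
the last element this is no condition). Ties may be broken in any way. -/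
def IsMRSOrdering (nbr : Fin p → Finset (Fin p)) (par : Fin p → GHDParam) (r Nmin : ℕ)
    (D : Data n p) (π : Equiv.Perm (Fin p)) : Prop :=
  ∀ m : Fin p, ∀ j, j ∉ before π m →
    score nbr par r Nmin D (before π m) (π m) ≤ score nbr par r Nmin D (before π m) j

/-- Run with the true skeleton, the MRS algorithm returns an ordering that is consistent with `G`,
however ties are broken. -/
def MRSRecovers (G : DAG p) (par : Fin p → GHDParam) (r Nmin : ℕ) (D : Data n p) : Prop :=
  ∀ π, IsMRSOrdering G.neighbors par r Nmin D π → G.IsOrdering π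

end Algorithm

/-! ## The assumptions -/

/-- Separation with constant `M`: if `S` consists of non-descendants of `j` and misses a non-empty set
`Pa₀` of parents of `j`, the conditional moments ratio of `X_j` given `X_S` exceeds `1 + M`. -/
def RatioGap {p : ℕ} (G : DAG p) (μ : Measure (Fin p → ℕ)) (par : Fin p → GHDParam)
    (r : ℕ) (M : ℝ) : Prop :=
  ∀ j, ∀ Pa₀ ⊆ G.parents j, Pa₀.Nonempty → ∀ S ⊆ G.nonDescendants j \ Pa₀,
    ∀ x : S → ℕ, μ (cyl S x) ≠ 0 → 1 + M < momentsRatio (par j) r (condMoment μ S x j)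

/-- Tail bound with constant `V`: `E(exp(X_j) | X_{Pa(j)}) < V`. -/
def ExpMomentBound {p : ℕ} (G : DAG p) (μ : Measure (Fin p → ℕ)) (V : ℝ) : Prop :=
  ∀ j, ∀ x : G.parents j → ℕ, μ (cyl (G.parents j) x) ≠ 0 →
    Integrable (fun y => Real.exp (y j)) (μ[|cyl (G.parents j) x]) ∧
    ∫ y, Real.exp (y j) ∂(μ[|cyl (G.parents j) x]) < V

/-- A condition on the data: for all `j`, `Pa₀` and `S` as in `RatioGap`, some configuration of
`X_S` occurs at least `Nmin` times. -/
def LargeCells {n p : ℕ} (G : DAG p) (Nmin : ℕ) (D : Data n p) : Prop :=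
  ∀ j, ∀ Pa₀ ⊆ G.parents j, Pa₀.Nonempty → ∀ S ⊆ G.nonDescendants j \ Pa₀,
    ∃ x : S → ℕ, Nmin ≤ (cell D S x).card

/-- The conditional means of all nodes given their parents are at least `γ`. -/
def MeansAtLeast {p : ℕ} (G : DAG p) (μ : Measure (Fin p → ℕ)) (γ : ℝ) : Prop :=
  ∀ j, ∀ x : G.parents j → ℕ, μ (cyl (G.parents j) x) ≠ 0 →
    γ ≤ condMoment μ (G.parents j) x j 1

/-- The joint law of `n` independent samples from `μ`. -/
noncomputable def sampleLaw {p : ℕ} (μ : Measure (Fin p → ℕ)) [IsProbabilityMeasure μ] (n : ℕ) :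
    Measure (Data n p) :=
  Measure.pi fun _ => μ

/-- `log^e(max(n,p)) (log p + log r)`. -/
noncomputable def logRate (e n p r : ℕ) : ℝ :=
  Real.log (max n p : ℝ) ^ e * (Real.log p + Real.log r)

/-- For every sample size `n > C log^{2r+d}(max(n,p)) (log p + log r)` and every minimum cell size
`Nmin ≥ 1`, outside an event of probability at most `ε` the MRS algorithm recovers an ordering of
`G` whenever `LargeCells` holds; and if `Nmin ≤ K log^{2r}(max(n,p)) (log p + log r)`, it recovers an
ordering with probability at least `1 - ε` outright. -/
def MRSGuarantee {p : ℕ} (G : DAG p) (μ : Measure (Fin p → ℕ)) [IsProbabilityMeasure μ]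
    (par : Fin p → GHDParam) (r d : ℕ) (K ε C : ℝ) : Prop :=
  ∀ n Nmin : ℕ, 1 ≤ Nmin → C * logRate (2 * r + d) n p r < n →
    1 - ε ≤ (sampleLaw μ n).real {D | LargeCells G Nmin D → MRSRecovers G par r Nmin D} ∧
    ((Nmin : ℝ) ≤ K * logRate (2 * r) n p r →
      1 - ε ≤ (sampleLaw μ n).real {D | MRSRecovers G par r Nmin D})

/-!
# Consistency of moments ratio scoring for GHD DAG models

**Reduction to a threshold.** As long as the nodes ordered so far form an ancestral set `A`, the
skeleton neighbours of a further node `j` that lie in `A` are exactly its parents in `A`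
(`DAG.IsAncestral.neighbors_inter`). Only conditioning sets `S ⊆ Pa(j)` therefore ever occur, and
conditional laws given `X_S` are mixtures of conditional laws given `X_{Pa(j)}`; the tower property
(`lintegral_cond_cyl_le`) replaces the Markov property of the model. Some unordered node always has
all its parents in `A`. The algorithm thus recovers an ordering as soon as the scores of complete
parent sets lie below `1 + M / 2` and those of incomplete ones above it
(`mrsRecovers_of_threshold`, `mrsRecovers_of_informative`).

**Population ratios.** Expanding the probability generating function at `s = 1` and using
uniqueness of power series, the factorial moments of a generalized hypergeometric law are explicit
(`GHDParam.IsGHD.factorial_moment`). This makes the moments ratio given all parents equal to `1`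
unless the conditional mean vanishes (`IsGHDModel.momentsRatio_eq_one`), in which case the
empirical ratio is `0`. For incomplete `S` the ratio exceeds `1 + M` by assumption. Since
`x ^ r - x (x - 1) ⋯ (x - r + 1) ≥ x ^ (r - 1)` on integers, for a nonnegative CMR coefficient the
denominator of the ratio is at least the mean, so the ratio depends continuously on the moments
(`exists_momentsRatio_stable`), and an empirical ratio never exceeds the largest value in its cell.

**A fixed model.** Only `n → ∞` matters, because for `p ≥ 2` the required sample size exceeds any
given number once the constant is large. For a finite set `F` of configurations the law of large
numbers puts all empirical ratios on the right side of the threshold (`withHighProb_onRightSide`).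
The set `F` is chosen so large that the remaining configurations are rarer than a fixed `x₀ ∈ F`;
hence they are either not counted at all, or outweighed by `x₀`. For complete parent sets their
ratios, which are not bounded, have to be controlled too: resampling one observation at a time
bounds the expected weighted ratio of a cell by the conditional moment of order `r` given that the
node is nonzero (`lintegral_weighted_average_le`). That moment is bounded uniformly in `θ`
(`tailConst`), because the `r`-th moment, the mean and the probability of being nonzero are all of
the same order. Markov's inequality concludes (`withHighProb_informative`).

**All models with means at least `γ`.** Let `Λ = log (max n p)`. With high probability all data are
at most `b = c Λ`, so that a candidate parent set has at most `(b + 1) ^ d` cells. Truncated powers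
concentrate on all cells with at least `T = τ Λ ^ (r + 1)` samples (`measureReal_hasDeviation_le`),
by a Chernoff bound whose compensator charges only the samples in the cell, so that the number of
those samples need not be conditioned on (`integral_exp_indicator_le_one`). The moments and the CMR
coefficients stay in a compact set and the denominators above `γ`, so the ratios of these cells are
uniformly accurate. The other cells hold at most `T (b + 1) ^ d` samples with ratios at most `b`;
this is negligible because `Λ ^ (r + 1) Λ ^ (d + 1)` is of lower or equal order to `Λ ^ (2 r + d)`
for `r ≥ 2` (`informative_of_bounded`). When `Nmin` is of order `Λ ^ (2 r) (log p + log r)`, the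
pigeonhole principle on the cells provides one with `Nmin` samples.
-/

/-! ### Stirling numbers, falling factorials and moments ratios -/

theorem stirlingS_succ_zero (r : ℕ) : stirlingS (r + 1) 0 = 0 := by
  simp [stirlingS, Nat.stirlingFirst_succ_zero]

theorem stirlingS_self (r : ℕ) : stirlingS r r = 1 := by
  simp [stirlingS, Nat.stirlingFirst_self]

theorem stirlingS_eq_zero_of_lt {r k : ℕ} (h : r < k) : stirlingS r k = 0 := by
  simp [stirlingS, Nat.stirlingFirst_eq_zero_of_lt h]

theorem stirlingS_succ_succ (r k : ℕ) :
    stirlingS (r + 1) (k + 1) = stirlingS r k - r * stirlingS r (k + 1) := by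
  rcases lt_trichotomy r k with h | h | h
  · simp [stirlingS_eq_zero_of_lt h, stirlingS_eq_zero_of_lt (Nat.lt_succ_of_lt h),
      stirlingS_eq_zero_of_lt (Nat.succ_lt_succ h)]
  · subst h
    simp [stirlingS_self, stirlingS_eq_zero_of_lt (Nat.lt_succ_self r)]
  · have e : r - k = (r - (k + 1)) + 1 := by omega
    simp only [stirlingS, Nat.stirlingFirst_succ_succ, Nat.add_sub_add_right, e]
    push_cast
    ring

theorem cast_descFactorial_succ (x r : ℕ) :
    ((x.descFactorial (r + 1) : ℕ) : ℝ) = ((x : ℝ) - r) * (x.descFactorial r : ℝ) := by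
  rcases le_or_gt r x with h | h
  · rw [Nat.descFactorial_succ]; push_cast [Nat.cast_sub h]; ring
  · rw [Nat.descFactorial_eq_zero_iff_lt.2 h, Nat.descFactorial_eq_zero_iff_lt.2 (by omega)]; simp

theorem cast_descFactorial_eq_sum_stirlingS (x r : ℕ) :
    (x.descFactorial r : ℝ) = ∑ k ∈ Finset.range (r + 1), (stirlingS r k : ℝ) * (x : ℝ) ^ k := by
  induction r with
  | zero => simp [stirlingS_self]
  | succ r ih =>
    rw [cast_descFactorial_succ, Finset.sum_range_succ', stirlingS_succ_zero]
    have h1 : ∑ k ∈ Finset.range (r + 1), (stirlingS (r + 1) (k + 1) : ℝ) * (x : ℝ) ^ (k + 1)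
        = (x : ℝ) * ∑ k ∈ Finset.range (r + 1), (stirlingS r k : ℝ) * (x : ℝ) ^ k
          - r * ∑ k ∈ Finset.range (r + 1), (stirlingS r (k + 1) : ℝ) * (x : ℝ) ^ (k + 1) := by
      rw [Finset.mul_sum, Finset.mul_sum, ← Finset.sum_sub_distrib]
      refine Finset.sum_congr rfl fun k _ => ?_
      rw [stirlingS_succ_succ]; push_cast; ring
    have h2 : (r : ℝ) * ∑ k ∈ Finset.range (r + 1), (stirlingS r (k + 1) : ℝ) * (x : ℝ) ^ (k + 1)
        = r * ∑ k ∈ Finset.range (r + 1), (stirlingS r k : ℝ) * (x : ℝ) ^ k := by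
      rw [Finset.sum_range_succ, stirlingS_eq_zero_of_lt (Nat.lt_succ_self r),
        Finset.sum_range_succ' (fun k => (stirlingS r k : ℝ) * (x : ℝ) ^ k)]
      rcases r with _ | r
      · simp
      · simp [stirlingS_succ_zero]
    rw [h1, h2, ← ih]; simp; ring

theorem sum_stirlingS_mul_pow (x r : ℕ) :
    ∑ k ∈ Finset.range r, (stirlingS r k : ℝ) * (x : ℝ) ^ k
      = (x.descFactorial r : ℝ) - (x : ℝ) ^ r := by
  rw [cast_descFactorial_eq_sum_stirlingS, Finset.sum_range_succ, stirlingS_self]; simp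

/-- As `r ≥ 2`, one factor of the falling factorial is `x - 1`; the others are at most `x`. -/
theorem descFactorial_add_pow_le {r : ℕ} (hr : 2 ≤ r) (x : ℕ) :
    x.descFactorial r + x ^ (r - 1) ≤ x ^ r := by
  obtain ⟨s, rfl⟩ := Nat.exists_eq_add_of_le' hr
  rcases x with _ | x
  · simp
  · have h : (x + 1).descFactorial (s + 2) ≤ (x + 1) ^ (s + 1) * x := by
      rw [Nat.succ_descFactorial_succ, pow_succ' (x + 1) s, mul_assoc]
      refine Nat.mul_le_mul_left _ ?_
      rcases x with _ | x
      · simp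
      · rw [Nat.succ_descFactorial_succ, mul_comm]
        refine Nat.mul_le_mul_right _ ((Nat.descFactorial_le_pow _ _).trans ?_)
        exact Nat.pow_le_pow_left (by omega) _
    calc _ ≤ (x + 1) ^ (s + 1) * x + (x + 1) ^ (s + 1) := by simpa using h
      _ = _ := by ring

/-- Powers are controlled by the first and the last falling factorial. -/
theorem pow_le_mul_add_descFactorial {r : ℕ} (hr : 1 ≤ r) (x : ℕ) :
    x ^ r ≤ (2 * r) ^ r * (x + x.descFactorial r) := by
  rcases lt_or_ge x (2 * r) with h | h
  · calc x ^ r = x ^ (r - 1) * x := by rw [← pow_succ, Nat.sub_add_cancel hr]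
      _ ≤ (2 * r) ^ (r - 1) * x := by gcongr
      _ ≤ (2 * r) ^ r * x := by gcongr <;> omega
      _ ≤ _ := by gcongr; omega
  · calc x ^ r ≤ (2 * (x + 1 - r)) ^ r := by gcongr; omega
      _ = 2 ^ r * (x + 1 - r) ^ r := mul_pow _ _ _
      _ ≤ (2 * r) ^ r * x.descFactorial r := by
        gcongr
        · omega
        · exact Nat.pow_sub_le_descFactorial x r
      _ ≤ _ := by gcongr; omega

theorem GHDParam.cmr_eq (q : GHDParam) (r : ℕ) (x : ℝ) : q.cmr r x = q.cmr r 1 * x ^ r := by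
  simp only [GHDParam.cmr, one_pow]; ring

theorem momentsRatio_eq (q : GHDParam) (r : ℕ) (m : ℕ → ℝ) :
    momentsRatio q r m =
      m r / (q.cmr r 1 * m 1 ^ r - ∑ k ∈ Finset.range r, (stirlingS r k : ℝ) * m k) := by
  rw [momentsRatio, GHDParam.cmr_eq]

section Empirical
variable {n p : ℕ}

theorem sum_stirlingS_mul_empMoment (D : Data n p) (I : Finset (Fin n)) (j : Fin p) (r : ℕ) :
    ∑ k ∈ Finset.range r, (stirlingS r k : ℝ) * empMoment D I j k
      = (∑ i ∈ I, (((D i j).descFactorial r : ℝ) - (D i j : ℝ) ^ r)) / I.card := by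
  simp only [← sum_stirlingS_mul_pow, empMoment]
  rw [Finset.sum_comm, Finset.sum_div]
  refine Finset.sum_congr rfl fun k _ => ?_
  rw [← Finset.mul_sum, mul_div_assoc]

/-- The moments ratio of a data set as a quotient of sums; all summands of the denominator are
nonnegative as soon as the CMR coefficient is. -/
theorem momentsRatio_empMoment_eq (q : GHDParam) (r : ℕ) (D : Data n p) (I : Finset (Fin n))
    (hI : I.Nonempty) (j : Fin p) :
    momentsRatio q r (empMoment D I j) = (∑ i ∈ I, (D i j : ℝ) ^ r) /
      (I.card * (q.cmr r 1 * empMoment D I j 1 ^ r) +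
        ∑ i ∈ I, ((D i j : ℝ) ^ r - ((D i j).descFactorial r : ℝ))) := by
  have hc : (0 : ℝ) < I.card := by exact_mod_cast hI.card_pos
  rw [momentsRatio_eq, sum_stirlingS_mul_empMoment]
  rw [empMoment, ← mul_div_mul_left _ _ hc.ne', mul_div_cancel₀ _ hc.ne', mul_sub,
    mul_div_cancel₀ _ hc.ne']
  congr 1
  rw [sub_eq_add_neg, ← Finset.sum_neg_distrib]
  congr 1
  exact Finset.sum_congr rfl fun i _ => by ring

theorem empMoment_nonneg (D : Data n p) (I : Finset (Fin n)) (j : Fin p) (k : ℕ) :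
    0 ≤ empMoment D I j k := by unfold empMoment; positivity

theorem pow_sub_descFactorial_ge {r : ℕ} (hr : 2 ≤ r) (x : ℕ) :
    (x : ℝ) ^ (r - 1) ≤ (x : ℝ) ^ r - (x.descFactorial r : ℝ) := by
  have := descFactorial_add_pow_le hr x
  have h : ((x.descFactorial r + x ^ (r - 1) : ℕ) : ℝ) ≤ ((x ^ r : ℕ) : ℝ) := by exact_mod_cast this
  push_cast at h; linarith

/-- If `X_j` vanishes on all samples, the moments ratio is `0` because its numerator is. -/
theorem momentsRatio_empMoment_of_zero (q : GHDParam) {r : ℕ} (hr : 2 ≤ r) (D : Data n p)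
    (I : Finset (Fin n)) (j : Fin p) (h : ∀ i ∈ I, D i j = 0) :
    momentsRatio q r (empMoment D I j) = 0 := by
  have : empMoment D I j r = 0 := by
    unfold empMoment
    rw [Finset.sum_eq_zero fun i hi => by rw [h i hi]; simp; omega]; simp
  rw [momentsRatio, this, zero_div]

/-- The sign of the CMR coefficient is needed only if some sample is nonzero; if `X_j` vanishes
almost surely, its law does not determine that sign. -/
theorem momentsRatio_empMoment_nonneg (q : GHDParam) {r : ℕ} (hr : 2 ≤ r) (D : Data n p)
    (I : Finset (Fin n)) (j : Fin p) (h : ∀ i ∈ I, D i j ≠ 0 → 0 ≤ q.cmr r 1) :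
    0 ≤ momentsRatio q r (empMoment D I j) := by
  by_cases h0 : ∀ i ∈ I, D i j = 0
  · rw [momentsRatio_empMoment_of_zero q hr D I j h0]
  push Not at h0
  obtain ⟨i, hi, hne⟩ := h0
  have hc := h i hi hne
  rw [momentsRatio_empMoment_eq q r D I ⟨i, hi⟩ j]
  have h1 := empMoment_nonneg D I j 1
  have h2 : 0 ≤ ∑ i ∈ I, ((D i j : ℝ) ^ r - ((D i j).descFactorial r : ℝ)) :=
    Finset.sum_nonneg fun i _ => le_trans (by positivity) (pow_sub_descFactorial_ge hr _)
  positivity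

/-- A moments ratio never exceeds `(∑ Xᵢ^r) / ∑ g(Xᵢ)` for a positive `g` below `x ↦ x^(r-1)`. -/
theorem momentsRatio_empMoment_le_div (q : GHDParam) {r : ℕ} (hr : 2 ≤ r) (D : Data n p)
    (I : Finset (Fin n)) (j : Fin p) (h : ∀ i ∈ I, D i j ≠ 0 → 0 ≤ q.cmr r 1) (g : ℕ → ℝ)
    (hg0 : ∀ x, x ≠ 0 → 0 < g x) (hg : ∀ x, g x ≤ (x : ℝ) ^ (r - 1)) (hgz : g 0 = 0) :
    momentsRatio q r (empMoment D I j) ≤ (∑ i ∈ I, (D i j : ℝ) ^ r) / ∑ i ∈ I, g (D i j) := by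
  have hg0' : ∀ x, 0 ≤ g x := fun x => by
    rcases eq_or_ne x 0 with rfl | hx
    · exact hgz.ge
    · exact (hg0 x hx).le
  by_cases h0 : ∀ i ∈ I, D i j = 0
  · rw [momentsRatio_empMoment_of_zero q hr D I j h0]
    exact div_nonneg (by positivity) (Finset.sum_nonneg fun i _ => hg0' _)
  push Not at h0
  obtain ⟨i, hi, hne⟩ := h0
  have hc := h i hi hne
  rw [momentsRatio_empMoment_eq q r D I ⟨i, hi⟩ j]
  have h1 := empMoment_nonneg D I j 1
  have h2 : ∑ i ∈ I, g (D i j) ≤ ∑ i ∈ I, ((D i j : ℝ) ^ r - ((D i j).descFactorial r : ℝ)) :=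
    Finset.sum_le_sum fun i _ => (hg _).trans (pow_sub_descFactorial_ge hr _)
  have h3 : 0 < ∑ i ∈ I, g (D i j) :=
    Finset.sum_pos' (fun i _ => hg0' _) ⟨i, hi, hg0 _ hne⟩
  refine div_le_div_of_nonneg_left (by positivity) h3 (h2.trans ?_)
  have : 0 ≤ (I.card : ℝ) * (q.cmr r 1 * empMoment D I j 1 ^ r) := by positivity
  linarith

/-- A moments ratio never exceeds the largest value in the sample: compare with `∑ Xᵢ^(r-1)`. -/
theorem momentsRatio_empMoment_le_of_le (q : GHDParam) {r : ℕ} (hr : 2 ≤ r) (D : Data n p)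
    (I : Finset (Fin n)) (j : Fin p) (h : ∀ i ∈ I, D i j ≠ 0 → 0 ≤ q.cmr r 1) (B : ℕ)
    (hB : ∀ i ∈ I, D i j ≤ B) :
    momentsRatio q r (empMoment D I j) ≤ B := by
  refine (momentsRatio_empMoment_le_div q hr D I j h (fun x => (x : ℝ) ^ (r - 1))
    (fun x hx => by positivity) (fun x => le_rfl) (by simp; omega)).trans ?_
  refine div_le_of_le_mul₀ (by positivity) (by positivity) ?_
  rw [Finset.mul_sum]
  refine Finset.sum_le_sum fun i hi => ?_
  have : (D i j : ℝ) ^ r = (D i j : ℝ) * (D i j : ℝ) ^ (r - 1) := by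
    rw [← pow_succ', Nat.sub_add_cancel (by omega)]
  rw [this]
  gcongr
  exact_mod_cast hB i hi

end Empirical

/-- Stability of the moments ratio, uniformly over a compact set of moment sequences and CMR
coefficients on which the denominator is bounded below. -/
theorem exists_momentsRatio_stable (r : ℕ) (hr : 1 ≤ r) (U γ η : ℝ) (hγ : 0 < γ) (hη : 0 < η) :
    ∃ δ > 0, ∀ (q : GHDParam) (m m' : ℕ → ℝ), |q.cmr r 1| ≤ U → (∀ k ≤ r, |m k| ≤ U) →
      γ ≤ q.cmr r 1 * m 1 ^ r - ∑ k ∈ Finset.range r, (stirlingS r k : ℝ) * m k →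
      (∀ k ≤ r, |m' k - m k| < δ) →
      |momentsRatio q r m' - momentsRatio q r m| < η := by
  let den : ℝ × (Fin (r + 1) → ℝ) → ℝ := fun z =>
    z.1 * z.2 ⟨1, by omega⟩ ^ r - ∑ k : Fin r, (stirlingS r k : ℝ) * z.2 k.castSucc
  have hden : Continuous den := by fun_prop
  let f : ℝ × (Fin (r + 1) → ℝ) → ℝ := fun z => z.2 (Fin.last r) / den z
  let s : Set (ℝ × (Fin (r + 1) → ℝ)) :=
    (Metric.closedBall 0 U) ∩ {z | γ ≤ den z}
  have hs : IsCompact s :=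
    (isCompact_closedBall _ _).inter_right (isClosed_le continuous_const hden)
  have hf : ∀ z ∈ s, ContinuousAt f z := fun z hz =>
    ContinuousAt.div (by fun_prop) hden.continuousAt (hγ.trans_le hz.2).ne'
  have := hs.uniformContinuousAt_of_continuousAt f hf (Metric.dist_mem_uniformity hη)
  obtain ⟨δ, hδ, h⟩ := Metric.mem_uniformity_dist.1 this
  refine ⟨δ, hδ, fun q m m' hc hm hd hm' => ?_⟩
  let z : (ℕ → ℝ) → ℝ × (Fin (r + 1) → ℝ) := fun m => (q.cmr r 1, fun k => m k)
  have hz : ∀ m, f (z m) = momentsRatio q r m := fun m => by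
    rw [momentsRatio_eq]
    simp only [f, den, z, Fin.val_last, Fin.val_castSucc]
    rw [Finset.sum_range]
  have hU : 0 ≤ U := (abs_nonneg _).trans hc
  have h1 : z m ∈ s := by
    refine ⟨?_, ?_⟩
    · rw [mem_closedBall_zero_iff, Prod.norm_def, max_le_iff]
      refine ⟨hc, (pi_norm_le_iff_of_nonneg hU).2 fun k => hm _ (by omega)⟩
    · simpa only [Set.mem_ofPred_eq, den, z, Fin.val_castSucc, Finset.sum_range] using hd
  have h2 : dist (z m) (z m') < δ := by
    rw [dist_comm, Prod.dist_eq, max_lt_iff]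
    refine ⟨by simpa [z] using hδ, (dist_pi_lt_iff hδ).2 fun k => hm' _ (by omega)⟩
  have h3 := h h2 h1
  simp only [Set.mem_ofPred_eq, hz, Real.dist_eq] at h3
  rwa [abs_sub_comm]

/-! ### Ancestral sets and the scores of the algorithm -/

namespace DAG
variable {p : ℕ} (G : DAG p)

theorem mem_parents {j k : Fin p} : j ∈ G.parents k ↔ G.edge j k := by simp [parents]

/-- A set of nodes that contains the parents of each of its elements. -/
def IsAncestral (A : Finset (Fin p)) : Prop := ∀ k ∈ A, G.parents k ⊆ A

variable {G}

/-- Children of a node outside an ancestral set are outside of it, so only parents are left of the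
skeleton neighbourhood. -/
theorem IsAncestral.neighbors_inter {A : Finset (Fin p)} (hA : G.IsAncestral A) {j : Fin p}
    (hj : j ∉ A) : G.neighbors j ∩ A = G.parents j ∩ A := by
  ext k
  simp only [neighbors, Finset.mem_inter, Finset.mem_filter, Finset.mem_univ, true_and,
    mem_parents]
  refine ⟨fun ⟨h, hk⟩ => ⟨h.resolve_left fun h => hj ?_, hk⟩, fun ⟨h, hk⟩ => ⟨Or.inr h, hk⟩⟩
  exact hA k hk (G.mem_parents.2 h)

variable (G) in
/-- Some node outside a proper subset `A` has all its parents in `A`, by acyclicity. -/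
theorem exists_parents_subset (A : Finset (Fin p)) (j₀ : Fin p) (hj₀ : j₀ ∉ A) :
    ∃ j ∉ A, G.parents j ⊆ A := by
  have : IsTrans (Fin p) (Relation.TransGen G.edge) := ⟨fun _ _ _ => Relation.TransGen.trans⟩
  have : Std.Irrefl (Relation.TransGen G.edge) := ⟨G.acyclic⟩
  have wf : WellFounded (Relation.TransGen G.edge) := Finite.wellFounded_of_trans_of_irrefl _
  obtain ⟨j, hj, hmin⟩ := wf.has_min {j | j ∉ A} ⟨j₀, hj₀⟩
  refine ⟨j, hj, fun k hk => by_contra fun hkA => ?_⟩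
  exact hmin k hkA (Relation.TransGen.single (G.mem_parents.1 hk))

variable (G) in
theorem parents_subset_nonDescendants (j : Fin p) : G.parents j ⊆ G.nonDescendants j := by
  intro k hk
  rw [mem_parents] at hk
  simp only [nonDescendants, descendants, Finset.mem_sdiff, Finset.mem_univ, true_and,
    Finset.mem_union, Finset.mem_singleton, Finset.mem_filter, not_or]
  refine ⟨?_, fun h => G.acyclic _ (h.tail hk)⟩
  rintro rfl
  exact G.acyclic _ (Relation.TransGen.single hk)

end DAG

section Algorithm
variable {n p : ℕ}

/-- The weighted average of conditional moments ratios that the algorithm attaches to the candidate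
parent set `S` of `j`. -/
noncomputable def cellScore (q : GHDParam) (r Nmin : ℕ) (D : Data n p) (S : Finset (Fin p))
    (j : Fin p) : ℝ :=
  ∑ x ∈ observed D S, (truncCount Nmin D S x : ℝ) / (totalCount Nmin D S : ℝ) *
    momentsRatio q r (empMoment D (cell D S x) j)

theorem mem_before {π : Equiv.Perm (Fin p)} {m k : Fin p} :
    k ∈ before π m ↔ π.symm k < m := by simp [before]

/-- The algorithm recovers an ordering if some threshold separates the scores of complete parent
sets from those of incomplete ones. -/
theorem mrsRecovers_of_threshold (G : DAG p) (par : Fin p → GHDParam) (r Nmin : ℕ) (D : Data n p)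
    (t : ℝ)
    (hgood : ∀ j, cellScore (par j) r Nmin D (G.parents j) j < t ∧
      (G.parents j = ∅ → momentsRatio (par j) r (empMoment D Finset.univ j) < t))
    (hbad : ∀ j, ∀ S ⊆ G.parents j, S ≠ G.parents j → t < cellScore (par j) r Nmin D S j ∧
      (S = ∅ → t < momentsRatio (par j) r (empMoment D Finset.univ j))) :
    MRSRecovers G par r Nmin D := by
  intro π hπ
  have key : ∀ m : Fin p, G.parents (π m) ⊆ before π m := by
    intro m
    induction m using WellFoundedLT.induction with
    | ind m ih =>
      have hanc : G.IsAncestral (before π m) := by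
        intro k hk l hl
        rw [mem_before] at hk ⊢
        have := ih _ hk
        rw [Equiv.apply_symm_apply] at this
        exact (mem_before.1 (this hl)).trans hk
      have hm : π m ∉ before π m := by simp [mem_before]
      obtain ⟨j, hj, hjp⟩ := G.exists_parents_subset _ _ hm
      have hle := hπ m j hj
      have hjt : score G.neighbors par r Nmin D (before π m) j < t := by
        unfold score
        split_ifs with h0
        · rw [h0, Finset.subset_empty] at hjp
          exact (hgood j).2 hjp
        · have := (hgood j).1
          rwa [hanc.neighbors_inter hj, Finset.inter_eq_left.2 hjp]
      by_contra hsub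
      have hne : G.parents (π m) ∩ before π m ≠ G.parents (π m) := fun h =>
        hsub (Finset.inter_eq_left.1 h)
      have hmt : t < score G.neighbors par r Nmin D (before π m) (π m) := by
        unfold score
        split_ifs with h0
        · exact (hbad (π m) _ Finset.inter_subset_left hne).2 (by rw [h0, Finset.inter_empty])
        · rw [hanc.neighbors_inter hm]
          exact (hbad (π m) _ Finset.inter_subset_left hne).1
      linarith
  intro j k hjk
  have := key (π.symm k) (by rw [Equiv.apply_symm_apply]; exact G.mem_parents.2 hjk)
  exact mem_before.1 this

theorem mem_observed {D : Data n p} {S : Finset (Fin p)} {x : S → ℕ} :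
    x ∈ observed D S ↔ ∃ i, S.restrict (D i) = x := by simp [observed]

theorem mem_cell {D : Data n p} {S : Finset (Fin p)} {x : S → ℕ} {i : Fin n} :
    i ∈ cell D S x ↔ S.restrict (D i) = x := by simp [cell]

theorem mem_observed_iff_cell_nonempty {D : Data n p} {S : Finset (Fin p)} {x : S → ℕ} :
    x ∈ observed D S ↔ (cell D S x).Nonempty := by
  rw [mem_observed]; exact exists_congr fun i => mem_cell.symm

theorem sum_card_cell (D : Data n p) (S : Finset (Fin p)) :
    ∑ x ∈ observed D S, (cell D S x).card = n := by
  have := Finset.card_eq_sum_card_image (fun i => S.restrict (D i)) (Finset.univ : Finset (Fin n))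
  rw [Finset.card_univ, Fintype.card_fin] at this
  exact this.symm

theorem truncCount_le (Nmin : ℕ) (D : Data n p) (S : Finset (Fin p)) (x : S → ℕ) :
    truncCount Nmin D S x ≤ (cell D S x).card := by unfold truncCount; split_ifs <;> simp

theorem card_cell_le_totalCount {Nmin : ℕ} (D : Data n p) (S : Finset (Fin p)) (x : S → ℕ)
    (h : Nmin ≤ (cell D S x).card) : (cell D S x).card ≤ totalCount Nmin D S := by
  by_cases hx : x ∈ observed D S
  · have h1 : truncCount Nmin D S x = (cell D S x).card := if_pos h
    rw [← h1]
    exact Finset.single_le_sum (f := truncCount Nmin D S) (fun _ _ => Nat.zero_le _) hx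
  · rw [mem_observed_iff_cell_nonempty, Finset.not_nonempty_iff_eq_empty] at hx
    simp [hx]

theorem totalCount_pos {Nmin : ℕ} (hN : 1 ≤ Nmin) (D : Data n p) (S : Finset (Fin p)) (x : S → ℕ)
    (h : Nmin ≤ (cell D S x).card) : 0 < totalCount Nmin D S := by
  have := card_cell_le_totalCount D S x h; omega

theorem cellScore_eq (q : GHDParam) (r Nmin : ℕ) (D : Data n p) (S : Finset (Fin p)) (j : Fin p) :
    cellScore q r Nmin D S j = (∑ x ∈ observed D S, (truncCount Nmin D S x : ℝ) *
      momentsRatio q r (empMoment D (cell D S x) j)) / (totalCount Nmin D S : ℝ) := by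
  rw [cellScore, Finset.sum_div]
  exact Finset.sum_congr rfl fun x _ => by ring

theorem cast_totalCount (Nmin : ℕ) (D : Data n p) (S : Finset (Fin p)) :
    (totalCount Nmin D S : ℝ) = ∑ x ∈ observed D S, (truncCount Nmin D S x : ℝ) := by
  rw [totalCount]; push_cast; rfl

open Classical in
/-- Upper bound for a score with good cells `Acc` and a small contribution of the others. -/
theorem cellScore_le (q : GHDParam) (r Nmin : ℕ) (D : Data n p) (S : Finset (Fin p)) (j : Fin p)
    (Acc : Set (S → ℕ)) {u η : ℝ} (hu : 0 ≤ u) (hη : 0 ≤ η)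
    (hacc : ∀ x ∈ observed D S, x ∈ Acc → momentsRatio q r (empMoment D (cell D S x) j) ≤ u)
    (hinacc : ∑ x ∈ (observed D S).filter (· ∉ Acc), (truncCount Nmin D S x : ℝ) *
      momentsRatio q r (empMoment D (cell D S x) j) ≤ η * totalCount Nmin D S) :
    cellScore q r Nmin D S j ≤ u + η := by
  rw [cellScore_eq]
  refine div_le_of_le_mul₀ (by positivity) (by positivity) ?_
  rw [← Finset.sum_filter_add_sum_filter_not _ (· ∈ Acc), add_mul]
  refine add_le_add ?_ hinacc
  rw [cast_totalCount, Finset.mul_sum]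
  calc _ ≤ ∑ x ∈ (observed D S).filter (· ∈ Acc), u * (truncCount Nmin D S x : ℝ) := by
        refine Finset.sum_le_sum fun x hx => ?_
        rw [Finset.mem_filter] at hx
        rw [mul_comm]
        exact mul_le_mul_of_nonneg_right (hacc x hx.1 hx.2) (by positivity)
    _ ≤ _ := Finset.sum_le_sum_of_subset_of_nonneg (Finset.filter_subset _ _)
        fun x _ _ => by positivity

open Classical in
/-- Lower bound for a score with good cells `Acc` and a small weight of the others. -/
theorem le_cellScore (q : GHDParam) (r Nmin : ℕ) (D : Data n p) (S : Finset (Fin p)) (j : Fin p)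
    (Acc : Set (S → ℕ)) {l η : ℝ} (hl : 0 ≤ l)
    (hnn : ∀ x, 0 ≤ momentsRatio q r (empMoment D (cell D S x) j))
    (hacc : ∀ x ∈ observed D S, x ∈ Acc → l ≤ momentsRatio q r (empMoment D (cell D S x) j))
    (hinacc : ∑ x ∈ (observed D S).filter (· ∉ Acc), (truncCount Nmin D S x : ℝ)
      ≤ η * totalCount Nmin D S) (hpos : 0 < totalCount Nmin D S) :
    (1 - η) * l ≤ cellScore q r Nmin D S j := by
  have hpos' : (0 : ℝ) < totalCount Nmin D S := by exact_mod_cast hpos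
  rw [cellScore_eq, le_div_iff₀ hpos']
  have hsplit : (totalCount Nmin D S : ℝ) =
      ∑ x ∈ (observed D S).filter (· ∈ Acc), (truncCount Nmin D S x : ℝ) +
      ∑ x ∈ (observed D S).filter (· ∉ Acc), (truncCount Nmin D S x : ℝ) := by
    rw [cast_totalCount, Finset.sum_filter_add_sum_filter_not]
  calc (1 - η) * l * totalCount Nmin D S
      = l * (totalCount Nmin D S - η * totalCount Nmin D S) := by ring
    _ ≤ l * ∑ x ∈ (observed D S).filter (· ∈ Acc), (truncCount Nmin D S x : ℝ) := by
        gcongr; linarith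
    _ ≤ ∑ x ∈ (observed D S).filter (· ∈ Acc), (truncCount Nmin D S x : ℝ) *
          momentsRatio q r (empMoment D (cell D S x) j) := by
        rw [Finset.mul_sum]
        refine Finset.sum_le_sum fun x hx => ?_
        rw [Finset.mem_filter] at hx
        rw [mul_comm]
        exact mul_le_mul_of_nonneg_left (hacc x hx.1 hx.2) (by positivity)
    _ ≤ _ := Finset.sum_le_sum_of_subset_of_nonneg (Finset.filter_subset _ _)
        fun x _ _ => mul_nonneg (by positivity) (hnn x)

/-- Accuracy `η` that is enough to tell the scores of complete and incomplete parent sets apart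
when the population moments ratios are separated by `M`. -/
noncomputable def tolerance (M : ℝ) : ℝ := M / (8 * (1 + M))

theorem tolerance_pos {M : ℝ} (hM : 0 < M) : 0 < tolerance M := by unfold tolerance; positivity

theorem tolerance_mul {M : ℝ} (hM : 0 < M) : tolerance M * (8 * (1 + M)) = M := by
  unfold tolerance; field_simp

open Classical in
/-- The data `D` are informative about `j` and its candidate parent set `S`: on the configurations
in some set the empirical moments ratios are on the right side of the threshold, up to `η`, and the
other configurations hardly contribute to the score. -/
def Informative (q : GHDParam) (r Nmin : ℕ) (M : ℝ) (D : Data n p) (S Pa : Finset (Fin p))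
    (j : Fin p) : Prop :=
  ∃ Acc : Set (S → ℕ),
    (∀ x ∈ observed D S, x ∈ Acc →
      (S = Pa → momentsRatio q r (empMoment D (cell D S x) j) ≤ 1 + tolerance M) ∧
      (S ≠ Pa → 1 + M - tolerance M ≤ momentsRatio q r (empMoment D (cell D S x) j))) ∧
    (S = Pa → ∑ x ∈ (observed D S).filter (· ∉ Acc), (truncCount Nmin D S x : ℝ) *
      momentsRatio q r (empMoment D (cell D S x) j) ≤ tolerance M * totalCount Nmin D S) ∧
    (S ≠ Pa → ∑ x ∈ (observed D S).filter (· ∉ Acc), (truncCount Nmin D S x : ℝ)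
      ≤ tolerance M * totalCount Nmin D S) ∧
    (S ≠ Pa → 0 < totalCount Nmin D S) ∧
    (S = ∅ → ∀ x, x ∈ Acc)

/-- The margin `M / 2` on either side of the threshold `1 + M / 2` absorbs the tolerance. The first
step of the algorithm scores the whole sample, which is the only cell of the empty conditioning
set; this is why `Informative` requires that cell to be on the right side. -/
theorem mrsRecovers_of_informative (hn : 0 < n) (G : DAG p) (par : Fin p → GHDParam) (r Nmin : ℕ)
    {M : ℝ} (hM : 0 < M) (D : Data n p)
    (hnn : ∀ j I, 0 ≤ momentsRatio (par j) r (empMoment D I j))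
    (h : ∀ j, ∀ S ⊆ G.parents j, Informative (par j) r Nmin M D S (G.parents j) j) :
    MRSRecovers G par r Nmin D := by
  have hη := tolerance_pos hM
  have hηM := tolerance_mul hM
  have hcell : ∀ x : (∅ : Finset (Fin p)) → ℕ, cell D ∅ x = Finset.univ := fun x => by
    ext i; simp only [mem_cell, Finset.mem_univ, iff_true]; exact Subsingleton.elim _ _
  have hobs : ∀ x : (∅ : Finset (Fin p)) → ℕ, x ∈ observed D ∅ := fun x =>
    mem_observed.2 ⟨⟨0, hn⟩, Subsingleton.elim _ _⟩
  refine mrsRecovers_of_threshold G par r Nmin D (1 + M / 2) (fun j => ?_) (fun j S hS hne => ?_)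
  · obtain ⟨Acc, hacc, hup, -, -, huniv⟩ := h j _ subset_rfl
    refine ⟨?_, fun h0 => ?_⟩
    · refine (cellScore_le _ _ _ _ _ _ Acc (u := 1 + tolerance M) (by positivity) hη.le
        (fun x hx hxA => (hacc x hx hxA).1 rfl) (hup rfl)).trans_lt ?_
      nlinarith
    · generalize G.parents j = S at *
      subst h0
      have := (hacc 0 (hobs 0) (huniv rfl 0)).1 rfl
      rw [hcell] at this
      nlinarith
  · obtain ⟨Acc, hacc, -, hlow, hpos, huniv⟩ := h j S hS
    refine ⟨?_, fun h0 => ?_⟩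
    · refine lt_of_lt_of_le ?_ (le_cellScore _ _ _ _ _ _ Acc (l := 1 + M - tolerance M)
        (by nlinarith)
        (fun x => hnn j _) (fun x hx hxA => (hacc x hx hxA).2 hne) (hlow hne) (hpos hne))
      nlinarith [mul_pos hη hη]
    · subst h0
      have := (hacc 0 (hobs 0) (huniv rfl 0)).2 hne
      rw [hcell] at this
      nlinarith

end Algorithm

/-! ### Factorial moments from the generating function -/

/-- Expansion of a probability generating function around `1`: its coefficients are the binomial
moments. -/
theorem hasSum_binomial_moments {w : ℕ → ℝ} (hw : ∀ k, 0 ≤ w k)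
    (hs : Summable fun k => w k * 2 ^ k) {t : ℝ} (ht : |t| < 1) :
    HasSum (fun m => t ^ m * ∑' k, w k * (k.choose m : ℝ)) (∑' k, w k * (1 + t) ^ k) := by
  have hinner : ∀ (t : ℝ) (k : ℕ),
      HasSum (fun m => w k * (k.choose m : ℝ) * t ^ m) (w k * (1 + t) ^ k) := by
    intro t k
    have h : HasSum (fun m => w k * (k.choose m : ℝ) * t ^ m)
        (∑ m ∈ Finset.range (k + 1), w k * (k.choose m : ℝ) * t ^ m) :=
      hasSum_sum_of_ne_finset_zero fun m hm => by
        rw [Finset.mem_range, not_lt] at hm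
        simp [Nat.choose_eq_zero_of_lt (show k < m by omega)]
    convert h using 1
    rw [add_comm, add_pow, Finset.mul_sum]
    exact Finset.sum_congr rfl fun m _ => by simp; ring
  have hsum : Summable fun z : ℕ × ℕ => w z.1 * (z.1.choose z.2 : ℝ) * t ^ z.2 := by
    refine Summable.of_abs ?_
    have he : (fun z : ℕ × ℕ => |w z.1 * (z.1.choose z.2 : ℝ) * t ^ z.2|)
        = fun z : ℕ × ℕ => w z.1 * (z.1.choose z.2 : ℝ) * |t| ^ z.2 := by
      funext z
      rw [abs_mul, abs_mul, abs_of_nonneg (hw _), abs_pow, Nat.abs_cast]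
    rw [he, summable_prod_of_nonneg (fun z => by have := hw z.1; positivity)]
    refine ⟨fun k => (hinner |t| k).summable, ?_⟩
    simp only [(hinner |t| _).tsum_eq]
    refine Summable.of_nonneg_of_le (fun k => by have := hw k; positivity) (fun k => ?_) hs
    have := hw k
    gcongr
    linarith
  have h1 := hsum.hasSum.prod_fiberwise fun k => hinner t k
  have h2 : HasSum (fun z : ℕ × ℕ => w z.2 * (z.2.choose z.1 : ℝ) * t ^ z.1) _ :=
    (Equiv.prodComm ℕ ℕ).hasSum_iff.2 hsum.hasSum
  have h3 := h2.prod_fiberwise fun m => (h2.summable.prod_factor m).hasSum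
  rw [h1.tsum_eq]
  convert h3 using 2 with m
  rw [← tsum_mul_left]
  exact tsum_congr fun k => mul_comm _ _

namespace GHDParam

theorem term_mul (q : GHDParam) (θ t : ℝ) (m : ℕ) : q.term (θ * t) m = t ^ m * q.term θ m := by
  simp only [term, mul_pow]; ring

/-- The binomial moments of a generalized hypergeometric distribution are the coefficients of its
series, by uniqueness of power series expansions. -/
theorem IsGHD.binomial_moment {q : GHDParam} {θ : ℝ} {w : ℕ → ℝ} (h : q.IsGHD θ w)
    (hw : ∀ k, 0 ≤ w k) (hs : Summable fun k => w k * 2 ^ k) (m : ℕ) :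
    ∑' k, w k * (k.choose m : ℝ) = q.term θ m := by
  obtain ⟨-, δ, hδ, h⟩ := h
  let f : ℝ → ℝ := fun t => ∑' k, w k * (1 + t) ^ k
  have h1 : HasFPowerSeriesAt f (FormalMultilinearSeries.ofScalars ℝ
      fun m => ∑' k, w k * (k.choose m : ℝ)) 0 := by
    rw [hasFPowerSeriesAt_iff]
    filter_upwards [Metric.ball_mem_nhds (0 : ℝ) one_pos] with t ht
    rw [mem_ball_zero_iff, Real.norm_eq_abs] at ht
    simpa [FormalMultilinearSeries.coeff_ofScalars, f] using hasSum_binomial_moments hw hs ht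
  have h2 : HasFPowerSeriesAt f (FormalMultilinearSeries.ofScalars ℝ fun m => q.term θ m) 0 := by
    rw [hasFPowerSeriesAt_iff]
    filter_upwards [Metric.ball_mem_nhds (0 : ℝ) hδ] with t ht
    rw [mem_ball_zero_iff, Real.norm_eq_abs] at ht
    obtain ⟨hsum, hh⟩ := h (1 + t) (by simpa using ht)
    have : f (0 + t) = q.hyp (θ * t) := by simpa [f] using hh.tsum_eq
    rw [this]
    simp only [FormalMultilinearSeries.coeff_ofScalars, smul_eq_mul, ← term_mul]
    simpa [hyp] using hsum.hasSum
  have := congrArg (fun p => p.coeff m) (h1.eq_formalMultilinearSeries h2)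
  simpa only [FormalMultilinearSeries.coeff_ofScalars] using this

theorem factorial_mul_term (q : GHDParam) (θ : ℝ) (m : ℕ) :
    m.factorial * q.term θ m = (q.a.map fun u => (ascPochhammer ℝ m).eval u).prod * θ ^ m /
      (q.b.map fun u => (ascPochhammer ℝ m).eval u).prod := by
  have : (m.factorial : ℝ) ≠ 0 := by positivity
  rw [term, ← mul_div_assoc, mul_comm _ (m.factorial : ℝ), mul_div_mul_left _ _ this]

theorem prod_map_div_pow (l : List ℝ) (f : ℝ → ℝ) (m : ℕ) :
    (l.map fun u => f u / u ^ m).prod = (l.map f).prod / l.prod ^ m := by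
  induction l with
  | nil => simp
  | cons u l ih => simp only [List.map_cons, List.prod_cons, ih, mul_pow]; rw [div_mul_div_comm]

theorem prod_map_pow_div (l : List ℝ) (f : ℝ → ℝ) (m : ℕ) :
    (l.map fun u => u ^ m / f u).prod = l.prod ^ m / (l.map f).prod := by
  induction l with
  | nil => simp
  | cons u l ih => simp only [List.map_cons, List.prod_cons, ih, mul_pow]; rw [div_mul_div_comm]

/-- The CMR function turns the mean of a generalized hypergeometric distribution into its factorial
moments. -/
theorem factorial_mul_term_eq_cmr (q : GHDParam) (θ : ℝ) (m : ℕ) (h : q.term θ 1 ≠ 0) :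
    m.factorial * q.term θ m = q.cmr m (q.term θ 1) := by
  have h1 : q.term θ 1 = q.a.prod * θ / q.b.prod := by
    have := q.factorial_mul_term θ 1
    simpa [ascPochhammer_one] using this
  rw [h1] at h ⊢
  have ha : q.a.prod ≠ 0 := fun h0 => h (by simp [h0])
  have hb : q.b.prod ≠ 0 := fun h0 => h (by simp [h0])
  rw [factorial_mul_term, cmr, prod_map_div_pow, prod_map_pow_div]
  rw [div_pow, mul_pow]
  field_simp

end GHDParam

/-! ### Moments of integer variables with an exponential moment -/

section Moments
variable {Ω : Type*} [MeasurableSpace Ω] [DiscreteMeasurableSpace Ω] {ν : Measure Ω} {X : Ω → ℕ}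

theorem pow_le_factorial_mul_exp (x k : ℕ) : (x : ℝ) ^ k ≤ k.factorial * Real.exp x := by
  have := Real.pow_div_factorial_le_exp (x : ℝ) (by positivity) k
  rwa [div_le_iff₀ (by positivity), mul_comm] at this

theorem integrable_of_le_exp (hX : Integrable (fun ω => Real.exp (X ω)) ν) {f : ℕ → ℝ} (C : ℝ)
    (hf : ∀ x : ℕ, |f x| ≤ C * Real.exp x) : Integrable (fun ω => f (X ω)) ν :=
  (hX.const_mul C).mono' (Measurable.of_discrete).aestronglyMeasurable
    (Filter.Eventually.of_forall fun ω => hf (X ω))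

theorem integrable_pow (hX : Integrable (fun ω => Real.exp (X ω)) ν) (k : ℕ) :
    Integrable (fun ω => (X ω : ℝ) ^ k) ν :=
  integrable_of_le_exp hX (f := fun x => (x : ℝ) ^ k) k.factorial fun x => by
    rw [abs_of_nonneg (by positivity)]; exact pow_le_factorial_mul_exp x k

theorem integral_pow_le (hX : Integrable (fun ω => Real.exp (X ω)) ν) (k : ℕ) :
    ∫ ω, (X ω : ℝ) ^ k ∂ν ≤ k.factorial * ∫ ω, Real.exp (X ω) ∂ν := by
  rw [← integral_const_mul]
  exact integral_mono (integrable_pow hX k) (hX.const_mul _)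
    fun ω => pow_le_factorial_mul_exp _ k

theorem cast_descFactorial_le_pow (x m : ℕ) : (x.descFactorial m : ℝ) ≤ (x : ℝ) ^ m := by
  exact_mod_cast Nat.descFactorial_le_pow x m

theorem integrable_descFactorial (hX : Integrable (fun ω => Real.exp (X ω)) ν) (m : ℕ) :
    Integrable (fun ω => ((X ω).descFactorial m : ℝ)) ν :=
  integrable_of_le_exp hX (f := fun x => (x.descFactorial m : ℝ)) m.factorial fun x => by
    rw [abs_of_nonneg (by positivity)]
    exact (cast_descFactorial_le_pow x m).trans (pow_le_factorial_mul_exp x m)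

theorem sum_stirlingS_mul_integral (hX : Integrable (fun ω => Real.exp (X ω)) ν) (r : ℕ) :
    ∑ k ∈ Finset.range r, (stirlingS r k : ℝ) * ∫ ω, (X ω : ℝ) ^ k ∂ν
      = ∫ ω, ((X ω).descFactorial r : ℝ) ∂ν - ∫ ω, (X ω : ℝ) ^ r ∂ν := by
  rw [← integral_sub (integrable_descFactorial hX r) (integrable_pow hX r)]
  simp only [← sum_stirlingS_mul_pow]
  rw [integral_finsetSum _ fun k _ => (integrable_pow hX k).const_mul _]
  exact Finset.sum_congr rfl fun k _ => (integral_const_mul _ _).symm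

/-- The denominator of the moments ratio is at least the mean. -/
theorem mean_le_momentsRatio_denom (hX : Integrable (fun ω => Real.exp (X ω)) ν) {r : ℕ}
    (hr : 2 ≤ r) {c : ℝ} (hc : 0 ≤ c) :
    ∫ ω, (X ω : ℝ) ^ 1 ∂ν ≤ c * (∫ ω, (X ω : ℝ) ^ 1 ∂ν) ^ r -
      ∑ k ∈ Finset.range r, (stirlingS r k : ℝ) * ∫ ω, (X ω : ℝ) ^ k ∂ν := by
  have h0 : 0 ≤ ∫ ω, (X ω : ℝ) ^ 1 ∂ν := integral_nonneg fun ω => by positivity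
  have h1 : ∫ ω, (X ω : ℝ) ^ 1 ∂ν ≤
      ∫ ω, ((X ω : ℝ) ^ r - ((X ω).descFactorial r : ℝ)) ∂ν := by
    refine integral_mono (integrable_pow hX 1)
      ((integrable_pow hX r).sub (integrable_descFactorial hX r)) fun ω => ?_
    refine le_trans ?_ (pow_sub_descFactorial_ge hr _)
    have : X ω ^ 1 ≤ X ω ^ (r - 1) := by
      rw [pow_one]; exact Nat.le_self_pow (by omega) _
    exact_mod_cast this
  rw [integral_sub (integrable_pow hX r) (integrable_descFactorial hX r)] at h1
  have h2 : 0 ≤ c * (∫ ω, (X ω : ℝ) ^ 1 ∂ν) ^ r := by positivity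
  rw [sum_stirlingS_mul_integral hX]
  linarith

theorem hasSum_integral_comp [IsFiniteMeasure ν] {f : ℕ → ℝ}
    (hf : Integrable (fun ω => f (X ω)) ν) :
    HasSum (fun k => ν.real {ω | X ω = k} * f k) (∫ ω, f (X ω) ∂ν) := by
  have h := hasSum_integral_iUnion (μ := ν) (f := fun ω => f (X ω)) (s := fun k => {ω | X ω = k})
    (fun _ => MeasurableSet.of_discrete)
    (fun a b hab => Set.disjoint_left.2 fun ω (h1 : X ω = a) (h2 : X ω = b) => hab (h1 ▸ h2))
    hf.integrableOn
  have hU : (⋃ k, {ω | X ω = k}) = Set.univ := Set.eq_univ_of_forall fun ω =>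
    Set.mem_iUnion.2 ⟨X ω, rfl⟩
  rw [hU, setIntegral_univ] at h
  have he : ∀ k, ∫ ω in {ω | X ω = k}, f (X ω) ∂ν = ν.real {ω | X ω = k} * f k := fun k => by
    rw [setIntegral_congr_fun (s := {ω | X ω = k}) (g := fun _ => f k) MeasurableSet.of_discrete
      (fun ω (hω : X ω = k) => by simp only [hω]), setIntegral_const, smul_eq_mul]
  simpa only [he] using h

/-- The exponential moment makes the generating function finite at `s = 2`, hence analytic around
`s = 1`. -/
theorem GHDParam.IsGHD.factorial_moment [IsFiniteMeasure ν] {q : GHDParam} {θ : ℝ}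
    (h : q.IsGHD θ fun k => ν.real {ω | X ω = k})
    (hX : Integrable (fun ω => Real.exp (X ω)) ν) (m : ℕ) :
    ∫ ω, ((X ω).descFactorial m : ℝ) ∂ν = m.factorial * q.term θ m := by
  have h2 : Integrable (fun ω => (2 : ℝ) ^ X ω) ν :=
    integrable_of_le_exp hX (f := fun x => (2 : ℝ) ^ x) 1 fun x => by
      rw [abs_of_nonneg (by positivity), one_mul, ← Real.exp_one_pow]
      gcongr
      have := Real.add_one_le_exp (1 : ℝ); linarith
  rw [← h.binomial_moment (fun k => measureReal_nonneg) (hasSum_integral_comp h2).summable m,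
    ← tsum_mul_left,
    ← (hasSum_integral_comp (f := fun x => (x.descFactorial m : ℝ))
      (integrable_descFactorial hX m)).tsum_eq]
  refine tsum_congr fun k => ?_
  rw [Nat.descFactorial_eq_factorial_mul_choose]; push_cast; ring

/-- The factorial moments of a generalized hypergeometric law with nonzero mean. -/
theorem GHDParam.IsGHD.factorial_moment_eq_cmr [IsProbabilityMeasure ν] {q : GHDParam} {θ : ℝ}
    (h : q.IsGHD θ fun k => ν.real {ω | X ω = k})
    (hX : Integrable (fun ω => Real.exp (X ω)) ν) (h0 : ∫ ω, (X ω : ℝ) ^ 1 ∂ν ≠ 0) (m : ℕ) :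
    ∫ ω, ((X ω).descFactorial m : ℝ) ∂ν = q.cmr m 1 * (∫ ω, (X ω : ℝ) ^ 1 ∂ν) ^ m := by
  have h1 : ∫ ω, (X ω : ℝ) ^ 1 ∂ν = q.term θ 1 := by
    have := h.factorial_moment hX 1
    simpa using this
  rw [h1] at h0 ⊢
  rw [h.factorial_moment hX, q.factorial_mul_term_eq_cmr θ m h0, q.cmr_eq]

/-- The denominator of the moments ratio collapses to the `r`-th moment, as the CMR function equals
the `r`-th factorial moment. -/
theorem GHDParam.IsGHD.momentsRatio_eq_one [IsProbabilityMeasure ν] {q : GHDParam} {θ : ℝ}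
    (h : q.IsGHD θ fun k => ν.real {ω | X ω = k})
    (hX : Integrable (fun ω => Real.exp (X ω)) ν) (h0 : ∫ ω, (X ω : ℝ) ^ 1 ∂ν ≠ 0) {r : ℕ}
    (hr : 1 ≤ r) : momentsRatio q r (fun k => ∫ ω, (X ω : ℝ) ^ k ∂ν) = 1 := by
  rw [momentsRatio_eq, sum_stirlingS_mul_integral hX, h.factorial_moment_eq_cmr hX h0,
    sub_sub_cancel, div_self]
  have h1 : 0 < ∫ ω, (X ω : ℝ) ^ 1 ∂ν :=
    lt_of_le_of_ne (integral_nonneg fun ω => by positivity) h0.symm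
  refine (h1.trans_le (integral_mono (integrable_pow hX 1) (integrable_pow hX r) fun ω => ?_)).ne'
  have : X ω ^ 1 ≤ X ω ^ r := by
    rw [pow_one]; exact Nat.le_self_pow (by omega) _
  exact_mod_cast this

/-- The CMR coefficient is a factorial moment divided by a power of the mean. -/
theorem GHDParam.IsGHD.cmr_nonneg [IsProbabilityMeasure ν] {q : GHDParam} {θ : ℝ}
    (h : q.IsGHD θ fun k => ν.real {ω | X ω = k})
    (hX : Integrable (fun ω => Real.exp (X ω)) ν) (h0 : ∫ ω, (X ω : ℝ) ^ 1 ∂ν ≠ 0) (r : ℕ) :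
    0 ≤ q.cmr r 1 := by
  have h1 : 0 < ∫ ω, (X ω : ℝ) ^ 1 ∂ν :=
    lt_of_le_of_ne (integral_nonneg fun ω => by positivity) h0.symm
  have h2 := h.factorial_moment_eq_cmr hX h0 r
  have h3 : 0 ≤ ∫ ω, ((X ω).descFactorial r : ℝ) ∂ν := integral_nonneg fun ω => by positivity
  rw [h2] at h3
  exact nonneg_of_mul_nonneg_left h3 (by positivity)

/-- The moments of a generalized hypergeometric law are of the order of its mean, uniformly in its
free parameter as long as the mean stays bounded. -/
theorem GHDParam.IsGHD.moment_le_mul_mean [IsProbabilityMeasure ν] {q : GHDParam} {θ : ℝ}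
    (h : q.IsGHD θ fun k => ν.real {ω | X ω = k})
    (hX : Integrable (fun ω => Real.exp (X ω)) ν) {r : ℕ} (hr : 1 ≤ r) {V : ℝ}
    (h0 : ∫ ω, (X ω : ℝ) ^ 1 ∂ν ≠ 0) (hV : ∫ ω, (X ω : ℝ) ^ 1 ∂ν ≤ V) :
    ∫ ω, (X ω : ℝ) ^ r ∂ν ≤
      (2 * r) ^ r * (1 + q.cmr r 1 * V ^ (r - 1)) * ∫ ω, (X ω : ℝ) ^ 1 ∂ν := by
  have h1 : 0 ≤ ∫ ω, (X ω : ℝ) ^ 1 ∂ν := integral_nonneg fun ω => by positivity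
  have hc := h.cmr_nonneg hX h0 r
  calc ∫ ω, (X ω : ℝ) ^ r ∂ν
      ≤ ∫ ω, (2 * r) ^ r * ((X ω : ℝ) ^ 1 + (X ω).descFactorial r) ∂ν := by
        refine integral_mono (integrable_pow hX r)
          (((integrable_pow hX 1).add (integrable_descFactorial hX r)).const_mul _) fun ω => ?_
        have := pow_le_mul_add_descFactorial hr (X ω)
        rw [pow_one]
        exact_mod_cast this
    _ = (2 * r) ^ r * (∫ ω, (X ω : ℝ) ^ 1 ∂ν + q.cmr r 1 * ((∫ ω, (X ω : ℝ) ^ 1 ∂ν) ^ (r - 1) *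
          ∫ ω, (X ω : ℝ) ^ 1 ∂ν)) := by
        rw [integral_const_mul, integral_add (integrable_pow hX 1) (integrable_descFactorial hX r),
          h.factorial_moment_eq_cmr hX h0, ← pow_succ, Nat.sub_add_cancel hr]
    _ ≤ (2 * r) ^ r * (∫ ω, (X ω : ℝ) ^ 1 ∂ν + q.cmr r 1 * (V ^ (r - 1) *
          ∫ ω, (X ω : ℝ) ^ 1 ∂ν)) := by gcongr
    _ = _ := by ring

/-- A nonnegative integer variable whose second moment is at most `K` times its mean is nonzero with
probability at least a `K`-th of its mean. -/
theorem mean_le_mul_measureReal_ne_zero [IsProbabilityMeasure ν]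
    (hX : Integrable (fun ω => Real.exp (X ω)) ν) {K : ℝ} (hK : 0 < K)
    (h2 : ∫ ω, (X ω : ℝ) ^ 2 ∂ν ≤ K * ∫ ω, (X ω : ℝ) ^ 1 ∂ν) :
    ∫ ω, (X ω : ℝ) ^ 1 ∂ν ≤ K * ν.real {ω | X ω ≠ 0} := by
  have h : ∫ ω, (2 * (X ω : ℝ) ^ 1 - (X ω : ℝ) ^ 2 / K) ∂ν ≤ K * ν.real {ω | X ω ≠ 0} := by
    have h3 : K * ν.real {ω | X ω ≠ 0} = ∫ ω, Set.indicator {ω | X ω ≠ 0} (fun _ => K) ω ∂ν := by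
      rw [integral_indicator MeasurableSet.of_discrete, setIntegral_const, smul_eq_mul, mul_comm]
    rw [h3]
    refine integral_mono (((integrable_pow hX 1).const_mul 2).sub
      ((integrable_pow hX 2).div_const K))
      ((integrable_const K).indicator MeasurableSet.of_discrete) fun ω => ?_
    by_cases h0 : X ω = 0
    · simp [h0]
    · rw [Set.indicator_of_mem (by exact h0)]
      have : K - (2 * (X ω : ℝ) ^ 1 - (X ω : ℝ) ^ 2 / K) = (K - X ω) ^ 2 / K := by
        field_simp; ring
      have h4 : 0 ≤ (K - X ω) ^ 2 / K := by positivity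
      linarith
  rw [integral_sub ((integrable_pow hX 1).const_mul 2) ((integrable_pow hX 2).div_const K),
    integral_const_mul, integral_div] at h
  have h5 : (∫ ω, (X ω : ℝ) ^ 2 ∂ν) / K ≤ ∫ ω, (X ω : ℝ) ^ 1 ∂ν := by
    rw [div_le_iff₀ hK]; linarith
  linarith

end Moments

/-! ### Conditional laws in the model -/

section Model
variable {p : ℕ} {G : DAG p} {μ : Measure (Fin p → ℕ)}

theorem setLIntegral_eq_mul_lintegral_cond [IsFiniteMeasure μ] {A : Set (Fin p → ℕ)} (hA : μ A ≠ 0)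
    (f : (Fin p → ℕ) → ENNReal) : ∫⁻ y in A, f y ∂μ = μ A * ∫⁻ y, f y ∂(μ[|A]) := by
  rw [ProbabilityTheory.cond, lintegral_smul_measure, smul_eq_mul, ← mul_assoc,
    ENNReal.mul_inv_cancel hA (measure_ne_top _ _), one_mul]

theorem mem_cyl {S : Finset (Fin p)} {x : S → ℕ} {y : Fin p → ℕ} :
    y ∈ cyl S x ↔ S.restrict y = x := Iff.rfl

theorem cyl_eq_iUnion {S T : Finset (Fin p)} (h : S ⊆ T) (x : S → ℕ) :
    cyl S x = ⋃ z : {z : T → ℕ // Finset.restrict₂ (π := fun _ => ℕ) h z = x}, cyl T z.1 := by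
  ext y
  simp only [mem_cyl, Set.mem_iUnion, Subtype.exists, exists_prop, exists_eq_right']
  rfl

theorem pairwise_disjoint_cyl {S : Finset (Fin p)} {ι : Type*} {f : ι → S → ℕ}
    (hf : Function.Injective f) : Pairwise (Function.onFun Disjoint fun i => cyl S (f i)) :=
  fun _ _ hab => Set.disjoint_left.2 fun _ h1 h2 => hab (hf ((mem_cyl.1 h1).symm.trans
    (mem_cyl.1 h2)))

/-- Tower property, upper bounds: a bound for the conditional expectation given the finer `X_T` is
inherited by the conditional expectation given `X_S`, `S ⊆ T`. -/
theorem lintegral_cond_cyl_le [IsFiniteMeasure μ] {S T : Finset (Fin p)} (h : S ⊆ T)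
    (f : (Fin p → ℕ) → ENNReal) (v : ENNReal)
    (hf : ∀ z, μ (cyl T z) ≠ 0 → ∫⁻ y, f y ∂(μ[|cyl T z]) ≤ v) {x : S → ℕ}
    (hx : μ (cyl S x) ≠ 0) : ∫⁻ y, f y ∂(μ[|cyl S x]) ≤ v := by
  have h1 : ∫⁻ y in cyl S x, f y ∂μ ≤ μ (cyl S x) * v := by
    rw [cyl_eq_iUnion h, lintegral_iUnion (fun _ => MeasurableSet.of_discrete)
      (pairwise_disjoint_cyl Subtype.val_injective), measure_iUnion
      (pairwise_disjoint_cyl Subtype.val_injective) (fun _ => MeasurableSet.of_discrete),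
      ← ENNReal.tsum_mul_right]
    refine ENNReal.tsum_le_tsum fun z => ?_
    by_cases hz : μ (cyl T z.1) = 0
    · simp [Measure.restrict_eq_zero.2 hz]
    · rw [setLIntegral_eq_mul_lintegral_cond hz]; gcongr; exact hf _ hz
  rw [setLIntegral_eq_mul_lintegral_cond hx] at h1
  exact (ENNReal.mul_le_mul_iff_right hx (measure_ne_top _ _)).1 h1

/-- Tower property, lower bounds. -/
theorem le_lintegral_cond_cyl [IsFiniteMeasure μ] {S T : Finset (Fin p)} (h : S ⊆ T)
    (f : (Fin p → ℕ) → ENNReal) (v : ENNReal)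
    (hf : ∀ z, μ (cyl T z) ≠ 0 → v ≤ ∫⁻ y, f y ∂(μ[|cyl T z])) {x : S → ℕ}
    (hx : μ (cyl S x) ≠ 0) : v ≤ ∫⁻ y, f y ∂(μ[|cyl S x]) := by
  have h1 : μ (cyl S x) * v ≤ ∫⁻ y in cyl S x, f y ∂μ := by
    rw [cyl_eq_iUnion h, lintegral_iUnion (fun _ => MeasurableSet.of_discrete)
      (pairwise_disjoint_cyl Subtype.val_injective), measure_iUnion
      (pairwise_disjoint_cyl Subtype.val_injective) (fun _ => MeasurableSet.of_discrete),
      ← ENNReal.tsum_mul_right]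
    refine ENNReal.tsum_le_tsum fun z => ?_
    by_cases hz : μ (cyl T z.1) = 0
    · simp [hz]
    · rw [setLIntegral_eq_mul_lintegral_cond hz]; gcongr; exact hf _ hz
  rw [setLIntegral_eq_mul_lintegral_cond hx] at h1
  exact (ENNReal.mul_le_mul_iff_right hx (measure_ne_top _ _)).1 h1

/-- The exponential moment bound given all parents is inherited by subsets of the parents. -/
theorem ExpMomentBound.integrable_cond [IsProbabilityMeasure μ] {V : ℝ}
    (hV : ExpMomentBound G μ V) {j : Fin p} {S : Finset (Fin p)} (hS : S ⊆ G.parents j)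
    {x : S → ℕ} (hx : μ (cyl S x) ≠ 0) :
    Integrable (fun y => Real.exp (y j)) (μ[|cyl S x]) ∧
      ∫ y, Real.exp (y j) ∂(μ[|cyl S x]) ≤ V := by
  have h := lintegral_cond_cyl_le hS (fun y => ENNReal.ofReal (Real.exp (y j))) (ENNReal.ofReal V)
    (fun z hz => by
      rw [← ofReal_integral_eq_lintegral_ofReal (hV j z hz).1
        (Filter.Eventually.of_forall fun y => (Real.exp_pos _).le)]
      exact ENNReal.ofReal_le_ofReal (hV j z hz).2.le) hx
  have hint : Integrable (fun y : Fin p → ℕ => Real.exp (y j)) (μ[|cyl S x]) := by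
    refine ⟨Measurable.of_discrete.aestronglyMeasurable, ?_⟩
    rw [hasFiniteIntegral_iff_ofReal (Filter.Eventually.of_forall fun y => (Real.exp_pos _).le)]
    exact h.trans_lt ENNReal.ofReal_lt_top
  refine ⟨hint, ?_⟩
  rw [← ofReal_integral_eq_lintegral_ofReal hint
        (Filter.Eventually.of_forall fun y => (Real.exp_pos _).le)] at h
  have hpos : 0 < ∫ y, Real.exp (y j) ∂(μ[|cyl S x]) := by
    have := cond_isProbabilityMeasure hx
    exact integral_exp_pos hint
  exact (ENNReal.ofReal_le_ofReal_iff' .. |>.1 h).resolve_right (not_le.2 hpos)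

theorem cyl_empty (x : (∅ : Finset (Fin p)) → ℕ) : cyl ∅ x = Set.univ :=
  Set.eq_univ_of_forall fun _ => Subsingleton.elim _ _

theorem ExpMomentBound.integrable [IsProbabilityMeasure μ] {V : ℝ}
    (hV : ExpMomentBound G μ V) (j : Fin p) :
    Integrable (fun y => Real.exp (y j)) μ ∧ ∫ y, Real.exp (y j) ∂μ ≤ V := by
  have h := hV.integrable_cond (j := j) (Finset.empty_subset _) (x := 0)
    (by rw [cyl_empty]; simp)
  rwa [cyl_empty, cond_univ] at h

theorem ExpMomentBound.one_le [IsProbabilityMeasure μ] {V : ℝ}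
    (hV : ExpMomentBound G μ V) (j : Fin p) : 1 ≤ V := by
  refine le_trans ?_ (hV.integrable j).2
  calc (1 : ℝ) = ∫ _, (1 : ℝ) ∂μ := by simp
    _ ≤ _ := integral_mono (integrable_const _) (hV.integrable j).1
      fun y => Real.one_le_exp (by positivity)

/-- The lower bound for the means given all parents is inherited by subsets of the parents. -/
theorem MeansAtLeast.le_condMoment [IsProbabilityMeasure μ] {V γ : ℝ}
    (hγ : MeansAtLeast G μ γ) (hV : ExpMomentBound G μ V) (h0 : 0 < γ) {j : Fin p}
    {S : Finset (Fin p)} (hS : S ⊆ G.parents j) {x : S → ℕ} (hx : μ (cyl S x) ≠ 0) :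
    γ ≤ condMoment μ S x j 1 := by
  have h := le_lintegral_cond_cyl hS (fun y => ENNReal.ofReal ((y j : ℝ) ^ 1)) (ENNReal.ofReal γ)
    (fun z hz => by
      rw [← ofReal_integral_eq_lintegral_ofReal (integrable_pow (hV j z hz).1 1)
        (Filter.Eventually.of_forall fun y => by positivity)]
      exact ENNReal.ofReal_le_ofReal (hγ j z hz)) hx
  rw [← ofReal_integral_eq_lintegral_ofReal (integrable_pow (hV.integrable_cond hS hx).1 1)
        (Filter.Eventually.of_forall fun y => by positivity)] at h
  exact (ENNReal.ofReal_le_ofReal_iff' .. |>.1 h).resolve_right (not_le.2 h0)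

theorem condMoment_nonneg (S : Finset (Fin p)) (x : S → ℕ) (j : Fin p) (k : ℕ) :
    0 ≤ condMoment μ S x j k := integral_nonneg fun _ => by positivity

theorem measure_cyl_restrict_ne_zero {y : Fin p → ℕ} (hy : μ {y} ≠ 0) (S : Finset (Fin p)) :
    μ (cyl S (S.restrict y)) ≠ 0 := fun h =>
  hy (measure_mono_null (Set.singleton_subset_iff.2 (mem_cyl.2 rfl)) h)

/-- If the mean of `X_j` vanishes on a cell, so does `X_j` at every atom in the cell. -/
theorem eq_zero_of_condMoment_eq_zero [IsProbabilityMeasure μ] {S : Finset (Fin p)} {j : Fin p}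
    {y : Fin p → ℕ} (hy : μ {y} ≠ 0)
    (hint : Integrable (fun y => Real.exp (y j)) (μ[|cyl S (S.restrict y)]))
    (h0 : condMoment μ S (S.restrict y) j 1 = 0) : y j = 0 := by
  have h1 := (integral_eq_zero_iff_of_nonneg (fun _ => by positivity) (integrable_pow hint 1)).1 h0
  by_contra hne
  have h2 : (μ[|cyl S (S.restrict y)]) {y} = 0 := by
    refine measure_mono_null (Set.singleton_subset_iff.2 ?_) h1
    simpa using hne
  rw [cond_apply MeasurableSet.of_discrete, Set.inter_eq_right.2
    (Set.singleton_subset_iff.2 (mem_cyl.2 rfl))] at h2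
  simp [hy] at h2

theorem IsGHDModel.exists_isGHD {par : Fin p → GHDParam} (hM : IsGHDModel G μ par) {j : Fin p}
    {x : G.parents j → ℕ} (hx : μ (cyl (G.parents j) x) ≠ 0) :
    ∃ θ, (par j).IsGHD θ fun k => (μ[|cyl (G.parents j) x]).real {y | y j = k} := by
  obtain ⟨θ, hθ⟩ := hM.ghd j
  exact ⟨θ x, hθ x hx⟩

theorem IsGHDModel.cmr_nonneg [IsProbabilityMeasure μ] {par : Fin p → GHDParam} {V : ℝ}
    (hM : IsGHDModel G μ par) (hV : ExpMomentBound G μ V) {j : Fin p} {y : Fin p → ℕ}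
    (hy : μ {y} ≠ 0) (hj : y j ≠ 0) (r : ℕ) : 0 ≤ (par j).cmr r 1 := by
  have hx := measure_cyl_restrict_ne_zero hy (G.parents j)
  obtain ⟨θ, hθ⟩ := hM.exists_isGHD hx
  have hp := cond_isProbabilityMeasure hx
  have hint := (hV j _ hx).1
  have h0 : ∫ y, (y j : ℝ) ^ 1 ∂(μ[|cyl (G.parents j) ((G.parents j).restrict y)]) ≠ 0 :=
    fun h0 => hj (eq_zero_of_condMoment_eq_zero hy hint h0)
  exact GHDParam.IsGHD.cmr_nonneg hθ hint h0 r

theorem IsGHDModel.momentsRatio_eq_one [IsProbabilityMeasure μ] {par : Fin p → GHDParam} {V : ℝ}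
    (hM : IsGHDModel G μ par) (hV : ExpMomentBound G μ V) {j : Fin p} {x : G.parents j → ℕ}
    (hx : μ (cyl (G.parents j) x) ≠ 0) (h0 : condMoment μ (G.parents j) x j 1 ≠ 0) {r : ℕ}
    (hr : 1 ≤ r) : momentsRatio (par j) r (condMoment μ (G.parents j) x j) = 1 := by
  obtain ⟨θ, hθ⟩ := hM.exists_isGHD hx
  have hp := cond_isProbabilityMeasure hx
  have hint := (hV j _ hx).1
  exact GHDParam.IsGHD.momentsRatio_eq_one hθ hint h0 hr

/-- For `S ⊂ Pa(j)` the separation applies with `Pa₀ = Pa(j) \ S`. -/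
theorem RatioGap.lt_momentsRatio {par : Fin p → GHDParam} {r : ℕ} {M : ℝ}
    (hgap : RatioGap G μ par r M) {j : Fin p} {S : Finset (Fin p)} (hS : S ⊆ G.parents j)
    (hne : S ≠ G.parents j) {x : S → ℕ} (hx : μ (cyl S x) ≠ 0) :
    1 + M < momentsRatio (par j) r (condMoment μ S x j) := by
  refine hgap j (G.parents j \ S) Finset.sdiff_subset ?_ S (fun k hk => ?_) x hx
  · rw [Finset.sdiff_nonempty]
    exact fun h => hne (hS.antisymm h)
  · rw [Finset.mem_sdiff, Finset.mem_sdiff]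
    exact ⟨G.parents_subset_nonDescendants j (hS hk), fun h => h.2 hk⟩

/-- Almost surely all samples are atoms of `μ`. -/
theorem ae_sampleLaw_atoms [IsProbabilityMeasure μ] (n : ℕ) :
    ∀ᵐ D ∂(sampleLaw μ n), ∀ i, μ {D i} ≠ 0 := by
  rw [ae_all_iff]
  intro i
  have h : ∀ᵐ y ∂μ, μ {y} ≠ 0 := by
    rw [ae_iff]
    have : {y | ¬ μ {y} ≠ 0} = ⋃ y : {y // μ {y} = 0}, {y.1} := by ext y; simp
    rw [this, measure_iUnion_null_iff]
    exact fun y => y.2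
  exact (measurePreserving_eval (fun _ : Fin n => μ) i).quasiMeasurePreserving.ae h

theorem IsGHDModel.momentsRatio_nonneg [IsProbabilityMeasure μ] {par : Fin p → GHDParam} {V : ℝ}
    (hM : IsGHDModel G μ par) (hV : ExpMomentBound G μ V) {r : ℕ} (hr : 2 ≤ r) {n : ℕ}
    {D : Data n p} (hD : ∀ i, μ {D i} ≠ 0) (j : Fin p) (I : Finset (Fin n)) :
    0 ≤ momentsRatio (par j) r (empMoment D I j) :=
  momentsRatio_empMoment_nonneg _ hr D I j fun i _ hi => hM.cmr_nonneg hV (hD i) hi r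

end Model

/-! ### Concentration of sums over a cell -/

section Concentration
variable {p : ℕ} {μ : Measure (Fin p → ℕ)} [IsProbabilityMeasure μ] {n : ℕ}

instance : IsProbabilityMeasure (sampleLaw μ n) := by unfold sampleLaw; infer_instance

theorem setIntegral_eq_mul_integral_cond (A : Set (Fin p → ℕ)) (f : (Fin p → ℕ) → ℝ) :
    ∫ y in A, f y ∂μ = μ.real A * ∫ y, f y ∂(μ[|A]) := by
  by_cases hA : μ A = 0
  · simp [Measure.restrict_eq_zero.2 hA, Measure.real, hA]
  · rw [ProbabilityTheory.cond, integral_smul_measure, smul_eq_mul, ← mul_assoc, ENNReal.toReal_inv,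
      Measure.real, mul_inv_cancel₀ (ENNReal.toReal_ne_zero.2 ⟨hA, measure_ne_top _ _⟩), one_mul]

/-- The exponential moment behind the concentration of cell averages. The compensator acts only on
the event `A`, so that no conditioning on the number of samples in the cell is needed. -/
theorem integral_exp_indicator_le_one (A : Set (Fin p → ℕ)) (g : (Fin p → ℕ) → ℝ) {b v l : ℝ}
    (hg : ∀ y, 0 ≤ g y ∧ g y ≤ b) (hv : ∫ y, g y ^ 2 ∂(μ[|A]) ≤ v) (hl : |l| * b ≤ 1) :
    ∫ y, Real.exp (A.indicator (fun y => l * (g y - ∫ z, g z ∂(μ[|A])) - l ^ 2 * v) y) ∂μ ≤ 1 := by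
  set e := ∫ z, g z ∂(μ[|A]) with he
  by_cases hA : μ A = 0
  · have : (fun y => Real.exp (A.indicator (fun y => l * (g y - e) - l ^ 2 * v) y)) =ᵐ[μ]
        fun _ => 1 := by
      have h : ∀ᵐ y ∂μ, y ∉ A := measure_eq_zero_iff_ae_notMem.1 hA
      filter_upwards [h] with y hy
      rw [Set.indicator_of_notMem hy, Real.exp_zero]
    rw [integral_congr_ae this]; simp
  have hp := cond_isProbabilityMeasure hA
  have hb : ∀ (ν : Measure (Fin p → ℕ)) [IsProbabilityMeasure ν] (f : (Fin p → ℕ) → ℝ) (C : ℝ),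
      (∀ y, |f y| ≤ C) → Integrable f ν := fun ν _ f C hf =>
    Integrable.of_bound Measurable.of_discrete.aestronglyMeasurable C
      (Filter.Eventually.of_forall hf)
  have hgi : Integrable g (μ[|A]) := hb _ g b fun y => by
    rw [abs_of_nonneg (hg y).1]; exact (hg y).2
  have hb0 : 0 ≤ b := (hg 0).1.trans (hg 0).2
  have he0 : 0 ≤ e ∧ e ≤ b := by
    refine ⟨integral_nonneg fun y => (hg y).1, ?_⟩
    calc e ≤ ∫ _, b ∂(μ[|A]) := integral_mono hgi (integrable_const _) fun y => (hg y).2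
      _ = b := by simp
  have hge : ∀ y, |g y - e| ≤ b := fun y => abs_sub_le_iff.2
    ⟨by linarith [(hg y).2, he0.1], by linarith [(hg y).1, he0.2]⟩
  have hle : ∀ y, |l * (g y - e)| ≤ 1 := fun y => by
    rw [abs_mul]
    exact (mul_le_mul_of_nonneg_left (hge y) (abs_nonneg _)).trans hl
  have hg2 : Integrable (fun y => g y ^ 2) (μ[|A]) := hb _ _ (b ^ 2) fun y => by
    rw [abs_of_nonneg (by positivity)]
    exact pow_le_pow_left₀ (hg y).1 (hg y).2 2
  have hcond : ∫ y, Real.exp (l * (g y - e) - l ^ 2 * v) ∂(μ[|A]) ≤ 1 := by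
    have h1 : ∫ y, Real.exp (l * (g y - e)) ∂(μ[|A]) ≤ 1 + l ^ 2 * v := by
      have hi1 : Integrable (fun y => 1 + l * (g y - e)) (μ[|A]) :=
        (integrable_const _).add ((hgi.sub (integrable_const _)).const_mul _)
      have hi2 : Integrable (fun y => l ^ 2 * (g y - e) ^ 2) (μ[|A]) := by
        refine (hb _ _ (b ^ 2) fun y => ?_).const_mul _
        rw [abs_of_nonneg (by positivity), ← sq_abs]
        exact pow_le_pow_left₀ (abs_nonneg _) (hge y) 2
      calc _ ≤ ∫ y, (1 + l * (g y - e) + l ^ 2 * (g y - e) ^ 2) ∂(μ[|A]) := by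
            refine integral_mono (hb _ _ (Real.exp 1) fun y => ?_) (hi1.add hi2) fun y => ?_
            · rw [Real.abs_exp]
              exact Real.exp_le_exp.2 ((le_abs_self _).trans (hle y))
            · have := Real.abs_exp_sub_one_sub_id_le (hle y)
              have := (abs_le.1 this).2
              simp only [mul_pow] at this
              linarith
        _ = 1 + l ^ 2 * ∫ y, (g y - e) ^ 2 ∂(μ[|A]) := by
            have hi3 : Integrable (fun y => g y - e) (μ[|A]) := hgi.sub (integrable_const _)
            rw [integral_add hi1 hi2, integral_const_mul, integral_add (integrable_const _)
              (hi3.const_mul _), integral_const_mul, integral_sub hgi (integrable_const _)]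
            simp [← he]
        _ ≤ 1 + l ^ 2 * v := by
            gcongr
            refine le_trans ?_ hv
            have : ∀ y, (g y - e) ^ 2 = g y ^ 2 - (2 * e * g y - e ^ 2) := fun y => by ring
            simp only [this]
            have hi3 : Integrable (fun y => 2 * e * g y - e ^ 2) (μ[|A]) :=
              (hgi.const_mul _).sub (integrable_const _)
            rw [integral_sub hg2 hi3, integral_sub (hgi.const_mul _) (integrable_const _),
              integral_const_mul, ← he]
            simp
            nlinarith [sq_nonneg e]
    simp only [Real.exp_sub]
    rw [integral_div, div_le_one (Real.exp_pos _)]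
    refine h1.trans ?_
    have := Real.add_one_le_exp (l ^ 2 * v); linarith
  have hmA : MeasurableSet A := MeasurableSet.of_discrete
  have hint : Integrable (fun y => Real.exp
    (A.indicator (fun y => l * (g y - e) - l ^ 2 * v) y)) μ := by
    refine hb _ _ (Real.exp (1 + |l ^ 2 * v|)) fun y => ?_
    rw [Real.abs_exp, Real.exp_le_exp]
    by_cases hy : y ∈ A
    · rw [Set.indicator_of_mem hy]
      have h1 := (abs_le.1 (hle y)).2
      have h2 := neg_abs_le (l ^ 2 * v)
      linarith
    · rw [Set.indicator_of_notMem hy]; positivity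
  rw [← integral_add_compl hmA hint, setIntegral_congr_fun hmA
    (g := fun y => Real.exp (l * (g y - e) - l ^ 2 * v))
    (fun y hy => by simp only [Set.indicator_of_mem hy]), setIntegral_congr_fun hmA.compl
    (g := fun _ => 1) (fun y hy => by simp only [Set.indicator_of_notMem hy, Real.exp_zero]),
    setIntegral_eq_mul_integral_cond, setIntegral_const, smul_eq_mul, mul_one,
      probReal_compl_eq_one_sub hmA]
  have : μ.real A * ∫ y, Real.exp (l * (g y - e) - l ^ 2 * v) ∂(μ[|A]) ≤ μ.real A * 1 := by
    gcongr
  linarith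

/-- Chernoff bound for a sum of independent copies of `h` with `E exp(h) ≤ 1`. -/
theorem measureReal_sum_ge_le (h : (Fin p → ℕ) → ℝ) {C : ℝ} (hC : ∀ y, h y ≤ C)
    (hexp : ∫ y, Real.exp (h y) ∂μ ≤ 1) (a : ℝ) :
    (sampleLaw μ n).real {D | a ≤ ∑ i, h (D i)} ≤ Real.exp (-a) := by
  have hint : Integrable (fun D : Data n p => Real.exp (∑ i, h (D i))) (sampleLaw μ n) := by
    refine Integrable.of_bound Measurable.of_discrete.aestronglyMeasurable
      (Real.exp (∑ _i : Fin n, C))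
      (Filter.Eventually.of_forall fun D => ?_)
    rw [Real.norm_eq_abs, Real.abs_exp, Real.exp_le_exp]
    exact Finset.sum_le_sum fun i _ => hC _
  have h1 := mul_meas_ge_le_integral_of_nonneg (Filter.Eventually.of_forall
    fun D : Data n p => (Real.exp_pos (∑ i, h (D i))).le) hint (Real.exp a)
  have h2 : ∫ D : Data n p, Real.exp (∑ i, h (D i)) ∂(sampleLaw μ n) ≤ 1 := by
    simp only [Real.exp_sum]
    rw [sampleLaw, integral_fintype_prod_eq_pow (fun y => Real.exp (h y))]
    exact pow_le_one₀ (integral_nonneg fun y => (Real.exp_pos _).le) hexp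
  simp only [Real.exp_le_exp] at h1
  rw [Real.exp_neg, ← one_div, le_div_iff₀ (Real.exp_pos _), mul_comm]
  exact h1.trans h2

/-- Concentration of the average of a bounded function over a cell, on the event that the cell holds
at least `T` samples. -/
theorem measureReal_cell_deviation_le (S : Finset (Fin p)) (x : S → ℕ) (g : (Fin p → ℕ) → ℝ)
    {b v l δ T : ℝ} (hg : ∀ y, 0 ≤ g y ∧ g y ≤ b) (hv : ∫ y, g y ^ 2 ∂(μ[|cyl S x]) ≤ v)
    (hl : 0 ≤ l) (hlb : l * b ≤ 1) (hlv : l * v ≤ δ / 2) :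
    (sampleLaw μ n).real {D | T ≤ (cell D S x).card ∧ δ * (cell D S x).card <
      |∑ i ∈ cell D S x, g (D i) - (cell D S x).card * ∫ y, g y ∂(μ[|cyl S x])|} ≤
      2 * Real.exp (-(l * δ / 2 * T)) := by
  set e := ∫ y, g y ∂(μ[|cyl S x])
  have hb0 : 0 ≤ b := (hg 0).1.trans (hg 0).2
  have hv0 : 0 ≤ v := (integral_nonneg fun y => by positivity).trans hv
  have hδ : 0 ≤ δ := by nlinarith [mul_nonneg hl hv0]
  have main : ∀ s : ℝ, |s| = l → (sampleLaw μ n).real {D | l * δ / 2 * T ≤ ∑ i : Fin n,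
      (cyl S x).indicator (fun y => s * (g y - e) - s ^ 2 * v) (D i)} ≤
      Real.exp (-(l * δ / 2 * T)) := fun s hs => by
    refine measureReal_sum_ge_le _ (C := |s| * (b + |e|)) (fun y => ?_)
      (integral_exp_indicator_le_one _ g hg hv (by rwa [hs])) _
    have h0 : 0 ≤ |s| * (b + |e|) := by positivity
    by_cases hy : y ∈ cyl S x
    · rw [Set.indicator_of_mem hy]
      have h1 : s * (g y - e) ≤ |s| * (b + |e|) := by
        refine (le_abs_self _).trans ?_
        rw [abs_mul]
        gcongr
        refine (abs_sub _ _).trans ?_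
        rw [abs_of_nonneg (hg y).1]
        linarith [(hg y).2]
      nlinarith [mul_nonneg (sq_nonneg s) hv0]
    · rwa [Set.indicator_of_notMem hy]
  have hsum : ∀ (s : ℝ) (D : Data n p),
      ∑ i : Fin n, (cyl S x).indicator (fun y => s * (g y - e) - s ^ 2 * v) (D i) =
      s * (∑ i ∈ cell D S x, g (D i) - (cell D S x).card * e) - s ^ 2 * v * (cell D S x).card := by
    intro s D
    have : ∑ i : Fin n, (cyl S x).indicator (fun y => s * (g y - e) - s ^ 2 * v) (D i) =
        ∑ i ∈ cell D S x, (s * (g (D i) - e) - s ^ 2 * v) := by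
      rw [cell, Finset.sum_filter]
      refine Finset.sum_congr rfl fun i _ => ?_
      by_cases hi : S.restrict (D i) = x
      · rw [Set.indicator_of_mem (mem_cyl.2 hi), if_pos hi]
      · rw [Set.indicator_of_notMem (mt mem_cyl.1 hi), if_neg hi]
    rw [this, Finset.sum_sub_distrib, ← Finset.mul_sum, Finset.sum_sub_distrib]
    simp only [Finset.sum_const, nsmul_eq_mul]
    ring
  have h1 := main l (abs_of_nonneg hl)
  have h2 := main (-l) (by rw [abs_neg, abs_of_nonneg hl])
  refine (measureReal_mono (s₂ := {D | l * δ / 2 * T ≤ ∑ i : Fin n,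
      (cyl S x).indicator (fun y => l * (g y - e) - l ^ 2 * v) (D i)} ∪
      {D | l * δ / 2 * T ≤ ∑ i : Fin n,
      (cyl S x).indicator (fun y => (-l) * (g y - e) - (-l) ^ 2 * v) (D i)}) ?_).trans
    ((measureReal_union_le _ _).trans (by linarith))
  rintro D ⟨hT, hdev⟩
  have hN : (0 : ℝ) ≤ (cell D S x).card := by positivity
  have key : l * δ / 2 * T ≤ l * (δ * (cell D S x).card) - l ^ 2 * v * (cell D S x).card := by
    have h3 : l * δ / 2 * T ≤ l * δ / 2 * (cell D S x).card := by gcongr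
    have h4 : l * (l * v) * (cell D S x).card ≤ l * (δ / 2) * (cell D S x).card := by gcongr
    nlinarith
  rcases lt_abs.1 hdev with h | h
  · left
    rw [Set.mem_ofPred_eq, hsum]
    have := mul_le_mul_of_nonneg_left h.le hl
    linarith
  · right
    rw [Set.mem_ofPred_eq, hsum]
    have := mul_le_mul_of_nonneg_left h.le hl
    nlinarith

/-- Weak law of large numbers for the samples. -/
theorem exists_sum_deviation_le (h : (Fin p → ℕ) → ℝ) (hh : MemLp h 2 μ) {t ε : ℝ} (ht : 0 < t)
    (hε : 0 < ε) : ∃ n₀ : ℕ, ∀ n ≥ n₀, (sampleLaw μ n).real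
      {D | t * n ≤ |∑ i, h (D i) - n * ∫ y, h y ∂μ|} ≤ ε := by
  obtain ⟨n₀, hn₀⟩ := exists_nat_gt (Var[h; μ] / (t ^ 2 * ε))
  refine ⟨n₀ + 1, fun n hn => ?_⟩
  have hn0 : (0 : ℝ) < n := by exact_mod_cast (by omega : 0 < n)
  have hnn : Var[h; μ] / (t ^ 2 * ε) < n := hn₀.trans_le (by exact_mod_cast (by omega : n₀ ≤ n))
  have hmp : ∀ i : Fin n, MeasurePreserving (fun D : Data n p => D i) (sampleLaw μ n) μ := fun i =>
    measurePreserving_eval (fun _ : Fin n => μ) i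
  have hLp : ∀ i : Fin n, MemLp (fun D : Data n p => h (D i)) 2 (sampleLaw μ n) := fun i =>
    hh.comp_measurePreserving (hmp i)
  have hsum : MemLp (∑ i : Fin n, fun D : Data n p => h (D i)) 2 (sampleLaw μ n) :=
    memLp_finsetSum' _ fun i _ => hLp i
  have hvar : Var[∑ i : Fin n, fun D : Data n p => h (D i); sampleLaw μ n] = n * Var[h; μ] := by
    rw [sampleLaw, variance_sum_pi (X := fun _ => h) (fun _ => hh)]; simp
  have hmean : ∫ D : Data n p, (∑ i : Fin n, fun D : Data n p => h (D i)) D ∂(sampleLaw μ n)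
      = n * ∫ y, h y ∂μ := by
    simp only [Finset.sum_apply]
    rw [integral_finsetSum _ fun i _ => (hLp i).integrable one_le_two]
    have : ∀ i : Fin n, ∫ D : Data n p, h (D i) ∂(sampleLaw μ n) = ∫ y, h y ∂μ := fun i => by
      have := integral_map (hmp i).aemeasurable (f := h)
        Measurable.of_discrete.aestronglyMeasurable
      rw [(hmp i).map_eq] at this
      exact this.symm
    simp [this]
  have := meas_ge_le_variance_div_sq hsum (mul_pos ht hn0)
  rw [hvar, hmean] at this
  simp only [Finset.sum_apply] at this
  refine (ENNReal.toReal_mono ENNReal.ofReal_ne_top this).trans ?_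
  rw [ENNReal.toReal_ofReal (by have := variance_nonneg h μ; positivity)]
  rw [div_lt_iff₀ (by positivity)] at hnn
  rw [div_le_iff₀ (by positivity)]
  nlinarith

end Concentration

/-! ### Averages over rare cells -/

section TailCells
variable {p : ℕ} {μ : Measure (Fin p → ℕ)} [IsProbabilityMeasure μ] {n : ℕ}

open Classical in
/-- The number of samples in `A`. -/
noncomputable def hits (D : Data n p) (A : Set (Fin p → ℕ)) : ℕ :=
  (Finset.univ.filter fun i => D i ∈ A).card

theorem hits_cyl (D : Data n p) (S : Finset (Fin p)) (x : S → ℕ) :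
    hits D (cyl S x) = (cell D S x).card := by
  unfold hits cell
  congr 1
  ext i
  simp [mem_cyl]

theorem cast_hits (D : Data n p) (A : Set (Fin p → ℕ)) :
    (hits D A : ENNReal) = ∑ i, A.indicator (fun _ => 1) (D i) := by
  classical
  rw [hits, Finset.card_filter]
  push_cast
  exact Finset.sum_congr rfl fun i _ => by simp [Set.indicator_apply]

theorem lintegral_hits (A : Set (Fin p → ℕ)) :
    ∫⁻ D : Data n p, hits D A ∂(sampleLaw μ n) = n * μ A := by
  simp only [cast_hits]
  rw [lintegral_finsetSum _ fun i _ => Measurable.of_discrete]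
  have : ∀ i : Fin n, ∫⁻ D : Data n p, A.indicator (fun _ => 1) (D i) ∂(sampleLaw μ n) = μ A := by
    intro i
    have hmp : MeasurePreserving (fun D : Data n p => D i) (sampleLaw μ n) μ :=
      measurePreserving_eval (fun _ : Fin n => μ) i
    rw [hmp.lintegral_comp (f := A.indicator fun _ => 1) Measurable.of_discrete,
      lintegral_indicator MeasurableSet.of_discrete]
    simp
  simp [this]

theorem hits_update_congr (D : Data n p) (i : Fin n) (A : Set (Fin p → ℕ)) {y z : Fin p → ℕ}
    (h : y ∈ A ↔ z ∈ A) : hits (Function.update D i y) A = hits (Function.update D i z) A := by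
  unfold hits
  congr 1
  ext k
  simp only [Finset.mem_filter, Finset.mem_univ, true_and]
  rcases eq_or_ne k i with rfl | hk
  · simpa using h
  · simp [hk]

/-- The average of `h` over the samples in `A`, weighted by the number of samples in a larger event
`C`. Given which samples lie in `A` and in `C`, the samples in `A` are independent draws from
`μ[|A]`; integrating them out one coordinate at a time bounds the expectation without dividing by
the probability of any of these patterns. -/
theorem lintegral_weighted_average_le {A C : Set (Fin p → ℕ)} (hAC : A ⊆ C)
    (h : (Fin p → ℕ) → ENNReal) (K : ENNReal) (hK : ∫⁻ y in A, h y ∂μ ≤ K * μ A) :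
    ∫⁻ D : Data n p, ∑ i, A.indicator h (D i) * (hits D C / hits D A) ∂(sampleLaw μ n) ≤
      K * (n * μ C) := by
  classical
  let w : Data n p → ENNReal := fun D => hits D C / hits D A
  have hstep : ∀ i : Fin n, ∫⁻ D : Data n p, A.indicator h (D i) * w D ∂(sampleLaw μ n) ≤
      ∫⁻ D : Data n p, K * (A.indicator (fun _ => 1) (D i) * w D) ∂(sampleLaw μ n) := by
    intro i
    refine lintegral_le_of_lmarginal_le {i} Measurable.of_discrete Measurable.of_discrete ?_
    intro D
    rw [lmarginal_singleton, lmarginal_singleton]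
    simp only [Function.update_self]
    rcases A.eq_empty_or_nonempty with rfl | ⟨z, hz⟩
    · simp
    have hw : ∀ y ∈ A, w (Function.update D i y) = w (Function.update D i z) := fun y hy => by
      simp only [w, hits_update_congr D i A (iff_of_true hy hz),
        hits_update_congr D i C (iff_of_true (hAC hy) (hAC hz))]
    have e1 : ∀ f : (Fin p → ℕ) → ENNReal, ∀ y, A.indicator f y * w (Function.update D i y) =
        A.indicator f y * w (Function.update D i z) := fun f y => by
      by_cases hy : y ∈ A
      · rw [hw y hy]
      · simp [Set.indicator_of_notMem hy]
    simp only [e1]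
    rw [lintegral_mul_const _ Measurable.of_discrete,
      lintegral_const_mul _ Measurable.of_discrete, lintegral_mul_const _ Measurable.of_discrete,
      lintegral_indicator MeasurableSet.of_discrete, lintegral_indicator MeasurableSet.of_discrete,
      ← mul_assoc]
    gcongr
    simpa using hK
  rw [lintegral_finsetSum _ fun i _ => Measurable.of_discrete]
  refine (Finset.sum_le_sum fun i _ => hstep i).trans ?_
  rw [← lintegral_finsetSum _ fun i _ => Measurable.of_discrete]
  simp only [← Finset.mul_sum, ← Finset.sum_mul, ← cast_hits]
  rw [lintegral_const_mul _ Measurable.of_discrete, ← lintegral_hits]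
  gcongr with D
  exact ENNReal.mul_div_le

end TailCells

section TailRatios
variable {p : ℕ} {G : DAG p} {μ : Measure (Fin p → ℕ)} [IsProbabilityMeasure μ] {n : ℕ}

/-- A bound, over all parent configurations at once, for the conditional `r`-th moment of a
generalized hypergeometric variable given that it is nonzero. -/
noncomputable def tailConst (q : GHDParam) (r : ℕ) (V : ℝ) : ℝ :=
  (2 * r) ^ r * (1 + |q.cmr r 1| * V ^ (r - 1)) * (4 ^ 2 * (1 + |q.cmr 2 1| * V))

theorem tailConst_nonneg (q : GHDParam) (r : ℕ) {V : ℝ} (hV : 0 ≤ V) : 0 ≤ tailConst q r V := by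
  unfold tailConst; positivity

/-- If the mean is nonzero, the `r`-th moment is at most a constant times the mean, which in turn
is at most a constant times the probability of being nonzero. If it is zero, both sides vanish. -/
theorem integral_pow_le_tailConst {par : Fin p → GHDParam} {V : ℝ} (hM : IsGHDModel G μ par)
    (hV : ExpMomentBound G μ V) {r : ℕ} (hr : 1 ≤ r) (j : Fin p) {x : G.parents j → ℕ}
    (hx : μ (cyl (G.parents j) x) ≠ 0) :
    ∫ y, (y j : ℝ) ^ r ∂(μ[|cyl (G.parents j) x]) ≤ tailConst (par j) r V *
      (μ[|cyl (G.parents j) x]).real {y | y j ≠ 0} := by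
  obtain ⟨θ, hθ⟩ := hM.exists_isGHD hx
  have hp := cond_isProbabilityMeasure hx
  have hint := (hV j _ hx).1
  have hVV := (hV j _ hx).2
  have hV1 := hV.one_le j
  set ν := μ[|cyl (G.parents j) x]
  by_cases h0 : ∫ y, (y j : ℝ) ^ 1 ∂ν = 0
  · have h1 := (integral_eq_zero_iff_of_nonneg (fun _ => by positivity)
      (integrable_pow hint 1)).1 h0
    have h2 : (fun y : Fin p → ℕ => (y j : ℝ) ^ r) =ᵐ[ν] 0 := by
      filter_upwards [h1] with y hy
      simp only [pow_one, Pi.zero_apply] at hy ⊢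
      rw [hy, zero_pow (by omega)]
    rw [integral_congr_ae h2]
    have := tailConst_nonneg (par j) r (zero_le_one.trans hV1)
    simp only [Pi.zero_apply, integral_zero]
    positivity
  · have hmV : ∫ y, (y j : ℝ) ^ 1 ∂ν ≤ V := by
      have := integral_pow_le hint 1
      simp only [Nat.factorial_one, Nat.cast_one, one_mul] at this
      linarith
    have hm0 : 0 ≤ ∫ y, (y j : ℝ) ^ 1 ∂ν := integral_nonneg fun y => by positivity
    have a1 := GHDParam.IsGHD.moment_le_mul_mean hθ hint hr h0 hmV
    have a2 := GHDParam.IsGHD.moment_le_mul_mean hθ hint (r := 2) (by norm_num) h0 hmV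
    rw [← abs_of_nonneg (GHDParam.IsGHD.cmr_nonneg hθ hint h0 r)] at a1
    rw [← abs_of_nonneg (GHDParam.IsGHD.cmr_nonneg hθ hint h0 2)] at a2
    have a3 := mean_le_mul_measureReal_ne_zero (ν := ν) (X := fun y => y j) hint
      (K := 4 ^ 2 * (1 + |(par j).cmr 2 1| * V)) (by positivity) (by
        refine a2.trans (le_of_eq ?_)
        norm_num)
    refine a1.trans ?_
    unfold tailConst
    rw [mul_assoc _ (4 ^ 2 * _)]
    gcongr

theorem setLIntegral_pow_le_tailConst {par : Fin p → GHDParam} {V : ℝ} (hM : IsGHDModel G μ par)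
    (hV : ExpMomentBound G μ V) {r : ℕ} (hr : 1 ≤ r) (j : Fin p) (x : G.parents j → ℕ) :
    ∫⁻ y in cyl (G.parents j) x ∩ {y | y j ≠ 0}, ENNReal.ofReal ((y j : ℝ) ^ r) ∂μ ≤
      ENNReal.ofReal (tailConst (par j) r V) * μ (cyl (G.parents j) x ∩ {y | y j ≠ 0}) := by
  by_cases hx : μ (cyl (G.parents j) x) = 0
  · rw [setLIntegral_measure_zero _ _ (measure_mono_null Set.inter_subset_left hx)]
    exact zero_le
  have hint := (hV j _ hx).1
  have h := integral_pow_le_tailConst hM hV hr j hx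
  have hC := tailConst_nonneg (par j) r (zero_le_one.trans (hV.one_le j))
  calc _ ≤ ∫⁻ y in cyl (G.parents j) x, ENNReal.ofReal ((y j : ℝ) ^ r) ∂μ :=
        lintegral_mono_set Set.inter_subset_left
    _ = μ (cyl (G.parents j) x) *
          ENNReal.ofReal (∫ y, (y j : ℝ) ^ r ∂(μ[|cyl (G.parents j) x])) := by
        rw [setLIntegral_eq_mul_lintegral_cond hx, ofReal_integral_eq_lintegral_ofReal
          (integrable_pow hint r) (Filter.Eventually.of_forall fun y => by positivity)]
    _ ≤ μ (cyl (G.parents j) x) * ENNReal.ofReal (tailConst (par j) r V *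
      (μ[|cyl (G.parents j) x]).real {y | y j ≠ 0}) := by gcongr
    _ = _ := by
        rw [ENNReal.ofReal_mul hC, ofReal_measureReal, cond_apply MeasurableSet.of_discrete]
        rw [mul_left_comm, ← mul_assoc (μ (cyl (G.parents j) x)),
          ENNReal.mul_inv_cancel hx (measure_ne_top _ _), one_mul]

/-- The contribution of a set of parent configurations to the score of a complete parent set has
expectation of the order of the expected number of samples in it. -/
theorem lintegral_tsum_momentsRatio_le {par : Fin p → GHDParam} {V : ℝ} (hM : IsGHDModel G μ par)
    (hV : ExpMomentBound G μ V) {r : ℕ} (hr : 2 ≤ r) (j : Fin p) (F : Set (G.parents j → ℕ)) :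
    ∫⁻ D : Data n p, ∑' x : F, ((cell D (G.parents j) x).card : ENNReal) *
        ENNReal.ofReal (momentsRatio (par j) r (empMoment D (cell D (G.parents j) x) j))
        ∂(sampleLaw μ n) ≤
      ENNReal.ofReal (tailConst (par j) r V) * (n * μ {y | (G.parents j).restrict y ∈ F}) := by
  have hset : {y : Fin p → ℕ | (G.parents j).restrict y ∈ F} = ⋃ x : F, cyl (G.parents j) x.1 := by
    ext y; simp [mem_cyl]
  rw [lintegral_tsum fun x => Measurable.of_discrete.aemeasurable, hset,
    measure_iUnion (pairwise_disjoint_cyl Subtype.val_injective) fun _ => MeasurableSet.of_discrete,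
    ← ENNReal.tsum_mul_left, ← ENNReal.tsum_mul_left]
  refine ENNReal.tsum_le_tsum fun x => ?_
  refine le_trans ?_ (lintegral_weighted_average_le (n := n)
    (A := cyl (G.parents j) x.1 ∩ {y | y j ≠ 0}) Set.inter_subset_left _ _
    (setLIntegral_pow_le_tailConst hM hV (by omega) j x.1))
  refine lintegral_mono_ae ?_
  filter_upwards [ae_sampleLaw_atoms (μ := μ) n] with D hD
  set I := cell D (G.parents j) x.1
  have hsum : ∑ i, (cyl (G.parents j) x.1 ∩ {y | y j ≠ 0}).indicator
      (fun y => ENNReal.ofReal ((y j : ℝ) ^ r)) (D i) =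
        ENNReal.ofReal (∑ i ∈ I, (D i j : ℝ) ^ r) := by
    rw [ENNReal.ofReal_sum_of_nonneg fun i _ => by positivity]
    simp only [I, cell]
    rw [Finset.sum_filter]
    refine Finset.sum_congr rfl fun i _ => ?_
    by_cases hi : (G.parents j).restrict (D i) = x.1
    · rw [if_pos hi]
      by_cases h0 : D i j = 0
      · rw [Set.indicator_of_notMem (fun h => h.2 h0), h0, Nat.cast_zero,
          zero_pow (by omega), ENNReal.ofReal_zero]
      · rw [Set.indicator_of_mem (Set.mem_inter (mem_cyl.2 hi) h0)]
    · rw [if_neg hi, Set.indicator_of_notMem (fun h => hi (mem_cyl.1 h.1))]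
  have hZ : (hits D (cyl (G.parents j) x.1 ∩ {y | y j ≠ 0}) : ℝ) =
      ∑ i ∈ I, if D i j = 0 then (0 : ℝ) else 1 := by
    classical
    simp only [I, cell]
    rw [hits, Finset.card_filter, Finset.sum_filter]
    push_cast
    refine Finset.sum_congr rfl fun i _ => ?_
    by_cases hi : (G.parents j).restrict (D i) = x.1 <;> by_cases h0 : D i j = 0 <;>
      simp [mem_cyl, hi, h0]
  rw [← Finset.sum_mul, hsum, hits_cyl]
  by_cases hz : hits D (cyl (G.parents j) x.1 ∩ {y | y j ≠ 0}) = 0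
  · have h0 : ∀ i ∈ I, D i j = 0 := fun i hi => by
      by_contra hne
      have h1 := Finset.single_le_sum (f := fun i => if D i j = 0 then (0 : ℝ) else 1)
        (fun i _ => by split_ifs <;> norm_num) hi
      rw [← hZ, hz] at h1
      simp only [hne, if_false, Nat.cast_zero] at h1
      linarith
    rw [momentsRatio_empMoment_of_zero _ hr D I j h0]
    simp
  · have hpos : (0 : ℝ) < hits D (cyl (G.parents j) x.1 ∩ {y | y j ≠ 0}) := by positivity
    have hle := momentsRatio_empMoment_le_div (par j) hr D I j
      (fun i _ hi => hM.cmr_nonneg hV (hD i) hi r) (fun y => if y = 0 then 0 else 1)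
      (fun y hy => by simp [hy]) (fun y => by
        split_ifs with h
        · positivity
        · exact one_le_pow₀ (by exact_mod_cast Nat.one_le_iff_ne_zero.2 h)) (by simp)
    rw [← hZ] at hle
    calc _ ≤ (I.card : ENNReal) * ENNReal.ofReal ((∑ i ∈ I, (D i j : ℝ) ^ r) /
          (hits D (cyl (G.parents j) x.1 ∩ {y | y j ≠ 0}))) := by gcongr
      _ = _ := by
        rw [ENNReal.ofReal_div_of_pos hpos, ENNReal.ofReal_natCast, mul_comm, ENNReal.mul_comm_div]

end TailRatios

/-! ### Events of high probability in a fixed model -/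

section WithHighProb
variable {p : ℕ} {μ : Measure (Fin p → ℕ)} [IsProbabilityMeasure μ]

variable (μ) in
/-- The property `Q n` of a data set of `n` samples holds with probability tending to one. -/
def WithHighProb (Q : ∀ n, Data n p → Prop) : Prop :=
  ∀ κ > 0, ∃ n₀ : ℕ, ∀ n ≥ n₀, (sampleLaw μ n).real {D | ¬ Q n D} ≤ κ

theorem WithHighProb.mono {Q R : ∀ n, Data n p → Prop} (h : WithHighProb μ Q)
    (hQR : ∀ n D, (∀ i, μ {D i} ≠ 0) → Q n D → R n D) : WithHighProb μ R := by
  intro κ hκ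
  obtain ⟨n₀, hn₀⟩ := h κ hκ
  refine ⟨n₀, fun n hn => le_trans ?_ (hn₀ n hn)⟩
  refine ENNReal.toReal_mono (measure_ne_top _ _) (measure_mono_ae ?_)
  filter_upwards [ae_sampleLaw_atoms (μ := μ) n] with D hD hR hQ
  exact hR (hQR n D hD hQ)

theorem withHighProb_true : WithHighProb μ fun _ _ => True := fun κ hκ =>
  ⟨0, fun n _ => by simpa using hκ.le⟩

theorem WithHighProb.and {Q R : ∀ n, Data n p → Prop} (hQ : WithHighProb μ Q)
    (hR : WithHighProb μ R) : WithHighProb μ fun n D => Q n D ∧ R n D := by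
  intro κ hκ
  obtain ⟨n₁, h₁⟩ := hQ (κ / 2) (by positivity)
  obtain ⟨n₂, h₂⟩ := hR (κ / 2) (by positivity)
  refine ⟨max n₁ n₂, fun n hn => ?_⟩
  have h : {D : Data n p | ¬ (Q n D ∧ R n D)} = {D | ¬ Q n D} ∪ {D | ¬ R n D} := by
    ext D; simp only [Set.mem_union, Set.mem_ofPred_eq]; tauto
  rw [h]
  linarith [measureReal_union_le (μ := sampleLaw μ n) {D | ¬ Q n D} {D | ¬ R n D},
    h₁ n ((le_max_left _ _).trans hn), h₂ n ((le_max_right _ _).trans hn)]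

theorem WithHighProb.forall_mem {ι : Type*} (s : Finset ι) {Q : ι → ∀ n, Data n p → Prop}
    (h : ∀ i ∈ s, WithHighProb μ (Q i)) : WithHighProb μ fun n D => ∀ i ∈ s, Q i n D := by
  classical
  induction s using Finset.induction_on with
  | empty => simpa using withHighProb_true
  | insert a s ha ih =>
    simp only [Finset.mem_insert, forall_eq_or_imp] at h ⊢
    exact h.1.and (ih h.2)

theorem withHighProb_sum (h : (Fin p → ℕ) → ℝ) (hh : MemLp h 2 μ) {t : ℝ} (ht : 0 < t) :
    WithHighProb μ fun n D => |∑ i, h (D i) - n * ∫ y, h y ∂μ| < t * n := by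
  intro κ hκ
  obtain ⟨n₀, hn₀⟩ := exists_sum_deviation_le h hh ht hκ
  exact ⟨n₀, fun n hn => by simpa only [not_lt] using hn₀ n hn⟩

theorem sum_indicator_cyl {n : ℕ} (D : Data n p) (S : Finset (Fin p)) (x : S → ℕ)
    (g : (Fin p → ℕ) → ℝ) : ∑ i, (cyl S x).indicator g (D i) = ∑ i ∈ cell D S x, g (D i) := by
  rw [cell, Finset.sum_filter]
  refine Finset.sum_congr rfl fun i _ => ?_
  by_cases hi : S.restrict (D i) = x
  · rw [Set.indicator_of_mem (mem_cyl.2 hi), if_pos hi]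
  · rw [Set.indicator_of_notMem (mt mem_cyl.1 hi), if_neg hi]

/-- A cell holds at least half of its expected number of samples. -/
theorem withHighProb_lt_card_cell (S : Finset (Fin p)) {x : S → ℕ} (hx : μ (cyl S x) ≠ 0) :
    WithHighProb μ fun n D => μ.real (cyl S x) / 2 * n < (cell D S x).card := by
  have hP : 0 < μ.real (cyl S x) := ENNReal.toReal_pos hx (measure_ne_top _ _)
  have h : MemLp ((cyl S x).indicator fun _ => (1 : ℝ)) 2 μ :=
    (memLp_const 1).indicator MeasurableSet.of_discrete
  refine (withHighProb_sum _ h (half_pos hP)).mono fun _n D _ hD => ?_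
  rw [sum_indicator_cyl, integral_indicator MeasurableSet.of_discrete, setIntegral_const] at hD
  simp only [Finset.sum_const, nsmul_eq_mul, smul_eq_mul, mul_one] at hD
  linarith [(abs_lt.1 hD).1]

/-- Empirical conditional moments converge in probability. -/
theorem withHighProb_empMoment (S : Finset (Fin p)) {x : S → ℕ} (hx : μ (cyl S x) ≠ 0) (j : Fin p)
    (hint : Integrable (fun y => Real.exp (y j)) μ) (k : ℕ) {δ : ℝ} (hδ : 0 < δ) :
    WithHighProb μ fun _n D => x ∈ observed D S →
      |empMoment D (cell D S x) j k - condMoment μ S x j k| < δ := by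
  have hP : 0 < μ.real (cyl S x) := ENNReal.toReal_pos hx (measure_ne_top _ _)
  set m := condMoment μ S x j k with hm
  have hp := cond_isProbabilityMeasure hx
  have hL : MemLp (fun y : Fin p → ℕ => (y j : ℝ) ^ k - m) 2 μ := by
    refine MemLp.sub ?_ (memLp_const _)
    rw [memLp_two_iff_integrable_sq Measurable.of_discrete.aestronglyMeasurable]
    simp only [← pow_mul]
    exact integrable_pow hint _
  have hcint : Integrable (fun y : Fin p → ℕ => (y j : ℝ) ^ k) (μ[|cyl S x]) := by
    rw [ProbabilityTheory.cond]
    exact (integrable_pow hint k).restrict.smul_measure (ENNReal.inv_ne_top.2 hx)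
  have h1 := withHighProb_sum _ (hL.indicator (s := cyl S x) MeasurableSet.of_discrete)
    (t := δ * (μ.real (cyl S x) / 2)) (by positivity)
  refine (h1.and (withHighProb_lt_card_cell S hx)).mono fun n D _ ⟨hD, hN⟩ hobs => ?_
  rw [sum_indicator_cyl, integral_indicator MeasurableSet.of_discrete,
    setIntegral_eq_mul_integral_cond,
    integral_sub hcint (integrable_const _)] at hD
  have hz : ∫ y, (y j : ℝ) ^ k ∂(μ[|cyl S x]) - ∫ _, m ∂(μ[|cyl S x]) = 0 := by
    rw [hm, condMoment]; simp
  rw [hz, mul_zero, mul_zero, sub_zero, Finset.sum_sub_distrib] at hD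
  simp only [Finset.sum_const, nsmul_eq_mul] at hD
  have hc : (0 : ℝ) < (cell D S x).card := by
    exact_mod_cast (mem_observed_iff_cell_nonempty.1 hobs).card_pos
  have he : empMoment D (cell D S x) j k - m =
      (∑ i ∈ cell D S x, (D i j : ℝ) ^ k - (cell D S x).card * m) / (cell D S x).card := by
    rw [empMoment]; field_simp
  rw [he, abs_div, abs_of_pos hc, div_lt_iff₀ hc]
  nlinarith

/-- Markov's inequality on the scale of the sample size. -/
theorem measureReal_le_of_lintegral_le {n : ℕ} (hn : 0 < n) (W : Data n p → ENNReal) {c a : ℝ}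
    (ha : 0 < a) (hc : 0 ≤ c)
    (hW : ∫⁻ D, W D ∂(sampleLaw μ n) ≤ ENNReal.ofReal (c * n)) :
    (sampleLaw μ n).real {D | ¬ W D < ENNReal.ofReal (a * n)} ≤ c / a := by
  have hn' : (0 : ℝ) < n := by exact_mod_cast hn
  simp only [not_lt]
  have h := meas_ge_le_lintegral_div (μ := sampleLaw μ n) (f := W)
    Measurable.of_discrete.aemeasurable
    (ε := ENNReal.ofReal (a * n)) (by simp; positivity) ENNReal.ofReal_ne_top
  refine ENNReal.toReal_le_of_le_ofReal (by positivity) (h.trans ?_)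
  calc _ ≤ ENNReal.ofReal (c * n) / ENNReal.ofReal (a * n) := by gcongr
    _ = ENNReal.ofReal (c / a) := by
      rw [← ENNReal.ofReal_div_of_pos (by positivity), mul_div_mul_right _ _ hn'.ne']

end WithHighProb

section FixedModel
variable {p : ℕ} {G : DAG p} {μ : Measure (Fin p → ℕ)} [IsProbabilityMeasure μ]

/-- The empirical moments ratio of `j` on the configuration `x` of the candidate parent set `S` is
on the right side of the threshold, up to the tolerance. -/
def OnRightSide {n : ℕ} (q : GHDParam) (r : ℕ) (M : ℝ) (D : Data n p) (S Pa : Finset (Fin p))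
    (j : Fin p) (x : S → ℕ) : Prop :=
  (S = Pa → momentsRatio q r (empMoment D (cell D S x) j) ≤ 1 + tolerance M) ∧
    (S ≠ Pa → 1 + M - tolerance M ≤ momentsRatio q r (empMoment D (cell D S x) j))

theorem exists_momentsRatio_stable_at (q : GHDParam) {r : ℕ} (hr : 1 ≤ r) (m : ℕ → ℝ)
    (hd : 0 < q.cmr r 1 * m 1 ^ r - ∑ k ∈ Finset.range r, (stirlingS r k : ℝ) * m k)
    {η : ℝ} (hη : 0 < η) :
    ∃ δ > 0, ∀ m' : ℕ → ℝ, (∀ k ≤ r, |m' k - m k| < δ) →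
      |momentsRatio q r m' - momentsRatio q r m| < η := by
  obtain ⟨δ, hδ, h⟩ := exists_momentsRatio_stable r hr
    (|q.cmr r 1| + ∑ k ∈ Finset.range (r + 1), |m k|) _ η hd hη
  refine ⟨δ, hδ, fun m' hm' => h q m m' ?_ (fun k hk => ?_) le_rfl hm'⟩
  · have : 0 ≤ ∑ k ∈ Finset.range (r + 1), |m k| := Finset.sum_nonneg fun _ _ => abs_nonneg _
    linarith
  · have := Finset.single_le_sum (f := fun k => |m k|) (fun _ _ => abs_nonneg _)
      (Finset.mem_range.2 (show k < r + 1 by omega))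
    have h0 := abs_nonneg (q.cmr r 1)
    linarith

/-- A cell on which all conditional moments are estimated precisely is on the right side. -/
theorem onRightSide_of_abs_sub_lt {n : ℕ} {par : Fin p → GHDParam} {r : ℕ} {M V : ℝ}
    (hM : IsGHDModel G μ par) (hV : ExpMomentBound G μ V) (hgap : RatioGap G μ par r M)
    (hr : 1 ≤ r) {D : Data n p} {j : Fin p} {S : Finset (Fin p)} (hS : S ⊆ G.parents j) {x : S → ℕ}
    (hx : μ (cyl S x) ≠ 0) (h0 : S = G.parents j → condMoment μ S x j 1 ≠ 0)
    (h : |momentsRatio (par j) r (empMoment D (cell D S x) j) -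
      momentsRatio (par j) r (condMoment μ S x j)| < tolerance M) :
    OnRightSide (par j) r M D S (G.parents j) j x := by
  refine ⟨fun he => ?_, fun hne => ?_⟩
  · subst he
    rw [hM.momentsRatio_eq_one hV hx (h0 rfl) hr] at h
    linarith [(abs_lt.1 h).2]
  · have := hgap.lt_momentsRatio hS hne hx
    linarith [(abs_lt.1 h).1]

/-- On a single configuration the empirical ratio converges, as the population denominator is
positive: otherwise the population ratio would be at most `0`. Where the conditional mean given all
parents vanishes, the empirical ratio is `0`. -/
theorem withHighProb_onRightSide {par : Fin p → GHDParam} {r : ℕ} {M V : ℝ} (hM0 : 0 < M)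
    (hM : IsGHDModel G μ par) (hV : ExpMomentBound G μ V) (hgap : RatioGap G μ par r M)
    (hr : 2 ≤ r) {j : Fin p} {S : Finset (Fin p)} (hS : S ⊆ G.parents j) (x : S → ℕ) :
    WithHighProb μ fun _ D => x ∈ observed D S →
      OnRightSide (par j) r M D S (G.parents j) j x := by
  have hη := tolerance_pos hM0
  by_cases hx : μ (cyl S x) = 0
  · refine withHighProb_true.mono fun n D hD _ hobs => ?_
    obtain ⟨i, rfl⟩ := mem_observed.1 hobs
    exact absurd hx (measure_cyl_restrict_ne_zero (hD i) S)
  have hp := cond_isProbabilityMeasure hx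
  have hcint := (hV.integrable_cond hS hx).1
  by_cases h0 : S = G.parents j ∧ condMoment μ S x j 1 = 0
  · refine withHighProb_true.mono fun n D hD _ hobs => ⟨fun _ => ?_, fun h => absurd h0.1 h⟩
    rw [momentsRatio_empMoment_of_zero _ hr _ _ _ fun i hi => ?_]
    · positivity
    · have hi' := mem_cell.1 hi
      have h1 := h0.2
      rw [← hi'] at h1 hcint
      exact eq_zero_of_condMoment_eq_zero (hD i) hcint h1
  have hden : 0 < (par j).cmr r 1 * condMoment μ S x j 1 ^ r -
      ∑ k ∈ Finset.range r, (stirlingS r k : ℝ) * condMoment μ S x j k := by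
    by_contra hneg
    have hle : momentsRatio (par j) r (condMoment μ S x j) ≤ 0 := by
      rw [momentsRatio_eq]
      exact div_nonpos_of_nonneg_of_nonpos (condMoment_nonneg _ _ _ _) (not_lt.1 hneg)
    by_cases hSP : S = G.parents j
    · subst hSP
      rw [hM.momentsRatio_eq_one hV hx (fun h => h0 ⟨rfl, h⟩) (by omega)] at hle
      linarith
    · linarith [hgap.lt_momentsRatio hS hSP hx]
  obtain ⟨δ, hδ, hstab⟩ := exists_momentsRatio_stable_at (par j) (by omega) _ hden hη
  have h1 := WithHighProb.forall_mem (Finset.range (r + 1)) fun k _ =>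
    withHighProb_empMoment S hx j (hV.integrable j).1 k hδ
  refine h1.mono fun n D _ hD hobs => ?_
  exact onRightSide_of_abs_sub_lt hM hV hgap (by omega) hS hx (fun h h' => h0 ⟨h, h'⟩)
    (hstab _ fun k hk => hD k (Finset.mem_range.2 (by omega)) hobs)

theorem exists_finite_measure_compl_lt (S : Finset (Fin p)) (x₀ : S → ℕ) {c : ENNReal}
    (hc : 0 < c) :
    ∃ F : Set (S → ℕ), F.Finite ∧ x₀ ∈ F ∧ μ {y | S.restrict y ∈ Fᶜ} < c := by
  have hsum : ∑' x : S → ℕ, μ (cyl S x) ≠ ⊤ := by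
    rw [← measure_iUnion (pairwise_disjoint_cyl (f := fun x : S → ℕ => x) Function.injective_id)
      fun _ => MeasurableSet.of_discrete]
    exact measure_ne_top _ _
  have h := (ENNReal.tendsto_tsum_compl_atTop_zero hsum).eventually_lt_const hc
  obtain ⟨F, hF, hx⟩ := (h.and (Filter.eventually_ge_atTop {x₀})).exists
  refine ⟨F, F.finite_toSet, hx (Finset.mem_singleton_self _), lt_of_le_of_lt (le_of_eq ?_) hF⟩
  have hset : {y : Fin p → ℕ | S.restrict y ∈ (F : Set (S → ℕ))ᶜ} =
      ⋃ x : {x // x ∉ F}, cyl S x.1 := by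
    ext y; simp [mem_cyl]
  rw [hset, measure_iUnion (pairwise_disjoint_cyl Subtype.val_injective)
    fun _ => MeasurableSet.of_discrete]

theorem sum_le_tsum_compl {α : Type*} (T : Finset α) (F : Set α) (hT : ∀ x ∈ T, x ∉ F)
    (f : α → ENNReal) : ∑ x ∈ T, f x ≤ ∑' x : (Fᶜ : Set α), f x := by
  rw [tsum_subtype (Fᶜ) f]
  refine le_trans (le_of_eq (Finset.sum_congr rfl fun x hx => ?_)) (ENNReal.sum_le_tsum T)
  rw [Set.indicator_of_mem (hT x hx)]

open Classical in
/-- If the configurations outside `F` are rarer than some `x₀ ∈ F`, then either none of them is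
counted, or `x₀` is counted and outweighs them. -/
theorem informative_of_rare_cells {n : ℕ} {q : GHDParam} {r : ℕ} {M : ℝ} (hM0 : 0 < M)
    {D : Data n p} {S Pa : Finset (Fin p)} {j : Fin p}
    (hnn : ∀ x, 0 ≤ momentsRatio q r (empMoment D (cell D S x) j)) (F : Set (S → ℕ))
    {x₀ : S → ℕ} (hx₀F : x₀ ∈ F) {ρ : ℝ} (hρ : 0 < ρ)
    (hacc : ∀ x ∈ F, x ∈ observed D S → OnRightSide q r M D S Pa j x)
    (hcard : ρ * n < (cell D S x₀).card)
    (hsum₁ : ∑ x ∈ (observed D S).filter (· ∉ F), ((cell D S x).card : ℝ) < tolerance M * ρ * n)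
    (hsum₂ : S = Pa → ∑ x ∈ (observed D S).filter (· ∉ F), ((cell D S x).card : ℝ) *
      momentsRatio q r (empMoment D (cell D S x) j) < tolerance M * ρ * n) :
    ∀ Nmin, 1 ≤ Nmin → (S ≠ Pa → (∃ x, Nmin ≤ (cell D S x).card) ∨ (Nmin : ℝ) ≤ ρ * n) →
      Informative q r Nmin M D S Pa j := by
  intro Nmin hN hlarge
  have hη := tolerance_pos hM0
  have hη1 : tolerance M ≤ 1 := by
    have := tolerance_mul hM0; nlinarith
  set a := tolerance M * ρ with ha_def
  set T := (observed D S).filter (· ∉ F) with hT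
  have htc : ∀ x, (truncCount Nmin D S x : ℝ) ≤ (cell D S x).card := fun x => by
    exact_mod_cast truncCount_le Nmin D S x
  -- if some configuration outside `F` is frequent enough to be counted, then so is `x₀`
  have htotal : (∃ x ∈ T, truncCount Nmin D S x ≠ 0) →
    a * n ≤ tolerance M * totalCount Nmin D S := by
    rintro ⟨x, hx, hne⟩
    have h3 : Nmin ≤ (cell D S x).card := by
      by_contra h; exact hne (if_neg h)
    have h4 : ((cell D S x).card : ℝ) < a * n := lt_of_le_of_lt
      (Finset.single_le_sum (f := fun x => ((cell D S x).card : ℝ)) (fun _ _ => by positivity) hx)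
      hsum₁
    have h5 : a * n ≤ ρ * n := by
      gcongr
      rw [ha_def]
      exact mul_le_of_le_one_left hρ.le hη1
    have h6 : Nmin ≤ (cell D S x₀).card := by
      refine h3.trans ?_
      have : ((cell D S x).card : ℝ) ≤ (cell D S x₀).card := by linarith
      exact_mod_cast this
    have h7 : ((cell D S x₀).card : ℝ) ≤ totalCount Nmin D S := by
      exact_mod_cast card_cell_le_totalCount D S x₀ h6
    rw [ha_def, mul_assoc]
    gcongr
    linarith
  have hzero : (¬ ∃ x ∈ T, truncCount Nmin D S x ≠ 0) → ∀ x ∈ T, (truncCount Nmin D S x : ℝ) = 0 :=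
    fun h x hx => by
      by_contra hne
      exact h ⟨x, hx, by exact_mod_cast hne⟩
  refine ⟨F, fun x hx hxF => hacc x hxF hx, fun hSP => ?_, fun _ => ?_,
    fun hne => ?_, fun h0 x => ?_⟩
  · by_cases hex : ∃ x ∈ T, truncCount Nmin D S x ≠ 0
    · refine le_trans ?_ (htotal hex)
      refine le_trans (Finset.sum_le_sum fun x _ => ?_) (hsum₂ hSP).le
      exact mul_le_mul_of_nonneg_right (htc x) (hnn x)
    · rw [Finset.sum_eq_zero fun x hx => by rw [hzero hex x hx, zero_mul]]
      positivity
  · by_cases hex : ∃ x ∈ T, truncCount Nmin D S x ≠ 0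
    · exact le_trans (Finset.sum_le_sum fun x _ => htc x) (hsum₁.le.trans (htotal hex))
    · rw [Finset.sum_eq_zero (hzero hex)]
      positivity
  · rcases hlarge hne with ⟨x, hx⟩ | h
    · exact totalCount_pos hN D S x hx
    · refine totalCount_pos hN D S x₀ ?_
      have : (Nmin : ℝ) ≤ (cell D S x₀).card := by linarith
      exact_mod_cast this
  · subst h0
    rw [Subsingleton.elim x x₀]
    exact hx₀F

open Classical in
/-- Finitely many configurations carry the score of a candidate parent set, up to the tolerance. -/
theorem withHighProb_informative {par : Fin p → GHDParam} {r : ℕ} {M V : ℝ} (hM0 : 0 < M)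
    (hM : IsGHDModel G μ par) (hV : ExpMomentBound G μ V) (hgap : RatioGap G μ par r M)
    (hr : 2 ≤ r) {j : Fin p} {S : Finset (Fin p)} (hS : S ⊆ G.parents j) :
    ∃ ρ > 0, WithHighProb μ fun n D => ∀ Nmin, 1 ≤ Nmin →
      (S ≠ G.parents j → (∃ x, Nmin ≤ (cell D S x).card) ∨ (Nmin : ℝ) ≤ ρ * n) →
      Informative (par j) r Nmin M D S (G.parents j) j := by
  have hη := tolerance_pos hM0
  obtain ⟨x₀, hx₀⟩ : ∃ x₀ : S → ℕ, μ (cyl S x₀) ≠ 0 := by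
    obtain ⟨D, hD⟩ := (ae_sampleLaw_atoms (μ := μ) 1).exists
    exact ⟨_, measure_cyl_restrict_ne_zero (hD 0) S⟩
  set ρ := μ.real (cyl S x₀) / 2 with hρdef
  have hρ : 0 < ρ := half_pos (ENNReal.toReal_pos hx₀ (measure_ne_top _ _))
  refine ⟨ρ, hρ, fun κ hκ => ?_⟩
  set Kc := tailConst (par j) r V
  have hKc : 0 ≤ Kc := tailConst_nonneg _ _ (zero_le_one.trans (hV.one_le j))
  set a := tolerance M * ρ with ha_def
  have ha : 0 < a := mul_pos hη hρ
  set τ := κ * a / (4 * (1 + Kc)) with hτ_def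
  have hτ : 0 < τ := by positivity
  have hτ1 : τ / a ≤ κ / 4 := by
    rw [hτ_def]; field_simp; linarith
  have hτ2 : Kc * τ / a ≤ κ / 4 := by
    rw [hτ_def]; field_simp; linarith
  obtain ⟨F, hFfin, hx₀F, hF⟩ := exists_finite_measure_compl_lt (μ := μ) S x₀
    (ENNReal.ofReal_pos.2 hτ)
  obtain ⟨n₁, h₁⟩ := ((WithHighProb.forall_mem hFfin.toFinset fun x _ =>
    withHighProb_onRightSide hM0 hM hV hgap hr hS x).and (withHighProb_lt_card_cell S hx₀))
      (κ / 2) (by positivity)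
  refine ⟨n₁ + 1, fun n hn => ?_⟩
  have hn0 : 0 < n := by omega
  let W₁ : Data n p → ENNReal := fun D =>
    ∑' x : (Fᶜ : Set (S → ℕ)), ((cell D S x).card : ENNReal)
  let W₂ : Data n p → ENNReal := fun D =>
    if S = G.parents j then ∑' x : (Fᶜ : Set (S → ℕ)), ((cell D S x).card : ENNReal) *
        ENNReal.ofReal (momentsRatio (par j) r (empMoment D (cell D S x) j)) else 0
  have hW₁ : ∫⁻ D, W₁ D ∂(sampleLaw μ n) ≤ ENNReal.ofReal (τ * n) := by
    simp only [W₁]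
    rw [lintegral_tsum fun x => Measurable.of_discrete.aemeasurable]
    simp only [← hits_cyl, lintegral_hits]
    rw [ENNReal.tsum_mul_left, ← measure_iUnion (pairwise_disjoint_cyl Subtype.val_injective)
      fun _ => MeasurableSet.of_discrete, ENNReal.ofReal_mul hτ.le, mul_comm,
        ENNReal.ofReal_natCast]
    gcongr
    refine le_trans (measure_mono ?_) hF.le
    intro y hy
    obtain ⟨x, hx⟩ := Set.mem_iUnion.1 hy
    rw [Set.mem_ofPred_eq, mem_cyl.1 hx]
    exact x.2
  have hW₂ : ∫⁻ D, W₂ D ∂(sampleLaw μ n) ≤ ENNReal.ofReal (Kc * τ * n) := by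
    by_cases hSP : S = G.parents j
    · subst hSP
      simp only [W₂, if_true]
      refine (lintegral_tsum_momentsRatio_le hM hV hr j _).trans ?_
      rw [ENNReal.ofReal_mul (by positivity), ENNReal.ofReal_mul hKc, ENNReal.ofReal_natCast,
        mul_assoc, mul_comm (n : ENNReal)]
      gcongr
    · simp only [W₂, if_neg hSP, lintegral_zero]; exact zero_le
  have b₁ := (measureReal_le_of_lintegral_le hn0 W₁ ha hτ.le hW₁).trans hτ1
  have b₂ := (measureReal_le_of_lintegral_le hn0 W₂ ha (by positivity) hW₂).trans hτ2
  have b₃ := h₁ n (by omega)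
  simp only [Set.Finite.mem_toFinset] at b₃
  refine le_trans (ENNReal.toReal_mono (measure_ne_top _ _) (measure_mono_ae (t :=
    {D : Data n p | ¬ ((∀ x ∈ F, x ∈ observed D S → OnRightSide (par j) r M D S (G.parents j) j x) ∧
      μ.real (cyl S x₀) / 2 * n < (cell D S x₀).card)} ∪ ({D | ¬ W₁ D < ENNReal.ofReal (a * n)} ∪
      {D | ¬ W₂ D < ENNReal.ofReal (a * n)})) ?_)) ?_
  swap
  · refine (measureReal_union_le _ _).trans ?_
    have := measureReal_union_le (μ := sampleLaw μ n) {D | ¬ W₁ D < ENNReal.ofReal (a * n)}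
      {D | ¬ W₂ D < ENNReal.ofReal (a * n)}
    linarith
  filter_upwards [ae_sampleLaw_atoms (μ := μ) n] with D hD hbad
  by_contra hgood
  refine hbad ?_
  have hgood' : ((∀ x ∈ F, x ∈ observed D S → OnRightSide (par j) r M D S (G.parents j) j x) ∧
      ρ * n < (cell D S x₀).card) ∧ W₁ D < ENNReal.ofReal (a * n) ∧
      W₂ D < ENNReal.ofReal (a * n) := by
    refine ⟨by_contra fun h => hgood (Or.inl h), by_contra fun h => hgood (Or.inr (Or.inl h)),
      by_contra fun h => hgood (Or.inr (Or.inr h))⟩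
  obtain ⟨⟨hacc, hcard⟩, h1, h2⟩ := hgood'
  have hnn : ∀ x, 0 ≤ momentsRatio (par j) r (empMoment D (cell D S x) j) := fun x =>
    hM.momentsRatio_nonneg hV hr hD j _
  have hTF : ∀ x ∈ (observed D S).filter (· ∉ F), x ∉ F := fun x hx => (Finset.mem_filter.1 hx).2
  have han : 0 < a * n := by positivity
  have hsum₁ : ∑ x ∈ (observed D S).filter (· ∉ F), ((cell D S x).card : ℝ) < a * n := by
    have h3 := (sum_le_tsum_compl _ _ hTF fun x => ((cell D S x).card : ENNReal)).trans_lt h1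
    rw [← ENNReal.ofReal_lt_ofReal_iff han, ENNReal.ofReal_sum_of_nonneg fun _ _ => by positivity]
    simpa only [ENNReal.ofReal_natCast] using h3
  refine informative_of_rare_cells hM0 hnn F hx₀F hρ hacc hcard hsum₁ fun hSP => ?_
  simp only [W₂, if_pos hSP] at h2
  have h3 := (sum_le_tsum_compl _ _ hTF fun x => ((cell D S x).card : ENNReal) *
    ENNReal.ofReal (momentsRatio (par j) r (empMoment D (cell D S x) j))).trans_lt h2
  rw [← ENNReal.ofReal_lt_ofReal_iff han, ENNReal.ofReal_sum_of_nonneg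
    fun x _ => mul_nonneg (by positivity) (hnn x)]
  refine lt_of_eq_of_lt (Finset.sum_congr rfl fun x _ => ?_) h3
  rw [ENNReal.ofReal_mul (Nat.cast_nonneg _), ENNReal.ofReal_natCast]

end FixedModel

/-! ### The guarantee for a fixed model -/

theorem mrsRecovers_of_le_one {n p : ℕ} (hp : p ≤ 1) (G : DAG p) (par : Fin p → GHDParam)
    (r Nmin : ℕ) (D : Data n p) : MRSRecovers G par r Nmin D := by
  intro π _ j k hjk
  have : j = k := Fin.ext (by omega)
  subst this
  exact absurd (Relation.TransGen.single hjk) (G.acyclic _)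

theorem mrsGuarantee_of_le_one {p : ℕ} (hp : p ≤ 1) (G : DAG p) (μ : Measure (Fin p → ℕ))
    [IsProbabilityMeasure μ] (par : Fin p → GHDParam) (r d : ℕ) (K : ℝ) {ε : ℝ} (hε : 0 < ε)
    (C : ℝ) : MRSGuarantee G μ par r d K ε C := by
  intro n Nmin _ _
  simp only [mrsRecovers_of_le_one hp, implies_true]
  have : (sampleLaw μ n).real {_D : Data n p | True} = 1 := by simp
  rw [this]
  constructor
  · linarith
  · intro; linarith

section LogRate
variable {n p r : ℕ}

theorem log_two_le_log_max (hp : 2 ≤ p) : Real.log 2 ≤ Real.log (max n p : ℝ) :=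
  Real.log_le_log (by norm_num) (le_max_of_le_right (by exact_mod_cast hp))

theorem two_mul_log_two_le (hp : 2 ≤ p) (hr : 2 ≤ r) :
    2 * Real.log 2 ≤ Real.log p + Real.log r := by
  have h1 : Real.log 2 ≤ Real.log p := Real.log_le_log (by norm_num) (by exact_mod_cast hp)
  have h2 : Real.log 2 ≤ Real.log r := Real.log_le_log (by norm_num) (by exact_mod_cast hr)
  linarith

theorem le_logRate (hp : 2 ≤ p) (hr : 2 ≤ r) (e : ℕ) :
    Real.log 2 ^ e * (2 * Real.log 2) ≤ logRate e n p r := by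
  have h0 : 0 < Real.log 2 := Real.log_pos (by norm_num)
  exact mul_le_mul (pow_le_pow_left₀ h0.le (log_two_le_log_max hp) e) (two_mul_log_two_le hp hr)
    (by positivity) (pow_nonneg (h0.le.trans (log_two_le_log_max hp)) e)

theorem logRate_add (e d : ℕ) :
    logRate (e + d) n p r = Real.log (max n p : ℝ) ^ d * logRate e n p r := by
  simp only [logRate, pow_add]; ring

end LogRate

/-- It is enough to bound the probability that the algorithm fails although one of the two
conditions on the minimum cell size holds. -/
theorem mrsGuarantee_of_failure_le {p : ℕ} {G : DAG p} {μ : Measure (Fin p → ℕ)}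
    [IsProbabilityMeasure μ] {par : Fin p → GHDParam} {r d : ℕ} {K ε C : ℝ}
    (h : ∀ n : ℕ, C * logRate (2 * r + d) n p r < n → (sampleLaw μ n).real
      {D | ¬ ∀ Nmin, 1 ≤ Nmin → (LargeCells G Nmin D ∨ (Nmin : ℝ) ≤ K * logRate (2 * r) n p r) →
        MRSRecovers G par r Nmin D} ≤ ε) : MRSGuarantee G μ par r d K ε C := by
  intro n Nmin hN hn
  have h1 := h n hn
  have key : ∀ E : Set (Data n p), {D | ¬ ∀ Nmin, 1 ≤ Nmin → (LargeCells G Nmin D ∨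
      (Nmin : ℝ) ≤ K * logRate (2 * r) n p r) → MRSRecovers G par r Nmin D}ᶜ ⊆ E →
      1 - ε ≤ (sampleLaw μ n).real E := fun E hE => by
    refine le_trans ?_ (measureReal_mono hE)
    rw [probReal_compl_eq_one_sub MeasurableSet.of_discrete]
    linarith
  refine ⟨key _ fun D hD => ?_, fun hK => key _ fun D hD => ?_⟩ <;>
    simp only [Set.mem_compl_iff, Set.mem_ofPred_eq, not_not] at hD ⊢
  · exact fun hL => hD Nmin hN (Or.inl hL)
  · exact hD Nmin hN (Or.inr hK)

section FixedModel
variable {p : ℕ} {G : DAG p} {μ : Measure (Fin p → ℕ)} [IsProbabilityMeasure μ]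

/-- For `S ⊂ Pa(j)` the condition on the data applies with `Pa₀ = Pa(j) \ S`. -/
theorem LargeCells.exists_le {n Nmin : ℕ} {D : Data n p} (h : LargeCells G Nmin D) {j : Fin p}
    {S : Finset (Fin p)} (hS : S ⊆ G.parents j) (hne : S ≠ G.parents j) :
    ∃ x : S → ℕ, Nmin ≤ (cell D S x).card := by
  refine h j (G.parents j \ S) Finset.sdiff_subset ?_ S fun k hk => ?_
  · rw [Finset.sdiff_nonempty]
    exact fun h => hne (hS.antisymm h)
  · rw [Finset.mem_sdiff, Finset.mem_sdiff]
    exact ⟨G.parents_subset_nonDescendants j (hS hk), fun h => h.2 hk⟩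

/-- The constant `ρ` is the least of those of the finitely many candidate parent sets. -/
theorem withHighProb_mrsRecovers {par : Fin p → GHDParam} {r : ℕ} {M V : ℝ} (hp : 1 ≤ p)
    (hM0 : 0 < M) (hM : IsGHDModel G μ par) (hV : ExpMomentBound G μ V)
    (hgap : RatioGap G μ par r M) (hr : 2 ≤ r) :
    ∃ ρ > 0, WithHighProb μ fun n D => 0 < n → ∀ Nmin, 1 ≤ Nmin →
      (LargeCells G Nmin D ∨ (Nmin : ℝ) ≤ ρ * n) → MRSRecovers G par r Nmin D := by
  have h : ∀ i : Fin p × Finset (Fin p), ∃ ρ > 0, WithHighProb μ fun n D =>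
      i.2 ⊆ G.parents i.1 → ∀ Nmin, 1 ≤ Nmin →
      (i.2 ≠ G.parents i.1 → (∃ x, Nmin ≤ (cell D i.2 x).card) ∨ (Nmin : ℝ) ≤ ρ * n) →
      Informative (par i.1) r Nmin M D i.2 (G.parents i.1) i.1 := by
    intro i
    by_cases hS : i.2 ⊆ G.parents i.1
    · obtain ⟨ρ, hρ, h⟩ := withHighProb_informative hM0 hM hV hgap hr hS
      exact ⟨ρ, hρ, h.mono fun n D _ hQ _ => hQ⟩
    · exact ⟨1, one_pos, withHighProb_true.mono fun n D _ _ h => absurd h hS⟩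
  choose ρ hρ hQ using h
  have : Nonempty (Fin p × Finset (Fin p)) := ⟨⟨⟨0, hp⟩, ∅⟩⟩
  obtain ⟨i₀, hi₀⟩ := Finite.exists_min ρ
  refine ⟨ρ i₀, hρ i₀, ?_⟩
  refine (WithHighProb.forall_mem Finset.univ fun i _ => hQ i).mono
    fun n D hD hall hn Nmin hN hor => ?_
  refine mrsRecovers_of_informative hn G par r Nmin hM0 D
    (fun j I => hM.momentsRatio_nonneg hV hr hD j I)
    fun j S hS => hall (j, S) (Finset.mem_univ _) hS Nmin hN fun hne => ?_
  rcases hor with hL | hle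
  · exact Or.inl (hL.exists_le hS hne)
  · refine Or.inr (hle.trans ?_)
    gcongr
    exact hi₀ _

/-- One part of the constant forces `n` to be large; the other makes
`K log^{2r}(max(n,p)) (log p + log r)` at most `ρ n`. Both use that `log (max n p)` and
`log p + log r` are bounded below once `p ≥ 2`. -/
theorem exists_mrsGuarantee {par : Fin p → GHDParam} {r : ℕ} {M V K ε : ℝ} (d : ℕ) (hp : 1 ≤ p)
    (hM0 : 0 < M) (hK : 0 < K) (hε : 0 < ε) (hM : IsGHDModel G μ par) (hV : ExpMomentBound G μ V)
    (hgap : RatioGap G μ par r M) (hr : 2 ≤ r) :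
    ∃ C : ℝ, 0 < C ∧ MRSGuarantee G μ par r d K ε C := by
  rcases Nat.lt_or_ge p 2 with h1 | hp2
  · exact ⟨1, one_pos, mrsGuarantee_of_le_one (by omega) G μ par r d K hε 1⟩
  obtain ⟨ρ, hρ, hQ⟩ := withHighProb_mrsRecovers hp hM0 hM hV hgap hr
  obtain ⟨n₀, hn₀⟩ := hQ ε hε
  have h0 : 0 < Real.log 2 := Real.log_pos (by norm_num)
  set c := Real.log 2 ^ (2 * r + d) * (2 * Real.log 2) with hc
  have hc0 : 0 < c := by positivity
  refine ⟨(n₀ + 1) / c + K / (ρ * Real.log 2 ^ d), by positivity,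
    mrsGuarantee_of_failure_le fun n hn => ?_⟩
  have hrate : c ≤ logRate (2 * r + d) n p r := le_logRate hp2 hr _
  rw [add_mul] at hn
  have a1 : (n₀ + 1 : ℝ) ≤ (n₀ + 1) / c * logRate (2 * r + d) n p r := by
    rw [div_mul_eq_mul_div, le_div_iff₀ hc0]; gcongr
  have a2 : K * logRate (2 * r) n p r ≤
      ρ * (K / (ρ * Real.log 2 ^ d) * logRate (2 * r + d) n p r) := by
    have hl : 0 ≤ logRate (2 * r) n p r := le_trans (by positivity) (le_logRate hp2 hr _)
    calc K * logRate (2 * r) n p r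
        = K / Real.log 2 ^ d * (Real.log 2 ^ d * logRate (2 * r) n p r) := by field_simp
      _ ≤ K / Real.log 2 ^ d * (Real.log (max n p : ℝ) ^ d * logRate (2 * r) n p r) := by
        have := pow_le_pow_left₀ h0.le (log_two_le_log_max (n := n) hp2) d
        gcongr
      _ = _ := by rw [logRate_add]; field_simp
  have a3 : 0 ≤ K / (ρ * Real.log 2 ^ d) * logRate (2 * r + d) n p r :=
    mul_nonneg (by positivity) (hc0.le.trans hrate)
  have hnn : n₀ + 1 ≤ n := by
    have : ((n₀ + 1 : ℕ) : ℝ) ≤ n := by push_cast; linarith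
    exact_mod_cast this
  refine le_trans (measureReal_mono ?_) (hn₀ n (by omega))
  intro D hD
  rw [Set.mem_ofPred_eq] at hD ⊢
  refine fun hgood => hD fun Nmin hN hor => ?_
  refine hgood (by omega) Nmin hN (hor.imp_right fun h => h.trans (a2.trans ?_))
  have : (0 : ℝ) ≤ (n₀ + 1) / c * logRate (2 * r + d) n p r := le_trans (by positivity) a1
  gcongr
  linarith

end FixedModel

/-! ### Truncation and bounded data -/

section Truncation
variable {p : ℕ} {G : DAG p} {μ : Measure (Fin p → ℕ)} [IsProbabilityMeasure μ]

theorem measureReal_exists_gt_le {V : ℝ} (hV : ExpMomentBound G μ V) (n : ℕ) (b : ℝ) :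
    (sampleLaw μ n).real {D | ∃ i j, b < D i j} ≤ n * (p * (V * Real.exp (-b))) := by
  have h1 : ∀ (i : Fin n) (j : Fin p),
      (sampleLaw μ n).real {D | b < D i j} ≤ V * Real.exp (-b) := by
    intro i j
    have hmp : MeasurePreserving (fun D : Data n p => D i) (sampleLaw μ n) μ :=
      measurePreserving_eval (fun _ : Fin n => μ) i
    have h2 : (sampleLaw μ n).real {D | b < D i j} = μ.real {y | b < y j} :=
      hmp.measureReal_preimage (s := {y : Fin p → ℕ | b < y j})
        MeasurableSet.of_discrete.nullMeasurableSet
    have h3 := mul_meas_ge_le_integral_of_nonneg (μ := μ)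
      (Filter.Eventually.of_forall fun y => (Real.exp_pos (y j)).le) (hV.integrable j).1
        (Real.exp b)
    have h4 : μ.real {y | b < y j} ≤ μ.real {y | Real.exp b ≤ Real.exp (y j)} := by
      refine measureReal_mono fun y hy => ?_
      rw [Set.mem_ofPred_eq] at hy ⊢
      exact Real.exp_le_exp.2 hy.le
    rw [h2, Real.exp_neg, ← div_eq_mul_inv, le_div_iff₀ (Real.exp_pos _), mul_comm]
    refine le_trans ?_ (h3.trans (hV.integrable j).2)
    gcongr
  have hset : {D : Data n p | ∃ i j, b < D i j} =
      ⋃ i ∈ (Finset.univ : Finset (Fin n)), ⋃ j ∈ (Finset.univ : Finset (Fin p)),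
        {D | b < D i j} := by
    ext D; simp
  rw [hset]
  refine (measureReal_biUnion_finset_le _ _).trans ((Finset.sum_le_sum fun i _ =>
    (measureReal_biUnion_finset_le _ _).trans (Finset.sum_le_sum fun j _ => h1 i j)).trans ?_)
  simp

/-- The `k`-th power of the coordinate `j`, truncated at `b`. -/
noncomputable def truncPow (b : ℝ) (j : Fin p) (k : ℕ) (y : Fin p → ℕ) : ℝ :=
  if (y j : ℝ) ≤ b then (y j : ℝ) ^ k else 0

theorem truncPow_nonneg (b : ℝ) (j : Fin p) (k : ℕ) (y : Fin p → ℕ) : 0 ≤ truncPow b j k y := by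
  unfold truncPow; split_ifs <;> positivity

theorem truncPow_le {b : ℝ} (hb : 1 ≤ b) (j : Fin p) {k r : ℕ} (hk : k ≤ r) (y : Fin p → ℕ) :
    truncPow b j k y ≤ b ^ r := by
  unfold truncPow; split_ifs with h
  · exact (pow_le_pow_left₀ (by positivity) h k).trans (pow_le_pow_right₀ hb hk)
  · positivity

theorem truncPow_le_pow (b : ℝ) (j : Fin p) (k : ℕ) (y : Fin p → ℕ) :
    truncPow b j k y ≤ (y j : ℝ) ^ k := by
  unfold truncPow; split_ifs
  · exact le_rfl
  · positivity

theorem integrable_truncPow {ν : Measure (Fin p → ℕ)} [IsFiniteMeasure ν] {b : ℝ} (hb : 1 ≤ b)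
    (j : Fin p) (k : ℕ) : Integrable (truncPow b j k) ν :=
  Integrable.of_bound Measurable.of_discrete.aestronglyMeasurable (b ^ k)
    (Filter.Eventually.of_forall fun y => by
      rw [Real.norm_eq_abs, abs_of_nonneg (truncPow_nonneg _ _ _ _)]
      exact truncPow_le hb j le_rfl y)

theorem integral_truncPow_sq_le {ν : Measure (Fin p → ℕ)} [IsProbabilityMeasure ν] {b V : ℝ}
    {j : Fin p} (hint : Integrable (fun y => Real.exp (y j)) ν)
    (hV : ∫ y, Real.exp (y j) ∂ν ≤ V) {k r : ℕ} (hk : k ≤ r) :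
    ∫ y, truncPow b j k y ^ 2 ∂ν ≤ (2 * r).factorial * V := by
  have h0 : 0 ≤ V := (integral_nonneg fun y => (Real.exp_pos _).le).trans hV
  calc ∫ y, truncPow b j k y ^ 2 ∂ν ≤ ∫ y, (y j : ℝ) ^ (2 * k) ∂ν := by
        refine integral_mono_of_nonneg (Filter.Eventually.of_forall fun y => by positivity)
          (integrable_pow hint _) (Filter.Eventually.of_forall fun y => ?_)
        have := pow_le_pow_left₀ (truncPow_nonneg b j k y) (truncPow_le_pow b j k y) 2
        rwa [← pow_mul, mul_comm k] at this
    _ ≤ (2 * k).factorial * ∫ y, Real.exp (y j) ∂ν := integral_pow_le hint _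
    _ ≤ (2 * r).factorial * V := by gcongr

/-- The truncation bias: `x ^ k ≤ x ^ (k + 1) / b` for `x > b`. -/
theorem abs_integral_truncPow_sub_le {ν : Measure (Fin p → ℕ)} [IsProbabilityMeasure ν] {b V : ℝ}
    (hb : 1 ≤ b) {j : Fin p} (hint : Integrable (fun y => Real.exp (y j)) ν)
    (hV : ∫ y, Real.exp (y j) ∂ν ≤ V) {k r : ℕ} (hk : k ≤ r) :
    |∫ y, truncPow b j k y ∂ν - ∫ y, (y j : ℝ) ^ k ∂ν| ≤ (r + 1).factorial * V / b := by
  have h0 : 0 ≤ V := (integral_nonneg fun y => (Real.exp_pos _).le).trans hV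
  have hb0 : 0 < b := zero_lt_one.trans_le hb
  rw [abs_sub_comm, ← integral_sub (integrable_pow hint k) (integrable_truncPow hb j k),
    abs_of_nonneg (integral_nonneg fun y => sub_nonneg.2 (truncPow_le_pow b j k y))]
  calc ∫ y, ((y j : ℝ) ^ k - truncPow b j k y) ∂ν ≤ ∫ y, (y j : ℝ) ^ (k + 1) / b ∂ν := by
        refine integral_mono ((integrable_pow hint k).sub (integrable_truncPow hb j k))
          ((integrable_pow hint _).div_const _) fun y => ?_
        simp only [truncPow]
        split_ifs with h
        · rw [sub_self]; positivity
        · rw [sub_zero, le_div_iff₀ hb0, pow_succ]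
          gcongr
          linarith
    _ ≤ (r + 1).factorial * V / b := by
        rw [integral_div]
        gcongr
        refine (integral_pow_le hint _).trans ?_
        gcongr

end Truncation

section Deterministic
variable {p n : ℕ}

theorem card_observed_le {D : Data n p} {B d : ℕ} (hB : ∀ i k, D i k ≤ B) {S : Finset (Fin p)}
    (hS : S.card ≤ d) : (observed D S).card ≤ (B + 1) ^ d := by
  have hsub : observed D S ⊆ Fintype.piFinset fun _ : S => Finset.range (B + 1) := by
    intro x hx
    obtain ⟨i, rfl⟩ := mem_observed.1 hx
    simp only [Fintype.mem_piFinset, Finset.mem_range, Finset.restrict]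
    exact fun k => Nat.lt_succ_of_le (hB i k)
  refine (Finset.card_le_card hsub).trans ?_
  rw [Fintype.card_piFinset]
  simp only [Finset.card_range, Finset.prod_const, Finset.card_univ, Fintype.card_coe]
  exact Nat.pow_le_pow_right (by omega) hS

/-- Pigeonhole principle for the cells of bounded data. -/
theorem exists_le_card_cell {D : Data n p} {B d : ℕ} (hB : ∀ i k, D i k ≤ B)
    {S : Finset (Fin p)} (hS : S.card ≤ d) {Nmin : ℕ} (h : (B + 1) ^ d * Nmin < n) :
    ∃ x : S → ℕ, Nmin ≤ (cell D S x).card := by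
  by_contra! hlt
  have h1 : n ≤ (observed D S).card * Nmin := by
    calc n = ∑ x ∈ observed D S, (cell D S x).card := (sum_card_cell D S).symm
      _ ≤ ∑ _x ∈ observed D S, Nmin := Finset.sum_le_sum fun x _ => (hlt x).le
      _ = _ := by rw [Finset.sum_const, smul_eq_mul]
  have := Nat.mul_le_mul_right Nmin (card_observed_le hB hS)
  omega

open Classical in
/-- If the data are bounded by `B`, cells with fewer than `T` samples hold at most `T (B+1)^d`
samples in total, and their moments ratios are at most `B`. -/
theorem informative_of_bounded {q : GHDParam} {r : ℕ} {M : ℝ} (hM0 : 0 < M) {D : Data n p}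
    {B d : ℕ} (hB : ∀ i k, D i k ≤ B) {S Pa : Finset (Fin p)} (hS : S.card ≤ d) {j : Fin p}
    (hnn : ∀ x, 0 ≤ momentsRatio q r (empMoment D (cell D S x) j))
    (hle : ∀ x, momentsRatio q r (empMoment D (cell D S x) j) ≤ B) {T : ℝ} (hT : 0 ≤ T)
    (hn : T * (B + 1) ^ (d + 1) ≤ tolerance M * (n / 2))
    (hacc : ∀ x ∈ observed D S, T ≤ (cell D S x).card → OnRightSide q r M D S Pa j x)
    {Nmin : ℕ} (hN : 1 ≤ Nmin) (hlarge : S ≠ Pa → ∃ x, Nmin ≤ (cell D S x).card) :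
    Informative q r Nmin M D S Pa j := by
  have hη := tolerance_pos hM0
  have hη1 : tolerance M ≤ 1 := by
    have := tolerance_mul hM0; nlinarith
  have hB0 : (0 : ℝ) ≤ B := by positivity
  set W := T * ((B : ℝ) + 1) ^ d with hW
  have hW0 : 0 ≤ W := by positivity
  have hWB : W * (B + 1) ≤ tolerance M * (n / 2) := by rw [hW, mul_assoc, ← pow_succ]; exact hn
  have hWn : W ≤ n / 2 := by
    have : W ≤ W * (B + 1) := le_mul_of_one_le_right hW0 (by linarith)
    have : tolerance M * (n / 2) ≤ n / 2 := mul_le_of_le_one_left (by positivity) hη1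
    linarith
  set R := (observed D S).filter (· ∉ {x : S → ℕ | T ≤ (cell D S x).card}) with hR
  have hRlt : ∀ x ∈ R, ((cell D S x).card : ℝ) ≤ T := fun x hx => by
    have := (Finset.mem_filter.1 hx).2
    rw [Set.mem_ofPred_eq, not_le] at this
    exact this.le
  have hRcard : ((R.card : ℕ) : ℝ) ≤ ((B : ℝ) + 1) ^ d := by
    have : R.card ≤ (B + 1) ^ d := (Finset.card_filter_le _ _).trans (card_observed_le hB hS)
    exact_mod_cast this
  have hRsum : ∑ x ∈ R, ((cell D S x).card : ℝ) ≤ W := by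
    calc _ ≤ ∑ _x ∈ R, T := Finset.sum_le_sum hRlt
      _ = R.card * T := by rw [Finset.sum_const, nsmul_eq_mul]
      _ ≤ ((B : ℝ) + 1) ^ d * T := by gcongr
      _ = W := mul_comm _ _
  have htc : ∀ x, (truncCount Nmin D S x : ℝ) ≤ (cell D S x).card := fun x => by
    exact_mod_cast truncCount_le Nmin D S x
  have hRtc : ∑ x ∈ R, (truncCount Nmin D S x : ℝ) ≤ W :=
    (Finset.sum_le_sum fun x _ => htc x).trans hRsum
  have htot : (∃ x ∈ R, truncCount Nmin D S x ≠ 0) →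
      tolerance M * (n / 2) ≤ tolerance M * totalCount Nmin D S := by
    rintro ⟨x, hx, hne⟩
    have h3 : Nmin ≤ (cell D S x).card := by
      by_contra h; exact hne (if_neg h)
    have h4 : (Nmin : ℝ) ≤ T := le_trans (by exact_mod_cast h3) (hRlt x hx)
    gcongr
    have h5 : (n : ℝ) = ∑ x ∈ observed D S, ((cell D S x).card : ℝ) := by
      exact_mod_cast (sum_card_cell D S).symm
    rw [← Finset.sum_filter_add_sum_filter_not _
      (· ∈ {x : S → ℕ | T ≤ (cell D S x).card})] at h5
    have h6 : ∑ x ∈ (observed D S).filter (· ∈ {x : S → ℕ | T ≤ (cell D S x).card}),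
        ((cell D S x).card : ℝ) ≤ totalCount Nmin D S := by
      rw [cast_totalCount]
      refine le_trans (Finset.sum_le_sum fun x hx => ?_) (Finset.sum_le_sum_of_subset_of_nonneg
        (Finset.filter_subset _ _) fun x _ _ => by positivity)
      have h7 := (Finset.mem_filter.1 hx).2
      rw [Set.mem_ofPred_eq] at h7
      have h8 : Nmin ≤ (cell D S x).card := by exact_mod_cast h4.trans h7
      rw [truncCount, if_pos h8]
    linarith
  have hzero : (¬ ∃ x ∈ R, truncCount Nmin D S x ≠ 0) → ∀ x ∈ R, (truncCount Nmin D S x : ℝ) = 0 :=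
    fun h x hx => by
      by_contra hne
      exact h ⟨x, hx, by exact_mod_cast hne⟩
  refine ⟨{x | T ≤ (cell D S x).card}, hacc, fun _ => ?_, fun _ => ?_, fun hne => ?_,
    fun h0 x => ?_⟩
  · by_cases hex : ∃ x ∈ R, truncCount Nmin D S x ≠ 0
    · refine le_trans ?_ (hWB.trans (htot hex))
      calc _ ≤ ∑ x ∈ R, (truncCount Nmin D S x : ℝ) * B :=
            Finset.sum_le_sum fun x _ => mul_le_mul_of_nonneg_left (hle x) (by positivity)
        _ ≤ W * (B + 1) := by
            rw [← Finset.sum_mul]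
            gcongr
            linarith
    · rw [Finset.sum_eq_zero fun x hx => by rw [hzero hex x hx, zero_mul]]
      positivity
  · by_cases hex : ∃ x ∈ R, truncCount Nmin D S x ≠ 0
    · refine hRtc.trans (le_trans ?_ (hWB.trans (htot hex)))
      exact le_mul_of_one_le_right hW0 (by linarith)
    · rw [Finset.sum_eq_zero (hzero hex)]
      positivity
  · obtain ⟨x, hx⟩ := hlarge hne
    exact totalCount_pos hN D S x hx
  · subst h0
    have hcell : cell D ∅ x = Finset.univ := by
      ext i; simp only [mem_cell, Finset.mem_univ, iff_true]; exact Subsingleton.elim _ _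
    rw [Set.mem_ofPred_eq, hcell, Finset.card_univ, Fintype.card_fin]
    have : T ≤ W := le_mul_of_one_le_right hT (one_le_pow₀ (by linarith))
    have : (0 : ℝ) ≤ n := by positivity
    linarith

end Deterministic

/-! ### Deviations uniformly over the cells -/

section Uniform
variable {p : ℕ} {G : DAG p} {μ : Measure (Fin p → ℕ)} [IsProbabilityMeasure μ]

/-- If the means are at least `γ`, the CMR coefficient is at most an `r`-th moment divided by
`γ ^ r`. -/
theorem IsGHDModel.cmr_mem_Icc {par : Fin p → GHDParam} {V γ : ℝ} (hM : IsGHDModel G μ par)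
    (hV : ExpMomentBound G μ V) (hγ : MeansAtLeast G μ γ) (hγ0 : 0 < γ) (j : Fin p) (r : ℕ) :
    0 ≤ (par j).cmr r 1 ∧ (par j).cmr r 1 ≤ r.factorial * V / γ ^ r := by
  obtain ⟨D, hD⟩ := (ae_sampleLaw_atoms (μ := μ) 1).exists
  have hx := measure_cyl_restrict_ne_zero (hD 0) (G.parents j)
  obtain ⟨θ, hθ⟩ := hM.exists_isGHD hx
  have hp := cond_isProbabilityMeasure hx
  have hint := (hV j _ hx).1
  have hV' := (hV j _ hx).2.le
  have hmean : γ ≤ ∫ y, (y j : ℝ) ^ 1 ∂(μ[|cyl (G.parents j) ((G.parents j).restrict (D 0))]) :=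
    hγ j _ hx
  have h0 : ∫ y, (y j : ℝ) ^ 1 ∂(μ[|cyl (G.parents j) ((G.parents j).restrict (D 0))]) ≠ 0 :=
    (hγ0.trans_le hmean).ne'
  have hc := GHDParam.IsGHD.cmr_nonneg hθ hint h0 r
  refine ⟨hc, ?_⟩
  rw [le_div_iff₀ (by positivity)]
  calc (par j).cmr r 1 * γ ^ r ≤ (par j).cmr r 1 *
        (∫ y, (y j : ℝ) ^ 1 ∂(μ[|cyl (G.parents j) ((G.parents j).restrict (D 0))])) ^ r := by
          gcongr
    _ = ∫ y, ((y j).descFactorial r : ℝ) ∂(μ[|cyl (G.parents j) ((G.parents j).restrict (D 0))]) :=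
        (GHDParam.IsGHD.factorial_moment_eq_cmr hθ hint h0 r).symm
    _ ≤ ∫ y, (y j : ℝ) ^ r ∂(μ[|cyl (G.parents j) ((G.parents j).restrict (D 0))]) :=
        integral_mono (integrable_descFactorial hint r) (integrable_pow hint r)
          fun y => cast_descFactorial_le_pow _ _
    _ ≤ r.factorial * V := (integral_pow_le hint r).trans (by gcongr)

/-- Some cell with at least `T` samples has an average of a truncated power that deviates by more
than `δ` from its expectation. -/
def HasDeviation {n : ℕ} (G : DAG p) (μ : Measure (Fin p → ℕ)) (r B : ℕ) (b T δ : ℝ)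
    (D : Data n p) : Prop :=
  ∃ j, ∃ S ⊆ G.parents j, ∃ x ∈ Fintype.piFinset fun _ : S => Finset.range (B + 1), ∃ k ≤ r,
    T ≤ (cell D S x).card ∧ δ * (cell D S x).card <
      |∑ i ∈ cell D S x, truncPow b j k (D i) -
        (cell D S x).card * ∫ y, truncPow b j k y ∂(μ[|cyl S x])|

/-- Union bound over the nodes, the sets of parents, their configurations in the box `{0, …, B}`
and the moments. The set of configurations does not depend on the data. -/
theorem measureReal_hasDeviation_le {V : ℝ} (hV : ExpMomentBound G μ V) {d : ℕ}
    (hd : ∀ j, (G.parents j).card ≤ d) {r B n : ℕ} {b T l δ : ℝ} (hb : 1 ≤ b) (hl : 0 ≤ l)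
    (hlb : l * b ^ r ≤ 1) (hV0 : 0 ≤ V) (hlv : l * ((2 * r).factorial * V) ≤ δ / 2) :
    (sampleLaw μ n).real {D | HasDeviation G μ r B b T δ D} ≤
      p * (2 ^ d * ((B + 1) ^ d * ((r + 1) * (2 * Real.exp (-(l * δ / 2 * T)))))) := by
  have hset : {D : Data n p | HasDeviation G μ r B b T δ D} =
      ⋃ j ∈ (Finset.univ : Finset (Fin p)), ⋃ S ∈ (G.parents j).powerset,
      ⋃ x ∈ Fintype.piFinset fun _ : S => Finset.range (B + 1), ⋃ k ∈ Finset.range (r + 1),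
      {D : Data n p | T ≤ (cell D S x).card ∧ δ * (cell D S x).card <
        |∑ i ∈ cell D S x, truncPow b j k (D i) -
          (cell D S x).card * ∫ y, truncPow b j k y ∂(μ[|cyl S x])|} := by
    ext D
    simp only [HasDeviation, Set.mem_iUnion, Set.mem_ofPred_eq, Finset.mem_univ,
      Finset.mem_powerset,
      Finset.mem_range, exists_prop, true_and, Nat.lt_succ_iff]
  rw [hset]
  have hcell : ∀ j, ∀ S ⊆ G.parents j, ∀ (x : S → ℕ) (k : ℕ), k ≤ r → (sampleLaw μ n).real
      {D : Data n p | T ≤ (cell D S x).card ∧ δ * (cell D S x).card <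
        |∑ i ∈ cell D S x, truncPow b j k (D i) -
          (cell D S x).card * ∫ y, truncPow b j k y ∂(μ[|cyl S x])|} ≤
      2 * Real.exp (-(l * δ / 2 * T)) := by
    intro j S hS x k hk
    refine measureReal_cell_deviation_le S x (truncPow b j k)
      (fun y => ⟨truncPow_nonneg _ _ _ _, truncPow_le hb j hk y⟩) ?_ hl hlb hlv
    by_cases hx : μ (cyl S x) = 0
    · rw [cond_eq_zero_of_meas_eq_zero hx, integral_zero_measure]; positivity
    · have hp := cond_isProbabilityMeasure hx
      obtain ⟨h1, h2⟩ := hV.integrable_cond hS hx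
      exact integral_truncPow_sq_le h1 h2 hk
  set e := 2 * Real.exp (-(l * δ / 2 * T))
  have he : 0 ≤ e := by positivity
  have h1 : ∀ j, ∀ S ⊆ G.parents j, ∀ x : S → ℕ, (sampleLaw μ n).real
      (⋃ k ∈ Finset.range (r + 1), {D : Data n p | T ≤ (cell D S x).card ∧
        δ * (cell D S x).card < |∑ i ∈ cell D S x, truncPow b j k (D i) -
          (cell D S x).card * ∫ y, truncPow b j k y ∂(μ[|cyl S x])|}) ≤ (r + 1) * e := by
    intro j S hS x
    refine (measureReal_biUnion_finset_le _ _).trans ((Finset.sum_le_sum fun k hk =>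
      hcell j S hS x k (Nat.lt_succ_iff.1 (Finset.mem_range.1 hk))).trans ?_)
    simp
  have h2 : ∀ j, ∀ S ⊆ G.parents j, (sampleLaw μ n).real
      (⋃ x ∈ Fintype.piFinset fun _ : S => Finset.range (B + 1), ⋃ k ∈ Finset.range (r + 1),
        {D : Data n p | T ≤ (cell D S x).card ∧
        δ * (cell D S x).card < |∑ i ∈ cell D S x, truncPow b j k (D i) -
          (cell D S x).card * ∫ y, truncPow b j k y ∂(μ[|cyl S x])|}) ≤
      (B + 1) ^ d * ((r + 1) * e) := by
    intro j S hS
    refine (measureReal_biUnion_finset_le _ _).trans ((Finset.sum_le_sum fun x _ =>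
      h1 j S hS x).trans ?_)
    rw [Finset.sum_const, nsmul_eq_mul, Fintype.card_piFinset]
    simp only [Finset.card_range, Finset.prod_const, Finset.card_univ, Fintype.card_coe]
    push_cast
    gcongr
    · have : (0 : ℝ) ≤ B := by positivity
      linarith
    · exact (Finset.card_le_card hS).trans (hd j)
  have h3 : ∀ j, (sampleLaw μ n).real (⋃ S ∈ (G.parents j).powerset,
      ⋃ x ∈ Fintype.piFinset fun _ : S => Finset.range (B + 1), ⋃ k ∈ Finset.range (r + 1),
        {D : Data n p | T ≤ (cell D S x).card ∧
        δ * (cell D S x).card < |∑ i ∈ cell D S x, truncPow b j k (D i) -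
          (cell D S x).card * ∫ y, truncPow b j k y ∂(μ[|cyl S x])|}) ≤
      2 ^ d * ((B + 1) ^ d * ((r + 1) * e)) := by
    intro j
    refine (measureReal_biUnion_finset_le _ _).trans ((Finset.sum_le_sum fun S hS =>
      h2 j S (Finset.mem_powerset.1 hS)).trans ?_)
    rw [Finset.sum_const, nsmul_eq_mul, Finset.card_powerset]
    push_cast
    gcongr
    · norm_num
    · exact hd j
  refine (measureReal_biUnion_finset_le _ _).trans ((Finset.sum_le_sum fun j _ => h3 j).trans ?_)
  simp

/-- On bounded data without large deviations, well-filled cells are on the right side of the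
threshold. -/
theorem onRightSide_of_not_hasDeviation {n : ℕ} {par : Fin p → GHDParam} {r B : ℕ}
    {M V γ b T δ : ℝ} (hM : IsGHDModel G μ par) (hV : ExpMomentBound G μ V)
    (hgap : RatioGap G μ par r M) (hγ : MeansAtLeast G μ γ) (hγ0 : 0 < γ) (hr : 2 ≤ r) (hb : 1 ≤ b)
    (hδ : 0 < δ) (hbias : (r + 1).factorial * V / b ≤ δ / 2)
    (hstab : ∀ (q : GHDParam) (m m' : ℕ → ℝ),
      |q.cmr r 1| ≤ r.factorial * V * (1 + 1 / γ ^ r) →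
      (∀ k ≤ r, |m k| ≤ r.factorial * V * (1 + 1 / γ ^ r)) →
      γ ≤ q.cmr r 1 * m 1 ^ r - ∑ k ∈ Finset.range r, (stirlingS r k : ℝ) * m k →
      (∀ k ≤ r, |m' k - m k| < δ) →
      |momentsRatio q r m' - momentsRatio q r m| < tolerance M)
    {D : Data n p} (hD : ∀ i, μ {D i} ≠ 0) (hDb : ∀ i j, (D i j : ℝ) ≤ b)
    (hDB : ∀ i j, D i j ≤ B) (hdev : ¬ HasDeviation G μ r B b T (δ / 4) D)
    {j : Fin p} {S : Finset (Fin p)} (hS : S ⊆ G.parents j) {x : S → ℕ} (hx : x ∈ observed D S)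
    (hT : T ≤ (cell D S x).card) : OnRightSide (par j) r M D S (G.parents j) j x := by
  obtain ⟨i₀, hi₀⟩ := mem_observed.1 hx
  have hμ : μ (cyl S x) ≠ 0 := hi₀ ▸ measure_cyl_restrict_ne_zero (hD i₀) S
  have hp := cond_isProbabilityMeasure hμ
  obtain ⟨hint, hVx⟩ := hV.integrable_cond hS hμ
  have hV0 : 0 ≤ V := zero_le_one.trans (hV.one_le j)
  have hmean : γ ≤ condMoment μ S x j 1 := hγ.le_condMoment hV hγ0 hS hμ
  obtain ⟨hc0, hc1⟩ := hM.cmr_mem_Icc hV hγ hγ0 j r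
  refine onRightSide_of_abs_sub_lt hM hV hgap (by omega) hS hμ
    (fun _ => (hγ0.trans_le hmean).ne') (hstab _ _ _ ?_ (fun k hk => ?_) ?_ fun k hk => ?_)
  · rw [abs_of_nonneg hc0]
    refine hc1.trans ?_
    rw [mul_add, mul_one, mul_one_div]
    have : 0 ≤ (r.factorial : ℝ) * V := by positivity
    linarith
  · rw [abs_of_nonneg (condMoment_nonneg _ _ _ _)]
    calc condMoment μ S x j k ≤ k.factorial * V :=
          (integral_pow_le hint k).trans (by gcongr)
      _ ≤ r.factorial * V * 1 := by rw [mul_one]; gcongr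
      _ ≤ _ := by
        gcongr
        have : 0 ≤ 1 / γ ^ r := by positivity
        linarith
  · exact hmean.trans (mean_le_momentsRatio_denom (X := fun y : Fin p → ℕ => y j) hint hr hc0)
  · have hc : (0 : ℝ) < (cell D S x).card := by
      exact_mod_cast (mem_observed_iff_cell_nonempty.1 hx).card_pos
    have hdev' : |∑ i ∈ cell D S x, truncPow b j k (D i) -
        (cell D S x).card * ∫ y, truncPow b j k y ∂(μ[|cyl S x])| ≤ δ / 4 * (cell D S x).card := by
      by_contra hlt
      refine hdev ⟨j, S, hS, x, ?_, k, hk, hT, not_le.1 hlt⟩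
      rw [Fintype.mem_piFinset]
      intro l
      rw [Finset.mem_range, ← hi₀]
      exact Nat.lt_succ_of_le (hDB i₀ l)
    have hsum : ∑ i ∈ cell D S x, truncPow b j k (D i) = ∑ i ∈ cell D S x, (D i j : ℝ) ^ k :=
      Finset.sum_congr rfl fun i _ => if_pos (hDb i j)
    rw [hsum] at hdev'
    have h1 : |empMoment D (cell D S x) j k - ∫ y, truncPow b j k y ∂(μ[|cyl S x])| ≤ δ / 4 := by
      have he : empMoment D (cell D S x) j k - ∫ y, truncPow b j k y ∂(μ[|cyl S x]) =
          (∑ i ∈ cell D S x, (D i j : ℝ) ^ k -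
            (cell D S x).card * ∫ y, truncPow b j k y ∂(μ[|cyl S x])) / (cell D S x).card := by
        rw [empMoment]; field_simp
      rw [he, abs_div, abs_of_pos hc, div_le_iff₀ hc]
      exact hdev'
    have h2 := (abs_integral_truncPow_sub_le hb hint hVx hk).trans hbias
    have h3 := abs_sub_le (empMoment D (cell D S x) j k)
      (∫ y, truncPow b j k y ∂(μ[|cyl S x])) (∫ y, (y j : ℝ) ^ k ∂(μ[|cyl S x]))
    change |empMoment D (cell D S x) j k - ∫ y, (y j : ℝ) ^ k ∂(μ[|cyl S x])| < δ
    linarith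

end Uniform

theorem exists_rate_mul_exp_le (Q ε : ℝ) (hQ : 0 < Q) (hε : 0 < ε) :
    ∃ s : ℝ, 0 ≤ s ∧ ∀ t : ℝ, Real.log 2 ≤ t → Q * Real.exp (-(s * t)) ≤ ε := by
  have h0 : 0 < Real.log 2 := Real.log_pos (by norm_num)
  refine ⟨max 0 (Real.log (Q / ε) / Real.log 2), le_max_left _ _, fun t ht => ?_⟩
  set s := max 0 (Real.log (Q / ε) / Real.log 2)
  have h1 : Real.log (Q / ε) ≤ s * t := by
    calc Real.log (Q / ε) = Real.log (Q / ε) / Real.log 2 * Real.log 2 := by field_simp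
      _ ≤ s * Real.log 2 := by gcongr; exact le_max_right _ _
      _ ≤ s * t := mul_le_mul_of_nonneg_left ht (le_max_left _ _)
  have h2 : Real.exp (-(s * t)) ≤ ε / Q := by
    calc Real.exp (-(s * t)) ≤ Real.exp (-Real.log (Q / ε)) := Real.exp_le_exp.2 (neg_le_neg h1)
      _ = ε / Q := by rw [Real.exp_neg, Real.exp_log (by positivity), inv_div]
  calc Q * Real.exp (-(s * t)) ≤ Q * (ε / Q) := by gcongr
    _ = ε := by field_simp

/-! ### The uniform guarantee -/

section Uniform

/-- The algorithm succeeds on bounded data without large deviations. -/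
theorem mrsRecovers_of_not_hasDeviation {p n : ℕ} {G : DAG p} {μ : Measure (Fin p → ℕ)}
    [IsProbabilityMeasure μ] {par : Fin p → GHDParam} {r B d : ℕ} {M V γ b T δ : ℝ} (hM0 : 0 < M)
    (hM : IsGHDModel G μ par) (hV : ExpMomentBound G μ V)
    (hgap : RatioGap G μ par r M) (hγ : MeansAtLeast G μ γ) (hγ0 : 0 < γ) (hr : 2 ≤ r)
    (hd : ∀ j, (G.parents j).card ≤ d) (hb : 1 ≤ b)
    (hδ : 0 < δ) (hbias : (r + 1).factorial * V / b ≤ δ / 2)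
    (hstab : ∀ (q : GHDParam) (m m' : ℕ → ℝ),
      |q.cmr r 1| ≤ r.factorial * V * (1 + 1 / γ ^ r) →
      (∀ k ≤ r, |m k| ≤ r.factorial * V * (1 + 1 / γ ^ r)) →
      γ ≤ q.cmr r 1 * m 1 ^ r - ∑ k ∈ Finset.range r, (stirlingS r k : ℝ) * m k →
      (∀ k ≤ r, |m' k - m k| < δ) →
      |momentsRatio q r m' - momentsRatio q r m| < tolerance M)
    (hn0 : 0 < n) (hT0 : 0 ≤ T) (hn : T * (B + 1) ^ (d + 1) ≤ tolerance M * (n / 2))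
    {D : Data n p} (hD : ∀ i, μ {D i} ≠ 0) (hDb : ∀ i j, (D i j : ℝ) ≤ b)
    (hDB : ∀ i j, D i j ≤ B) (hdev : ¬ HasDeviation G μ r B b T (δ / 4) D)
      {Nmin : ℕ} (hN : 1 ≤ Nmin)
    (hlarge : LargeCells G Nmin D ∨ (B + 1) ^ d * Nmin < n) : MRSRecovers G par r Nmin D := by
  refine mrsRecovers_of_informative hn0 G par r Nmin hM0 D
    (fun j I => hM.momentsRatio_nonneg hV hr hD j I) fun j S hS => ?_
  have hSd : S.card ≤ d := (Finset.card_le_card hS).trans (hd j)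
  refine informative_of_bounded hM0 hDB hSd (fun x => hM.momentsRatio_nonneg hV hr hD j _)
    (fun x => momentsRatio_empMoment_le_of_le _ hr D _ j
      (fun i _ _ => (hM.cmr_mem_Icc hV hγ hγ0 j r).1) B fun i _ => hDB i j) hT0 hn
    (fun x hx hT => onRightSide_of_not_hasDeviation hM hV hgap hγ hγ0 hr hb hδ hbias hstab hD
      hDb hDB
      hdev hS hx hT) hN fun hne => ?_
  rcases hlarge with hL | hlt
  · exact hL.exists_le hS hne
  · exact exists_le_card_cell hDB hSd hlt

/-- The events `some value exceeds b` and `some well-filled cell deviates` have probability at most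
`n p V exp(-b)` and `Q' p Λ^d exp(-a τ Λ)`. As `n`, `p` and `Λ^d / d!` are at most `exp Λ`, both
are at most `ε / 2` once the rates exceed `2` by enough, where `Λ ≥ log 2`. -/
theorem exists_uniform_mrsGuarantee {r : ℕ} (d : ℕ) (hr : 2 ≤ r) {M K ε γ : ℝ} (V : ℝ) (hM0 : 0 < M)
    (hK : 0 < K) (hε : 0 < ε) (hγ0 : 0 < γ) :
    ∃ C : ℝ, 0 < C ∧ ∀ (p : ℕ) (G : DAG p) (μ : Measure (Fin p → ℕ)) [IsProbabilityMeasure μ]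
      (par : Fin p → GHDParam), 1 ≤ p → IsGHDModel G μ par →
      (∀ j, (G.parents j).card ≤ d) → RatioGap G μ par r M → ExpMomentBound G μ V →
      MeansAtLeast G μ γ → MRSGuarantee G μ par r d K ε C := by
  by_cases hV1 : 1 ≤ V
  swap
  · exact ⟨1, one_pos, fun p G μ _ par hp _ _ _ hV _ => absurd (hV.one_le ⟨0, hp⟩) hV1⟩
  have hV0 : 0 < V := zero_lt_one.trans_le hV1
  have hη := tolerance_pos hM0
  have h0 : 0 < Real.log 2 := Real.log_pos (by norm_num)
  obtain ⟨δ, hδ, hstab⟩ := exists_momentsRatio_stable r (by omega)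
    (r.factorial * V * (1 + 1 / γ ^ r)) γ (tolerance M) hγ0 hη
  -- values are truncated at `b = c Λ` with `Λ = log (max n p)`
  obtain ⟨s₁, hs₁, hexp₁⟩ := exists_rate_mul_exp_le V (ε / 2) hV0 (by positivity)
  set c := 2 + s₁ + 1 / Real.log 2 + (r + 1).factorial * V / (Real.log 2 * (δ / 2)) with hc
  have hc0 : 0 < c := by positivity
  have hc1 : 2 + s₁ ≤ c := by
    have : 0 ≤ 1 / Real.log 2 + (r + 1).factorial * V / (Real.log 2 * (δ / 2)) := by positivity
    linarith
  have hc2 : 1 ≤ c * Real.log 2 := by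
    have h : 1 / Real.log 2 ≤ c := by
      have : 0 ≤ 2 + s₁ + (r + 1).factorial * V / (Real.log 2 * (δ / 2)) := by positivity
      linarith
    rwa [div_le_iff₀ h0] at h
  have hc3 : (r + 1).factorial * V ≤ δ / 2 * (c * Real.log 2) := by
    have h : (r + 1).factorial * V / (Real.log 2 * (δ / 2)) ≤ c := by
      have : 0 ≤ 2 + s₁ + 1 / Real.log 2 := by positivity
      linarith
    rw [div_le_iff₀ (by positivity)] at h
    linarith
  -- the exponent of the Chernoff bound is `l = l₀ / b ^ r`
  set v := (2 * r).factorial * V with hv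
  have hv0 : 0 < v := by positivity
  set l₀ := δ / (8 * v + δ) with hl₀
  have hl₀0 : 0 < l₀ := by positivity
  have hl₀1 : l₀ ≤ 1 := by rw [hl₀, div_le_one (by positivity)]; linarith
  have hl₀v : l₀ * v ≤ δ / 4 / 2 := by
    rw [hl₀, div_mul_eq_mul_div, div_le_iff₀ (by positivity)]
    nlinarith
  set Q := 2 ^ d * ((2 * c) ^ d * d.factorial) * ((r + 1) * 2) with hQ
  have hQ0 : 0 < Q := by positivity
  obtain ⟨s₂, hs₂, hexp₂⟩ := exists_rate_mul_exp_le Q (ε / 2) hQ0 (by positivity)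
  -- cells are well filled if they hold at least `T = τ Λ ^ (r + 1)` samples
  set a := l₀ / c ^ r * (δ / 4) / 2 with ha
  have ha0 : 0 < a := by positivity
  set τ := (2 + s₂) / a with hτ
  have hτ0 : 0 < τ := by positivity
  have hτa : a * τ = 2 + s₂ := by rw [hτ]; field_simp
  set C₁ := 2 * τ * (2 * c) ^ (d + 1) / (tolerance M * (Real.log 2 ^ (r - 2) * (2 * Real.log 2)))
    with hC₁
  have hC₁0 : 0 < C₁ := by positivity
  refine ⟨C₁ + K * (2 * c) ^ d, by positivity, fun p G μ _ par hp hM hd hgap hV hγ => ?_⟩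
  rcases Nat.lt_or_ge p 2 with h1 | hp2
  · exact mrsGuarantee_of_le_one (by omega) G μ par r d K hε _
  refine mrsGuarantee_of_failure_le fun n hn => ?_
  set Λ := Real.log (max n p : ℝ) with hΛ
  have hΛ2 : Real.log 2 ≤ Λ := log_two_le_log_max hp2
  have hΛ0 : 0 < Λ := h0.trans_le hΛ2
  have hrate0 : ∀ e, 0 ≤ logRate e n p r := fun e =>
    le_trans (by positivity) (le_logRate hp2 hr e)
  set b := c * Λ with hbdef
  have hb1 : 1 ≤ b := hc2.trans (by rw [hbdef]; gcongr)
  have hb0 : 0 < b := zero_lt_one.trans_le hb1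
  have hbias : (r + 1).factorial * V / b ≤ δ / 2 := by
    rw [div_le_iff₀ hb0]
    refine hc3.trans ?_
    rw [hbdef]; gcongr
  set B := ⌊b⌋₊ with hBdef
  have hB : (B : ℝ) + 1 ≤ 2 * c * Λ := by
    have := Nat.floor_le hb0.le
    rw [mul_assoc, ← hbdef]; linarith
  have hmax : Real.exp Λ = max (n : ℝ) p := by
    rw [hΛ, Real.exp_log]
    exact lt_of_lt_of_le (by positivity) (le_max_right (n : ℝ) p)
  have hnE : (n : ℝ) ≤ Real.exp Λ := hmax ▸ le_max_left _ _
  have hpE : (p : ℝ) ≤ Real.exp Λ := hmax ▸ le_max_right _ _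
  set T := τ * Λ ^ (r + 1) with hT
  set l := l₀ / b ^ r with hl
  have hl0 : 0 < l := by positivity
  have hll₀ : l ≤ l₀ := div_le_self hl₀0.le (one_le_pow₀ hb1)
  have hexpo : l * (δ / 4) / 2 * T = (2 + s₂) * Λ := by
    rw [← hτa, hl, hT, ha, hbdef, mul_pow]
    field_simp
    ring
  have hsplit : ∀ s : ℝ, Real.exp (-((2 + s) * Λ)) =
      Real.exp (-(s * Λ)) / (Real.exp Λ * Real.exp Λ) := fun s => by
    rw [← Real.exp_add, ← Real.exp_sub]; congr 1; ring
  -- some value exceeds `b`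
  have hP₁ : (sampleLaw μ n).real {D | ∃ i j, b < D i j} ≤ ε / 2 := by
    refine (measureReal_exists_gt_le hV n b).trans (le_trans ?_ (hexp₁ Λ hΛ2))
    have : Real.exp (-b) ≤ Real.exp (-((2 + s₁) * Λ)) := by
      rw [Real.exp_le_exp, neg_le_neg_iff, hbdef]; gcongr
    calc n * (p * (V * Real.exp (-b)))
        ≤ Real.exp Λ * (Real.exp Λ * (V * Real.exp (-((2 + s₁) * Λ)))) := by gcongr
      _ = V * Real.exp (-(s₁ * Λ)) := by rw [hsplit]; field_simp
  -- some well-filled cell deviates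
  have hP₂ : (sampleLaw μ n).real {D | HasDeviation G μ r B b T (δ / 4) D} ≤ ε / 2 := by
    refine (measureReal_hasDeviation_le hV hd hb1 hl0.le ?_ hV0.le ?_).trans
      (le_trans ?_ (hexp₂ Λ hΛ2))
    · rw [hl, div_mul_cancel₀ _ (by positivity)]; exact hl₀1
    · exact le_trans (by gcongr) hl₀v
    · rw [hexpo]
      have h1 : ((B : ℝ) + 1) ^ d ≤ (2 * c) ^ d * (d.factorial * Real.exp Λ) := by
        refine (pow_le_pow_left₀ (by positivity) hB d).trans ?_
        rw [mul_pow]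
        gcongr
        have := Real.pow_div_factorial_le_exp Λ hΛ0.le d
        rwa [div_le_iff₀ (by positivity), mul_comm] at this
      calc p * (2 ^ d * (((B : ℝ) + 1) ^ d * ((r + 1) * (2 * Real.exp (-((2 + s₂) * Λ))))))
          ≤ Real.exp Λ * (2 ^ d * ((2 * c) ^ d * (d.factorial * Real.exp Λ) *
            ((r + 1) * (2 * Real.exp (-((2 + s₂) * Λ)))))) := by gcongr
        _ = Q * Real.exp (-(s₂ * Λ)) := by rw [hsplit, hQ]; field_simp
  have hC₁n : C₁ * logRate (2 * r + d) n p r ≤ n := by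
    have : 0 ≤ K * (2 * c) ^ d * logRate (2 * r + d) n p r := mul_nonneg (by positivity) (hrate0 _)
    linarith
  have hKn : K * (2 * c) ^ d * logRate (2 * r + d) n p r < n := by
    have : 0 ≤ C₁ * logRate (2 * r + d) n p r := mul_nonneg hC₁0.le (hrate0 _)
    linarith
  have hn0 : 0 < n := by
    have : (0 : ℝ) < n := lt_of_le_of_lt (mul_nonneg (by positivity) (hrate0 _)) hKn
    exact_mod_cast this
  have hTn : T * (B + 1) ^ (d + 1) ≤ tolerance M * (n / 2) := by
    have h1 : Real.log 2 ^ (r - 2) * (2 * Real.log 2) * Λ ^ (r + d + 2) ≤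
        logRate (2 * r + d) n p r := by
      have he : 2 * r + d = (r - 2) + (r + d + 2) := by omega
      have h2 := le_logRate (n := n) hp2 hr (r - 2)
      rw [he, logRate_add, mul_comm]
      gcongr
    calc T * (B + 1) ^ (d + 1) ≤ T * (2 * c * Λ) ^ (d + 1) := by gcongr
      _ = tolerance M / 2 * (C₁ * (Real.log 2 ^ (r - 2) * (2 * Real.log 2) * Λ ^ (r + d + 2))) := by
          rw [hT, hC₁, mul_pow, show r + d + 2 = (r + 1) + (d + 1) by omega, pow_add Λ (r + 1)]
          field_simp
      _ ≤ tolerance M / 2 * n := by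
          gcongr
          exact le_trans (by gcongr) hC₁n
      _ = _ := by ring
  refine le_trans (ENNReal.toReal_mono (measure_ne_top _ _) (measure_mono_ae (t :=
    {D : Data n p | ∃ i j, b < D i j} ∪ {D | HasDeviation G μ r B b T (δ / 4) D}) ?_)) ?_
  swap
  · exact (measureReal_union_le _ _).trans (by linarith)
  filter_upwards [ae_sampleLaw_atoms (μ := μ) n] with D hD hbad
  by_contra hgood
  refine hbad ?_
  have hDb : ∀ i j, (D i j : ℝ) ≤ b := fun i j =>
    not_lt.1 fun h => hgood (Or.inl ⟨i, j, h⟩)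
  intro Nmin hN hor
  refine mrsRecovers_of_not_hasDeviation hM0 hM hV hgap hγ hγ0 hr hd hb1 hδ hbias hstab hn0
    (by positivity) hTn hD hDb (fun i j => Nat.le_floor (hDb i j)) (fun h => hgood (Or.inr h)) hN
    (hor.imp_right fun hle => ?_)
  have h1 : ((B : ℝ) + 1) ^ d * Nmin < n := by
    refine lt_of_le_of_lt ?_ hKn
    calc ((B : ℝ) + 1) ^ d * Nmin ≤ (2 * c * Λ) ^ d * (K * logRate (2 * r) n p r) := by gcongr
      _ = K * (2 * c) ^ d * logRate (2 * r + d) n p r := by rw [logRate_add, mul_pow]; ring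
  exact_mod_cast h1

end Uniform

theorem theorem3p2 (r d : ℕ) (hr : 2 ≤ r) (M V K ε : ℝ) (hM : 0 < M) (hK : 0 < K) (hε : 0 < ε) :
    (∀ (p : ℕ) (G : DAG p) (μ : Measure (Fin p → ℕ)) [IsProbabilityMeasure μ]
        (par : Fin p → GHDParam), 1 ≤ p → IsGHDModel G μ par →
        (∀ j, (G.parents j).card ≤ d) → RatioGap G μ par r M → ExpMomentBound G μ V →
        ∃ C : ℝ, 0 < C ∧ MRSGuarantee G μ par r d K ε C) ∧
    (∀ γ : ℝ, 0 < γ → ∃ C : ℝ, 0 < C ∧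
      ∀ (p : ℕ) (G : DAG p) (μ : Measure (Fin p → ℕ)) [IsProbabilityMeasure μ]
        (par : Fin p → GHDParam), 1 ≤ p → IsGHDModel G μ par →
        (∀ j, (G.parents j).card ≤ d) → RatioGap G μ par r M → ExpMomentBound G μ V →
        MeansAtLeast G μ γ → MRSGuarantee G μ par r d K ε C) :=
  ⟨fun _ _ _ _ _ hp hmod _ hgap hexp => exists_mrsGuarantee d hp hM hK hε hmod hexp hgap hr,
    fun _ hγ => exists_uniform_mrsGuarantee d hr V hM hK hε hγ⟩
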